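/- A plane map $\mathcal M$ is a connected graph drawn in the Euclidean plane (edges are simple polygonal arcs joining two distinct vertices and meeting other edges and the vertex set only at their ends; parallel edges are allowed), locally finite, all of whose faces, i.e. the connected components of the complement of vertices and edges, are bounded. A symmetry of $\mathcal M$ is an isometry of the plane mapping vertices to vertices and edges to edges, and $\mathcal M$ is periodic if it is invariant under translations in two non-parallel directions. A directed edge is a pair $(v,e)$ of an edge $e$ and a vertex $v$ in $e$. A harmonic vector is a real function $w$ on directed edges such that the sums of $w$ over the directed edges originating at any vertex, contained in any edge, and having any given face on the right, all vanish. $Harm^{per}(\mathcal M)$ denotes the harmonic vectors invariant under translations of $\mathcal M$ in two non-parallel directions. A symmetry $f$ of $\mathcal M$ acts on vectors by $(f_*w)(f(d))=w(d)$. Let $\mathcal M$ be a periodic plane map and $0\neq w\in Harm^{per}(\mathcal M)$. The tiling $\mathcal T(\mathcal M,w)$, unique up to translation, is given by heights $y$ of the vertices and abscissas $x$ of the faces with $y(v)-y(v')=w_d$ for each directed edge $d$ from $v$ to $v'$ and $x(F')-x(F)=w_d$, where $F$ and $F'$ are the faces on the right and on the left of $d$. To every $d$ from $v$ to $v'$ with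 $w_d>0$ corresponds the square $[x(F),x(F')]\times[y(v'),y(v)]$. To a vertex $v$ corresponds a horizontal face of the tiling: the union of the horizontal edges at height $y(v)$ of the squares of the edges at $v$. To a face $F$ corresponds a vertical face of the tiling: the union of the vertical edges at abscissa $x(F)$ of the squares of the edges bordering $F$. A symmetry of the tiling is an isometry of the plane that permutes its squares. A symmetry $f$ of $\mathcal M$ induces a symmetry of $\mathcal T(\mathcal M,w)$ if there is a symmetry $g$ of $\mathcal T(\mathcal M,w)$ such that for every edge, vertex and face $c$ of $\mathcal M$, $g$ maps the square, horizontal face or vertical face corresponding to $c$ onto the one corresponding to $f(c)$ (the square of an edge with $w_e=0$ being empty). **Proposition.** Let $\mathcal M$ be a periodic plane map. For every $0\ne w\in Harm^{per}(\mathcal M)$ the tiling $\mathcal T(\mathcal M,w)$ exists, and the following hold. (i) For every symmetry $f$ of $\mathcal M$ and every $0\neq w\in Harm^{per}(\mathcal M)$, $f$ induces a symmetry of $\mathcal T(\mathcal M,w)$ if and only if $f_*(w)=w$ or $f_*(w)=-w$. (ii) If the symmetry group of $\mathcal M$ contains a wallpaper group of type $p2$, then so does the symmetry group of $\mathcal T(\mathcal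 M,w)$ for every $0\neq w\in Harm^{per}(\mathcal M)$. (iii) If $(w^1,w^2)$ is a basis of $Harm^{per}(\mathcal M)$, then for Lebesgue-almost every $(\alpha_1,\alpha_2)\in\mathbb R^2$ the symmetry group of $\mathcal T(\mathcal M,\alpha_1w^1+\alpha_2w^2)$ is a wallpaper group of type $p1$, $p2$ or $p4$. -/

import Mathlib

open Set Filter Topology

noncomputable section

/-! The Euclidean plane is `ℂ`; its isometries are the elements of the group `ℂ ≃ᵢ ℂ`. -/

/-- The translation `z ↦ z + t`. -/
def planeTranslation (t : ℂ) : ℂ ≃ᵢ ℂ := IsometryEquiv.addRight t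

/-- The isometries `g` with `g '' S ∈ 𝒮` for `S ∈ 𝒮`, and conversely: the symmetry group of a
family `𝒮` of subsets of the plane. -/
def familySymmetryGroup (𝒮 : Set (Set ℂ)) : Subgroup (ℂ ≃ᵢ ℂ) where
  carrier := {g | (fun S : Set ℂ => g '' S) '' 𝒮 = 𝒮}
  one_mem' := by
    change (fun S : Set ℂ => id '' S) '' 𝒮 = 𝒮
    simp
  mul_mem' := by
    intro a b ha hb
    change (fun S : Set ℂ => a '' S) '' 𝒮 = 𝒮 at ha
    change (fun S : Set ℂ => b '' S) '' 𝒮 = 𝒮 at hb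
    change (fun S : Set ℂ => (a ∘ b) '' S) '' 𝒮 = 𝒮
    simp only [image_comp]
    rw [← image_image (fun S : Set ℂ => a '' S) (fun S : Set ℂ => b '' S), hb, ha]
  inv_mem' := by
    intro a ha
    change (fun S : Set ℂ => a '' S) '' 𝒮 = 𝒮 at ha
    change (fun S : Set ℂ => a.symm '' S) '' 𝒮 = 𝒮
    conv_lhs => rw [← ha]
    rw [image_image]
    simp [image_image]

/-- `G` contains translations in two non-parallel directions. -/
def HasTwoTranslations (G : Subgroup (ℂ ≃ᵢ ℂ)) : Prop :=
  ∃ t₁ t₂ : ℂ, LinearIndependent ℝ ![t₁, t₂] ∧ planeTranslation t₁ ∈ G ∧ planeTranslation t₂ ∈ G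

/-- `G` is a wallpaper group of type `p k` (for `k = 1, 2, 3, 4, 6`): its translations form a
lattice of rank two and its point group is the group of rotations of order `k`. -/
def IsWallpaperP (k : ℕ) (G : Subgroup (ℂ ≃ᵢ ℂ)) : Prop :=
  (∃ t₁ t₂ : ℂ, LinearIndependent ℝ ![t₁, t₂] ∧
    ∀ t : ℂ, planeTranslation t ∈ G ↔ ∃ m n : ℤ, t = m * t₁ + n * t₂) ∧
  (∀ g ∈ G, ∃ a b : ℂ, a ^ k = 1 ∧ ∀ z, g z = a * z + b) ∧
  (∃ g ∈ G, ∃ a b : ℂ, IsPrimitiveRoot a k ∧ ∀ z, g z = a * z + b)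

/-- `G` has at least the symmetry `p2`. -/
def ContainsP2 (G : Subgroup (ℂ ≃ᵢ ℂ)) : Prop :=
  ∃ H : Subgroup (ℂ ≃ᵢ ℂ), H ≤ G ∧ IsWallpaperP 2 H

/-- `e` is the simple polygonal arc with successive corners `p 0, …, p n`. -/
def IsPolygonalArc (n : ℕ) (p : ℕ → ℂ) (e : Set ℂ) : Prop :=
  0 < n ∧ (∀ i < n, p i ≠ p (i + 1)) ∧
  (∀ i j, i < j → j < n →
    segment ℝ (p i) (p (i + 1)) ∩ segment ℝ (p j) (p (j + 1)) = if j = i + 1 then {p j} else ∅) ∧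
  e = ⋃ i ∈ Iio n, segment ℝ (p i) (p (i + 1))

/-- The faces of a drawing with vertex set `V` and edge set `E`: the connected components of the
plane minus vertices and edges. -/
def facesOf (V : Set ℂ) (E : Set (Set ℂ)) : Set (Set ℂ) :=
  {F | ∃ z ∈ (V ∪ ⋃₀ E)ᶜ, F = connectedComponentIn (V ∪ ⋃₀ E)ᶜ z}

/-- A plane map: a connected graph drawn in the plane, locally finite, with bounded faces. An edge
is given by its point set, so parallel edges are allowed. -/
structure PlaneMap where
  V : Set ℂ
  E : Set (Set ℂ)
  /-- An edge is a polygonal arc that contains its two ends and no other vertex. -/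
  edge_arc : ∀ e ∈ E, ∃ n p, IsPolygonalArc n p e ∧ e ∩ V = {p 0, p n}
  edge_inter : ∀ e ∈ E, ∀ e' ∈ E, e ≠ e' → e ∩ e' ⊆ V
  connected : ∀ u ∈ V, ∀ v ∈ V,
    Relation.ReflTransGen (fun a b : ℂ => a ∈ V ∧ b ∈ V ∧ ∃ e ∈ E, a ∈ e ∧ b ∈ e) u v
  face_bounded : ∀ F ∈ facesOf V E, Bornology.IsBounded F
  locally_finite : ∀ K : Set ℂ, IsCompact K →
    (V ∩ K).Finite ∧ {e ∈ E | (e ∩ K).Nonempty}.Finite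

namespace PlaneMap

variable (M : PlaneMap)

/-- The set `F(M)` of faces. -/
def faces : Set (Set ℂ) := facesOf M.V M.E

/-- A directed edge: a pair `(v, e)` with `v` a vertex and `e` an edge containing `v`. -/
structure DirEdge where
  vertex : ℂ
  edge : Set ℂ
  vertex_mem : vertex ∈ M.V
  edge_mem : edge ∈ M.E
  mem : vertex ∈ edge

/-- The group of the isometries of the plane that map vertices to vertices and edges to edges. -/
def symmetryGroup : Subgroup (ℂ ≃ᵢ ℂ) :=
  familySymmetryGroup M.E ⊓ familySymmetryGroup ((fun v : ℂ => {v}) '' M.V)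

/-- `M` is invariant under translations in two non-parallel directions. -/
def IsPeriodic : Prop := HasTwoTranslations M.symmetryGroup

variable {M}

/-- The face `F` lies on the right of the directed edge `d`: at the midpoint of some segment of the
polygonal arc, run through from `d.vertex`, the points just to the right belong to `F`. -/
def OnRight (d : M.DirEdge) (F : Set ℂ) : Prop :=
  F ∈ M.faces ∧ ∃ (n : ℕ) (p : ℕ → ℂ), IsPolygonalArc n p d.edge ∧ p 0 = d.vertex ∧ ∃ i < n,
    ∀ᶠ s : ℝ in 𝓝[>] 0,
      (p i + p (i + 1)) / 2 - (s : ℂ) * (Complex.I * (p (i + 1) - p i)) ∈ F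

/-- `d'` is `d` with the direction reversed. -/
def IsReverse (d d' : M.DirEdge) : Prop := d.edge = d'.edge ∧ d.vertex ≠ d'.vertex

/-- Harmonic vectors: the sums over the directed edges originating from any vertex, contained in
any edge, or having any face on the right, are zero (these sums are finite). -/
def IsHarmonic (w : M.DirEdge → ℝ) : Prop :=
  (∀ v ∈ M.V, ∑ᶠ d ∈ {d : M.DirEdge | d.vertex = v}, w d = 0) ∧
  (∀ e ∈ M.E, ∑ᶠ d ∈ {d : M.DirEdge | d.edge = e}, w d = 0) ∧
  (∀ F ∈ M.faces, ∑ᶠ d ∈ {d : M.DirEdge | OnRight d F}, w d = 0)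

theorem symm_vertex {f : ℂ ≃ᵢ ℂ} (hf : f ∈ M.symmetryGroup) {v : ℂ} (hv : v ∈ M.V) :
    f v ∈ M.V := by
  have h : (fun S : Set ℂ => f '' S) '' ((fun v : ℂ => {v}) '' M.V) = (fun v : ℂ => {v}) '' M.V :=
    hf.2
  have h1 : f '' {v} ∈ (fun v : ℂ => ({v} : Set ℂ)) '' M.V := by
    rw [← h]
    exact mem_image_of_mem _ (mem_image_of_mem _ hv)
  obtain ⟨u, hu, hu'⟩ := h1
  rw [image_singleton] at hu'
  rwa [← singleton_injective hu']

theorem symm_edge {f : ℂ ≃ᵢ ℂ} (hf : f ∈ M.symmetryGroup) {e : Set ℂ} (he : e ∈ M.E) :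
    f '' e ∈ M.E := by
  have h : (fun S : Set ℂ => f '' S) '' M.E = M.E := hf.1
  have h1 := mem_image_of_mem (fun S : Set ℂ => f '' S) he
  rwa [h] at h1

/-- The action of a symmetry of `M` on directed edges. -/
def mapDir (f : M.symmetryGroup) (d : M.DirEdge) : M.DirEdge where
  vertex := f.1 d.vertex
  edge := f.1 '' d.edge
  vertex_mem := symm_vertex f.2 d.vertex_mem
  edge_mem := symm_edge f.2 d.edge_mem
  mem := mem_image_of_mem _ d.mem

/-- The action `f_*` of a symmetry of `M` on vectors, `(f_* w) (f d) = w d`. -/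
def pushforward (f : M.symmetryGroup) (w : M.DirEdge → ℝ) : M.DirEdge → ℝ :=
  fun d => w (mapDir f⁻¹ d)

variable (M)

/-- The space `Harm^per(M)` of the harmonic vectors that are invariant under translations of `M`
in two non-parallel directions. -/
def harmPer : Set (M.DirEdge → ℝ) :=
  {w | IsHarmonic w ∧ ∃ (f₁ f₂ : M.symmetryGroup) (t₁ t₂ : ℂ),
    f₁.1 = planeTranslation t₁ ∧ f₂.1 = planeTranslation t₂ ∧ LinearIndependent ℝ ![t₁, t₂] ∧
    pushforward f₁ w = w ∧ pushforward f₂ w = w}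

/-- `(w₁, w₂)` is a basis of `Harm^per(M)`. -/
def IsHarmPerBasis (w₁ w₂ : M.DirEdge → ℝ) : Prop :=
  LinearIndependent ℝ ![w₁, w₂] ∧ (Submodule.span ℝ {w₁, w₂} : Set (M.DirEdge → ℝ)) = M.harmPer

/-- The square tiling `T(M, w)`, which is unique up to translations, in a given position. A vertex
`v` of `M` stands for a horizontal face of the tiling, at height `height v`; a face `F` of `M`
stands for a vertical face, at abscissa `abscissa F`; an edge with `w d > 0` stands for a square of
side `w d` between the horizontal faces of the origin of `d` (above) and of its end (below), and
between the vertical faces on the right of `d` (which is the western side, as `d` points down) and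
on the left of `d`. Values off `M.V` and off `M.faces` play no role. -/
structure SquareTiling (w : M.DirEdge → ℝ) where
  height : ℂ → ℝ
  abscissa : Set ℂ → ℝ
  height_sub : ∀ d d' : M.DirEdge, IsReverse d d' → height d.vertex - height d'.vertex = w d
  abscissa_sub : ∀ (d d' : M.DirEdge) (F F' : Set ℂ), IsReverse d d' → OnRight d F →
    OnRight d' F' → abscissa F' - abscissa F = w d

namespace SquareTiling

variable {M} {w : M.DirEdge → ℝ} (T : M.SquareTiling w)

/-- The square that corresponds to the edge `e` (empty if `w` vanishes on `e`). -/
def square (e : Set ℂ) : Set ℂ :=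
  {z | ∃ (d : M.DirEdge) (F : Set ℂ), d.edge = e ∧ 0 < w d ∧ OnRight d F ∧
    z.re ∈ Icc (T.abscissa F) (T.abscissa F + w d) ∧
    z.im ∈ Icc (T.height d.vertex - w d) (T.height d.vertex)}

/-- The set of squares of the tiling. -/
def tiles : Set (Set ℂ) := {S | ∃ e ∈ M.E, S = T.square e ∧ S.Nonempty}

/-- The horizontal face that corresponds to the vertex `v`: the union of the horizontal edges, at
the height of `v`, of the squares whose edge in `M` contains `v`. -/
def horizontalFace (v : ℂ) : Set ℂ :=
  {z | z.im = T.height v ∧ ∃ d : M.DirEdge, d.vertex = v ∧ z ∈ T.square d.edge}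

/-- The vertical face that corresponds to the face `F`: the union of the vertical edges, at the
abscissa of `F`, of the squares whose edge in `M` borders `F`. -/
def verticalFace (F : Set ℂ) : Set ℂ :=
  {z | z.re = T.abscissa F ∧ ∃ d : M.DirEdge, OnRight d F ∧ z ∈ T.square d.edge}

/-- The group of the isometries of the plane that map squares of the tiling to such squares. -/
def symmetryGroup : Subgroup (ℂ ≃ᵢ ℂ) := familySymmetryGroup T.tiles

/-- The symmetry `f` of `M` induces a symmetry of the tiling: some symmetry `g` of the tiling acts
on the squares, horizontal faces and vertical faces in the same way as `f` acts on the edges,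
vertices and faces of `M` to which they correspond. -/
def Induces (f : M.symmetryGroup) : Prop :=
  ∃ g ∈ T.symmetryGroup,
    (∀ e ∈ M.E, g '' T.square e = T.square (f.1 '' e)) ∧
    (∀ v ∈ M.V, g '' T.horizontalFace v = T.horizontalFace (f.1 v)) ∧
    (∀ F ∈ M.faces, g '' T.verticalFace F = T.verticalFace (f.1 '' F))

end SquareTiling

end PlaneMap

end

/-! ### Segments and polygonal arcs -/

/-! Existence of the tiling is a statement of planar homology. By linear algebra
(`exists_potential`), a function on edges is a difference of potentials as soon as it kills every
finite real cycle. For the heights, let `c` be such a cycle. The sum of `c e` times the integral of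
`1 / (ζ - z)` along `e` has zero derivative in `z` off the cycle, since the contributions of the
ends cancel; it tends to 0 at infinity and jumps by `2πi * c e` across `e`. Its values on the faces,
a winding number up to `2πi`, exhibit `c` as a boundary of faces, and the pairing of `c` with `w`
vanishes because the face sums of `w` do (`exists_height`). For the abscissas the roles are
exchanged: the same integrals with coefficients `w`, corrected by logarithms for the vertices
outside a large disc, are constant on the faces in the disc and jump by `2πi * w` across edges,
because the vertex sums vanish (`exists_abscissa`). Beforehand the side faces of an edge must be
shown to be well defined: `arc_sides` and `onRight_iff_sideR` follow one face along the arc.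
Induction over the map then uses only the moves `rot` and `rev` (`dirEdge_induction`).

For (i), if `f` multiplies `w` by a sign, connectivity shows that heights and abscissas transform by
affine maps of slope `±1`, which assemble into an isometry (`induced_of_shift`). Conversely an
induced isometry maps some nondegenerate horizontal segment to a horizontal one, so it acts on
heights with one slope `±1`, and differences of heights are the weights (`pushforward_of_induces`).

For (ii), the maximum principle shows that a symmetry `f` multiplies `w` by `ε` once `y ∘ f - ε y`
is periodic for the height `y` (`SquareTiling.weight_mapDir`). Translations commute with each other
and half-turns invert them, so translations fix `w` and half-turns negate it. Translations of the
map induce translations of the tiling, and `linearIndependent_periods`, a maximum principle for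
combinations of height and abscissa, shows that the rank does not drop. Together these give a `p2`
group.

For (iii), the period vectors depend linearly on the coefficients, so for almost all coefficients no
nonzero period lies on a symmetry axis of a square (`ae_isGeneric`). A reflection or glide
reflection would produce such a period. Finiteness of the tiles modulo periods makes the full
translation group a lattice (`exists_multiple_mem`, `exists_lattice_basis`), and the remaining
linear parts are the rotations that preserve the axes, of order 1, 2 or 4. -/

theorem eventually_add_mem_segment_iff {a b : ℂ} (hab : a ≠ b) :
    ∀ᶠ z : ℂ in 𝓝[≠] 0, (a + z ∈ segment ℝ a b ↔ z.arg = (b - a).arg) := by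
  have hb : b - a ≠ 0 := sub_ne_zero.2 hab.symm
  have hpos : 0 < ‖b - a‖ := norm_pos_iff.2 hb
  have h1 : ∀ᶠ z : ℂ in 𝓝[≠] 0, ‖z‖ < ‖b - a‖ := by
    apply Filter.Eventually.filter_mono nhdsWithin_le_nhds
    have : Tendsto (fun z : ℂ => ‖z‖) (𝓝 0) (𝓝 0) := by
      simpa using (continuous_norm (E := ℂ)).tendsto 0
    exact this.eventually_lt_const hpos
  filter_upwards [h1, self_mem_nhdsWithin] with z hz hz0
  rw [segment_eq_image']
  constructor
  · rintro ⟨t, ht, h⟩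
    have hzt : t • (b - a) = z := add_left_cancel h
    have ht0 : 0 < t := by
      rcases ht.1.eq_or_lt with h0 | h0
      · rw [← h0, zero_smul] at hzt
        exact absurd hzt.symm hz0
      · exact h0
    rw [← hzt, Complex.real_smul, Complex.arg_real_mul _ ht0]
  · intro h
    rw [Complex.arg_eq_arg_iff hz0 hb] at h
    have hzpos : 0 < ‖z‖ := norm_pos_iff.2 hz0
    refine ⟨‖z‖ / ‖b - a‖, ⟨by positivity, (div_le_one hpos).2 hz.le⟩, ?_⟩
    have e1 : (‖z‖ : ℂ) ≠ 0 := by exact_mod_cast hzpos.ne'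
    have e2 : (‖b - a‖ : ℂ) ≠ 0 := by exact_mod_cast hpos.ne'
    simp only [Complex.real_smul]
    push_cast
    generalize (‖b - a‖ : ℂ) = N at h e2 ⊢
    rw [← h]
    field_simp

theorem tendsto_const_add_nhds_zero (q : ℂ) : Tendsto (fun z : ℂ => q + z) (𝓝 0) (𝓝 q) := by
  have h : Continuous fun z : ℂ => q + z := by fun_prop
  exact h.tendsto' 0 q (add_zero q)

theorem isClosed_segment (a b : ℂ) : IsClosed (segment ℝ a b) := by
  rw [← convexHull_pair]
  exact ((Set.toFinite {a, b}).isCompact_convexHull ℝ).isClosed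

theorem isCompact_segment (a b : ℂ) : IsCompact (segment ℝ a b) := by
  rw [← convexHull_pair]
  exact (Set.toFinite {a, b}).isCompact_convexHull ℝ

namespace IsPolygonalArc

variable {n : ℕ} {p : ℕ → ℂ} {e : Set ℂ}

theorem mem_iff (h : IsPolygonalArc n p e) {z : ℂ} :
    z ∈ e ↔ ∃ i < n, z ∈ segment ℝ (p i) (p (i + 1)) := by
  rw [h.2.2.2]
  simp

theorem isCompact (h : IsPolygonalArc n p e) : IsCompact e := by
  rw [h.2.2.2]
  exact (Set.finite_Iio n).isCompact_biUnion fun i _ => isCompact_segment _ _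

/-- Segments are closed and finite in number, so those that miss `q` miss a neighbourhood of it. The
shape of the arc at `q` can thus be read off from the segments through `q`. -/
theorem eventually_mem_iff (h : IsPolygonalArc n p e) (q : ℂ) :
    ∀ᶠ z in 𝓝 q, (z ∈ e ↔ ∃ i < n, q ∈ segment ℝ (p i) (p (i + 1)) ∧
      z ∈ segment ℝ (p i) (p (i + 1))) := by
  have h1 : ∀ᶠ z in 𝓝 q, ∀ i ∈ Finset.range n, z ∈ segment ℝ (p i) (p (i + 1)) →
      q ∈ segment ℝ (p i) (p (i + 1)) := by
    rw [Filter.eventually_all_finset]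
    intro i _
    by_cases hq : q ∈ segment ℝ (p i) (p (i + 1))
    · exact Eventually.of_forall fun _ _ => hq
    · filter_upwards [(isClosed_segment (p i) (p (i + 1))).isOpen_compl.mem_nhds hq] with z hz hz'
      exact absurd hz' hz
  filter_upwards [h1] with z hz
  rw [h.mem_iff]
  constructor
  · rintro ⟨i, hi, hzi⟩
    exact ⟨i, hi, hz i (Finset.mem_range.2 hi) hzi, hzi⟩
  · rintro ⟨i, hi, _, hzi⟩
    exact ⟨i, hi, hzi⟩

theorem eq_of_mem_segment (h : IsPolygonalArc n p e) {i j : ℕ} (hij : i < j) (hj : j < n) {z : ℂ}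
    (hi : z ∈ segment ℝ (p i) (p (i + 1))) (hzj : z ∈ segment ℝ (p j) (p (j + 1))) :
    j = i + 1 ∧ z = p j := by
  have h1 := h.2.2.1 i j hij hj
  have h2 : z ∈ segment ℝ (p i) (p (i + 1)) ∩ segment ℝ (p j) (p (j + 1)) := ⟨hi, hzj⟩
  rw [h1] at h2
  split_ifs at h2 with hc
  · exact ⟨hc, h2⟩
  · exact absurd h2 (notMem_empty _)

theorem corner_mem_segment_iff (h : IsPolygonalArc n p e) {i j : ℕ} (hi : i < n) (hj : j ≤ n) :
    p j ∈ segment ℝ (p i) (p (i + 1)) ↔ j = i ∨ j = i + 1 := by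
  constructor
  · intro hm
    by_contra hc
    push Not at hc
    rcases lt_trichotomy i j with hij | hij | hij
    · obtain ⟨k, rfl⟩ : ∃ k, j = k + 1 := ⟨j - 1, by omega⟩
      have h1 := (h.eq_of_mem_segment (i := i) (j := k) (by omega) (by omega) hm
        (right_mem_segment ℝ _ _)).2
      exact h.2.1 k (by omega) h1.symm
    · exact hc.1 hij.symm
    · obtain ⟨h1, h2⟩ := h.eq_of_mem_segment hij hi (left_mem_segment ℝ _ _) hm
      subst h1
      exact h.2.1 j (by omega) h2
  · rintro (rfl | rfl)
    · exact left_mem_segment ℝ _ _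
    · exact right_mem_segment ℝ _ _

theorem eq_of_mem_openSegment (h : IsPolygonalArc n p e) {i k : ℕ} (hi : i < n) (hk : k < n)
    {z : ℂ} (hz : z ∈ openSegment ℝ (p i) (p (i + 1))) (hzk : z ∈ segment ℝ (p k) (p (k + 1))) :
    k = i := by
  have hne := h.2.1 i hi
  have hz' := openSegment_subset_segment ℝ _ _ hz
  rcases lt_trichotomy k i with hki | hki | hki
  · obtain ⟨h1, h2⟩ := h.eq_of_mem_segment hki hi hzk hz'
    subst h2
    exact absurd (left_mem_openSegment_iff.1 hz) hne
  · exact hki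
  · obtain ⟨h1, h2⟩ := h.eq_of_mem_segment hki hk hz' hzk
    subst h2
    subst h1
    exact absurd (right_mem_openSegment_iff.1 hz) hne

theorem corner_ne (h : IsPolygonalArc n p e) {i j : ℕ} (hij : i < j) (hj : j ≤ n) : p i ≠ p j := by
  intro he
  have h1 := (h.corner_mem_segment_iff (i := i) (by omega) hj).1
    (he ▸ left_mem_segment ℝ (p i) (p (i + 1)))
  rcases h1 with h1 | h1
  · omega
  · subst h1
    exact h.2.1 i (by omega) he

theorem corner_mem (h : IsPolygonalArc n p e) {j : ℕ} (hj : j ≤ n) : p j ∈ e := by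
  rw [h.mem_iff]
  rcases Nat.eq_zero_or_pos j with rfl | hj0
  · exact ⟨0, h.1, left_mem_segment ℝ _ _⟩
  · obtain ⟨k, rfl⟩ : ∃ k, j = k + 1 := ⟨j - 1, by omega⟩
    exact ⟨k, hj, right_mem_segment ℝ _ _⟩

theorem reverse (h : IsPolygonalArc n p e) : IsPolygonalArc n (fun i => p (n - i)) e := by
  have key : ∀ i < n, segment ℝ (p (n - i)) (p (n - (i + 1))) =
      segment ℝ (p (n - (i + 1))) (p (n - (i + 1) + 1)) := by
    intro i hi
    rw [segment_symm, show n - (i + 1) + 1 = n - i by omega]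
  refine ⟨h.1, ?_, ?_, ?_⟩
  · intro i hi
    have := h.2.1 (n - (i + 1)) (by omega)
    rw [show n - (i + 1) + 1 = n - i by omega] at this
    exact this.symm
  · intro i j hij hj
    simp only
    rw [key i (by omega), key j hj, inter_comm, h.2.2.1 _ _ (by omega) (by omega)]
    by_cases hc : j = i + 1
    · rw [if_pos (by omega), if_pos hc]
      rw [show n - (i + 1) = n - j by omega]
    · rw [if_neg (by omega), if_neg hc]
  · ext z
    rw [h.mem_iff]
    simp only [mem_iUnion, mem_Iio, exists_prop]
    constructor
    · rintro ⟨i, hi, hz⟩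
      refine ⟨n - (i + 1), by omega, ?_⟩
      rw [key _ (by omega), show n - (n - (i + 1) + 1) = i by omega]
      exact hz
    · rintro ⟨i, hi, hz⟩
      rw [key i hi] at hz
      exact ⟨_, by omega, hz⟩

theorem eventually_mem_iff_start (h : IsPolygonalArc n p e) :
    ∀ᶠ z : ℂ in 𝓝[≠] 0, (p 0 + z ∈ e ↔ z.arg = (p 1 - p 0).arg) := by
  have h1 := eventually_add_mem_segment_iff (h.2.1 0 h.1)
  have h2 : ∀ᶠ z : ℂ in 𝓝[≠] 0, (p 0 + z ∈ e ↔ ∃ i < n, p 0 ∈ segment ℝ (p i) (p (i + 1)) ∧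
      p 0 + z ∈ segment ℝ (p i) (p (i + 1))) := by
    apply Filter.Eventually.filter_mono nhdsWithin_le_nhds
    exact (tendsto_const_add_nhds_zero _).eventually (h.eventually_mem_iff (p 0))
  filter_upwards [h1, h2] with z hz1 hz2
  rw [hz2, ← hz1]
  constructor
  · rintro ⟨i, hi, h3, h4⟩
    rw [h.corner_mem_segment_iff hi (Nat.zero_le _)] at h3
    obtain rfl : i = 0 := by omega
    exact h4
  · intro h3
    exact ⟨0, h.1, left_mem_segment ℝ _ _, h3⟩

theorem eventually_mem_iff_corner (h : IsPolygonalArc n p e) {i : ℕ} (hi : i + 1 < n) :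
    ∀ᶠ z : ℂ in 𝓝[≠] 0, (p (i + 1) + z ∈ e ↔
      z.arg = (p i - p (i + 1)).arg ∨ z.arg = (p (i + 2) - p (i + 1)).arg) := by
  have h0 := eventually_add_mem_segment_iff (h.2.1 i (by omega)).symm
  have h1 := eventually_add_mem_segment_iff (h.2.1 (i + 1) hi)
  have h2 : ∀ᶠ z : ℂ in 𝓝[≠] 0, (p (i + 1) + z ∈ e ↔
      ∃ k < n, p (i + 1) ∈ segment ℝ (p k) (p (k + 1)) ∧
      p (i + 1) + z ∈ segment ℝ (p k) (p (k + 1))) := by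
    apply Filter.Eventually.filter_mono nhdsWithin_le_nhds
    exact (tendsto_const_add_nhds_zero _).eventually (h.eventually_mem_iff (p (i + 1)))
  filter_upwards [h0, h1, h2] with z hz0 hz1 hz2
  rw [hz2, ← hz0, ← hz1]
  constructor
  · rintro ⟨k, hk, h3, h4⟩
    rw [h.corner_mem_segment_iff hk (by omega)] at h3
    rcases h3 with h3 | h3
    · subst h3
      exact Or.inr h4
    · obtain rfl : k = i := by omega
      exact Or.inl (segment_symm ℝ (p k) (p (k + 1)) ▸ h4)
  · rintro (h3 | h3)
    · exact ⟨i, by omega, right_mem_segment ℝ _ _, segment_symm ℝ (p i) (p (i + 1)) ▸ h3⟩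
    · exact ⟨i + 1, hi, left_mem_segment ℝ _ _, h3⟩

/-- With equal directions the two segments would overlap beyond their common corner, the only point
they may share. This keeps the two directions at a corner distinct. -/
theorem corner_arg_ne (h : IsPolygonalArc n p e) {i : ℕ} (hi : i + 1 < n) :
    (p i - p (i + 1)).arg ≠ (p (i + 2) - p (i + 1)).arg := by
  intro he
  have h0 := eventually_add_mem_segment_iff (h.2.1 i (by omega)).symm
  have h1 := eventually_add_mem_segment_iff (h.2.1 (i + 1) hi)
  rw [← he] at h1
  have hne : p i - p (i + 1) ≠ 0 := sub_ne_zero.2 (h.2.1 i (by omega))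
  have h2 : Tendsto (fun t : ℝ => (t : ℂ) * (p i - p (i + 1))) (𝓝[>] 0) (𝓝[≠] 0) := by
    apply tendsto_nhdsWithin_iff.2
    constructor
    · have : Continuous fun t : ℝ => (t : ℂ) * (p i - p (i + 1)) := by fun_prop
      exact (this.tendsto' 0 0 (by simp)).mono_left nhdsWithin_le_nhds
    · filter_upwards [self_mem_nhdsWithin] with t ht
      have ht' : (t : ℂ) ≠ 0 := by exact_mod_cast (ne_of_gt ht)
      exact mul_ne_zero ht' hne
  obtain ⟨t, ht, h3, h4⟩ := (Eventually.and
    (show ∀ᶠ t : ℝ in 𝓝[>] 0, 0 < t from self_mem_nhdsWithin)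
    ((h2.eventually h0).and (h2.eventually h1))).exists
  have ha := Complex.arg_real_mul (p i - p (i + 1)) ht
  have := h.eq_of_mem_segment (Nat.lt_succ_self i) hi
    (segment_symm ℝ (p i) (p (i + 1)) ▸ h3.2 ha) (h4.2 ha)
  have h5 : (t : ℂ) * (p i - p (i + 1)) = 0 := by
    have h6 := this.2
    simpa using h6
  have ht' : (t : ℂ) ≠ 0 := by exact_mod_cast ht.ne'
  exact mul_ne_zero ht' hne h5

end IsPolygonalArc

/-! ### Faces and sectors -/

/-- The counterclockwise angle from direction `θ` to direction `θ'`, in `(0, 2π]`. -/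
noncomputable def angularGap (θ θ' : ℝ) : ℝ := if θ < θ' then θ' - θ else θ' - θ + 2 * Real.pi

namespace PlaneMap

variable (M : PlaneMap)

/-- The point set of the drawing. -/
def graph : Set ℂ := M.V ∪ ⋃₀ M.E

variable {M}

theorem isCompact_edge {e : Set ℂ} (he : e ∈ M.E) : IsCompact e := by
  obtain ⟨n, p, hp, _⟩ := M.edge_arc e he
  exact hp.isCompact

theorem finite_vertices_inter {K : Set ℂ} (hK : IsCompact K) : (M.V ∩ K).Finite :=
  (M.locally_finite K hK).1

theorem finite_edges_meeting {K : Set ℂ} (hK : IsCompact K) :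
    {e ∈ M.E | (e ∩ K).Nonempty}.Finite := (M.locally_finite K hK).2

/-- Local finiteness: in a closed ball around `q` only finitely many vertices and edges matter, and
those that avoid `q` stay at positive distance from it. -/
theorem eventually_mem_edge (q : ℂ) :
    ∀ᶠ z in 𝓝 q, (z ∈ M.V → z = q) ∧ ∀ e ∈ M.E, z ∈ e → q ∈ e := by
  have hK : IsCompact (Metric.closedBall q 1) := isCompact_closedBall q 1
  have hb : ∀ᶠ z in 𝓝 q, z ∈ Metric.closedBall q 1 := Metric.closedBall_mem_nhds q one_pos
  have h1 : ∀ᶠ z in 𝓝 q, ∀ v ∈ M.V ∩ Metric.closedBall q 1, z = v → v = q := by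
    rw [Filter.eventually_all_finite (finite_vertices_inter hK)]
    intro v _
    by_cases hv : v = q
    · exact Eventually.of_forall fun _ _ => hv
    · filter_upwards [isOpen_compl_singleton.mem_nhds (show q ∈ ({v} : Set ℂ)ᶜ from Ne.symm hv)]
        with z hz hz'
      exact absurd hz' hz
  have h2 : ∀ᶠ z in 𝓝 q, ∀ e ∈ {e ∈ M.E | (e ∩ Metric.closedBall q 1).Nonempty},
      z ∈ e → q ∈ e := by
    rw [Filter.eventually_all_finite (finite_edges_meeting hK)]
    intro e he
    by_cases hq : q ∈ e
    · exact Eventually.of_forall fun _ _ => hq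
    · filter_upwards [(isCompact_edge he.1).isClosed.isOpen_compl.mem_nhds hq] with z hz hz'
      exact absurd hz' hz
  filter_upwards [hb, h1, h2] with z hz hz1 hz2
  exact ⟨fun hv => hz1 z ⟨hv, hz⟩ rfl, fun e he hze => hz2 e ⟨he, z, hze, hz⟩ hze⟩

theorem isClosed_graph : IsClosed M.graph := by
  rw [← isOpen_compl_iff, isOpen_iff_mem_nhds]
  intro q hq
  filter_upwards [M.eventually_mem_edge q] with z hz hzg
  apply hq
  rcases hzg with hv | ⟨e, he, hze⟩
  · exact hz.1 hv ▸ Or.inl hv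
  · exact Or.inr ⟨e, he, hz.2 e he hze⟩

theorem edge_subset_graph {e : Set ℂ} (he : e ∈ M.E) : e ⊆ M.graph :=
  fun _ hz => Or.inr ⟨e, he, hz⟩

theorem face_subset {F : Set ℂ} (hF : F ∈ M.faces) : F ⊆ M.graphᶜ := by
  obtain ⟨z, hz, rfl⟩ := hF
  exact connectedComponentIn_subset _ _

theorem isOpen_face {F : Set ℂ} (hF : F ∈ M.faces) : IsOpen F := by
  obtain ⟨z, hz, rfl⟩ := hF
  exact M.isClosed_graph.isOpen_compl.connectedComponentIn

theorem isPreconnected_face {F : Set ℂ} (hF : F ∈ M.faces) : IsPreconnected F := by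
  obtain ⟨z, hz, rfl⟩ := hF
  exact isPreconnected_connectedComponentIn

theorem face_nonempty {F : Set ℂ} (hF : F ∈ M.faces) : F.Nonempty := by
  obtain ⟨z, hz, rfl⟩ := hF
  exact ⟨z, mem_connectedComponentIn hz⟩

theorem subset_face {F S : Set ℂ} (hF : F ∈ M.faces) (hS : IsPreconnected S)
    (hSg : S ⊆ M.graphᶜ) (hn : (S ∩ F).Nonempty) : S ⊆ F := by
  obtain ⟨z, hz, rfl⟩ := hF
  obtain ⟨x, hxS, hxF⟩ := hn
  rw [connectedComponentIn_eq hxF]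
  exact hS.subset_connectedComponentIn hxS hSg

theorem face_eq {F F' : Set ℂ} (hF : F ∈ M.faces) (hF' : F' ∈ M.faces) {z : ℂ} (hz : z ∈ F)
    (hz' : z ∈ F') : F = F' :=
  (subset_face hF' (isPreconnected_face hF) (face_subset hF) ⟨z, hz, hz'⟩).antisymm
    (subset_face hF (isPreconnected_face hF') (face_subset hF') ⟨z, hz', hz⟩)

theorem exists_face_of_preconnected {S : Set ℂ} (hS : IsPreconnected S)
    (hSg : S ⊆ M.graphᶜ) (hn : S.Nonempty) : ∃ F ∈ M.faces, S ⊆ F := by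
  obtain ⟨z, hz⟩ := hn
  exact ⟨_, ⟨z, hSg hz, rfl⟩, hS.subset_connectedComponentIn hz hSg⟩

variable (M) in
/-- `F` contains the directions just clockwise of `θ` at `q`. -/
def SideR (q : ℂ) (θ : ℝ) (F : Set ℂ) : Prop :=
  F ∈ M.faces ∧ ∀ᶠ x : ℝ × ℝ in 𝓝[>] 0 ×ˢ 𝓝[<] θ, q + x.1 * Complex.exp (x.2 * Complex.I) ∈ F

variable (M) in
/-- `F` contains the directions just counterclockwise of `θ` at `q`. -/
def SideL (q : ℂ) (θ : ℝ) (F : Set ℂ) : Prop :=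
  F ∈ M.faces ∧ ∀ᶠ x : ℝ × ℝ in 𝓝[>] 0 ×ˢ 𝓝[>] θ, q + x.1 * Complex.exp (x.2 * Complex.I) ∈ F

theorem SideR.unique {q : ℂ} {θ : ℝ} {F F' : Set ℂ} (h : M.SideR q θ F) (h' : M.SideR q θ F') :
    F = F' := by
  obtain ⟨x, hx, hx'⟩ := (h.2.and h'.2).exists
  exact face_eq h.1 h'.1 hx hx'

theorem SideL.unique {q : ℂ} {θ : ℝ} {F F' : Set ℂ} (h : M.SideL q θ F) (h' : M.SideL q θ F') :
    F = F' := by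
  obtain ⟨x, hx, hx'⟩ := (h.2.and h'.2).exists
  exact face_eq h.1 h'.1 hx hx'

theorem arg_mul_exp {ρ φ : ℝ} (hρ : 0 < ρ) (h1 : -Real.pi < φ) (h2 : φ ≤ Real.pi) :
    ((ρ : ℂ) * Complex.exp (φ * Complex.I)).arg = φ := by
  rw [Complex.exp_mul_I, ← Complex.ofReal_cos, ← Complex.ofReal_sin]
  exact_mod_cast Complex.arg_mul_cos_add_sin_mul_I hρ ⟨h1, h2⟩

theorem arg_mul_exp' {ρ φ : ℝ} (hρ : 0 < ρ) (h1 : Real.pi < φ) (h2 : φ ≤ 3 * Real.pi) :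
    ((ρ : ℂ) * Complex.exp (φ * Complex.I)).arg = φ - 2 * Real.pi := by
  have : Complex.exp (φ * Complex.I) = Complex.exp ((φ - 2 * Real.pi : ℝ) * Complex.I) := by
    push_cast
    rw [sub_mul, Complex.exp_sub, Complex.exp_two_pi_mul_I, div_one]
  rw [this, arg_mul_exp hρ (by linarith) (by linarith)]

theorem angularGap_pos {θ θ' : ℝ} (h : θ ∈ Ioc (-Real.pi) Real.pi)
    (h' : θ' ∈ Ioc (-Real.pi) Real.pi) : 0 < angularGap θ θ' := by
  unfold angularGap
  split_ifs with hc
  · linarith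
  · linarith [h.2, h'.1]

theorem exp_add_angularGap (θ θ' : ℝ) :
    Complex.exp ((θ + angularGap θ θ' : ℝ) * Complex.I) = Complex.exp (θ' * Complex.I) := by
  unfold angularGap
  split_ifs with hc
  · congr 2
    push_cast
    ring
  · have : ((θ + (θ' - θ + 2 * Real.pi) : ℝ) : ℂ) * Complex.I =
        θ' * Complex.I + 2 * Real.pi * Complex.I := by
      push_cast
      ring
    rw [this, Complex.exp_add, Complex.exp_two_pi_mul_I, mul_one]

/-- The sector between two consecutive directions at `q` lies in one face. -/
theorem exists_sector {q : ℂ} {Θ : Set ℝ} (hΘ : Θ ⊆ Ioc (-Real.pi) Real.pi)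
    (hq : ∀ᶠ z : ℂ in 𝓝[≠] 0, (q + z ∈ M.graph ↔ z.arg ∈ Θ)) {θ θ' : ℝ} (hθ : θ ∈ Θ) (hθ' : θ' ∈ Θ)
    (hmin : ∀ ψ ∈ Θ, angularGap θ θ' ≤ angularGap θ ψ) :
    ∃ F, M.SideL q θ F ∧ M.SideR q θ' F := by
  set γ := angularGap θ θ' with hγ
  have hγ0 : 0 < γ := angularGap_pos (hΘ hθ) (hΘ hθ')
  -- The direction `θ` itself competes, with gap `2π`; this is the actual gap when `Θ` is a single
  -- direction and the sector is a slit disc.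
  have hγ2 : γ ≤ 2 * Real.pi := by
    have : γ ≤ angularGap θ θ := hmin θ hθ
    simpa [angularGap] using this
  rw [eventually_nhdsWithin_iff, Metric.eventually_nhds_iff] at hq
  obtain ⟨r, hr, hq⟩ := hq
  let f : ℝ × ℝ → ℂ := fun x => q + x.1 * Complex.exp (x.2 * Complex.I)
  have hf : Continuous f := by fun_prop
  have hS : IsPreconnected (f '' (Ioo 0 r ×ˢ Ioo θ (θ + γ))) :=
    (isPreconnected_Ioo.prod isPreconnected_Ioo).image f hf.continuousOn
  have hg : f '' (Ioo 0 r ×ˢ Ioo θ (θ + γ)) ⊆ M.graphᶜ := by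
    rintro _ ⟨⟨ρ, φ⟩, ⟨⟨h1, h2⟩, h3, h4⟩, rfl⟩ hmem
    simp only at h1 h2 h3 h4
    have hz0 : (ρ : ℂ) * Complex.exp (φ * Complex.I) ≠ 0 :=
      mul_ne_zero (by exact_mod_cast h1.ne') (Complex.exp_ne_zero _)
    have hn : ‖(ρ : ℂ) * Complex.exp (φ * Complex.I)‖ < r := by
      rw [norm_mul, Complex.norm_exp_ofReal_mul_I, mul_one, Complex.norm_real, Real.norm_eq_abs,
        abs_of_pos h1]
      exact h2
    have harg := (hq (by simpa [dist_eq_norm] using hn) hz0).1 hmem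
    have hθI := hΘ hθ
    rcases le_or_gt φ Real.pi with hφ | hφ
    · rw [arg_mul_exp h1 (by linarith [hθI.1]) hφ] at harg
      have := hmin φ harg
      rw [angularGap, if_pos h3] at this
      linarith
    · rw [arg_mul_exp' h1 hφ (by linarith [hθI.2])] at harg
      have := hmin _ harg
      rw [angularGap, if_neg (by linarith)] at this
      linarith
  obtain ⟨F, hF, hSF⟩ := exists_face_of_preconnected hS hg
    ⟨_, mem_image_of_mem f (show ((r / 2, θ + γ / 2) : ℝ × ℝ) ∈ Ioo 0 r ×ˢ Ioo θ (θ + γ) from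
      ⟨⟨by simp only; linarith, by simp only; linarith⟩,
        by simp only; linarith, by simp only; linarith⟩)⟩
  refine ⟨F, ⟨hF, ?_⟩, hF, ?_⟩
  · filter_upwards [prod_mem_prod (Ioo_mem_nhdsGT hr) (Ioo_mem_nhdsGT (by linarith : θ < θ + γ))]
      with x hx
    exact hSF (mem_image_of_mem f hx)
  · filter_upwards [prod_mem_prod (Ioo_mem_nhdsGT hr) (Ioo_mem_nhdsLT (by linarith : θ' - γ < θ'))]
      with x hx
    have hx2 := hx.2
    -- The shift `θ + γ - θ'` is `0` or `2π`: it moves angles just below `θ'` into the parametrised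
    -- sector without changing the point.
    have h1 : f (x.1, x.2 + (θ + γ - θ')) = q + x.1 * Complex.exp (x.2 * Complex.I) := by
      simp only [f]
      have h2 := exp_add_angularGap θ θ'
      rw [← hγ] at h2
      have h3 : ((x.2 + (θ + γ - θ') : ℝ) : ℂ) * Complex.I =
          x.2 * Complex.I + ((θ + γ : ℝ) * Complex.I - θ' * Complex.I) := by
        push_cast
        ring
      rw [h3, Complex.exp_add, Complex.exp_sub, h2, div_self (Complex.exp_ne_zero _), mul_one]
    rw [← h1]
    exact hSF (mem_image_of_mem f ⟨hx.1, by simp only; linarith [hx2.1],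
      by simp only; linarith [hx2.2]⟩)

theorem exists_next {Θ : Set ℝ} (hfin : Θ.Finite) {θ : ℝ} (hθ : θ ∈ Θ) :
    ∃ θ' ∈ Θ, ∀ ψ ∈ Θ, angularGap θ θ' ≤ angularGap θ ψ :=
  Set.exists_min_image Θ (angularGap θ) hfin ⟨θ, hθ⟩

/-- Of two distinct directions with the same successor, one would come before that successor as seen
from the other. Injectivity is what provides predecessors, hence right sides. -/
theorem next_injective {Θ : Set ℝ} (hΘ : Θ ⊆ Ioc (-Real.pi) Real.pi) {θ₁ θ₂ θ' : ℝ} (h₁ : θ₁ ∈ Θ)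
    (h₂ : θ₂ ∈ Θ)
    (h' : θ' ∈ Θ) (hm₁ : ∀ ψ ∈ Θ, angularGap θ₁ θ' ≤ angularGap θ₁ ψ)
    (hm₂ : ∀ ψ ∈ Θ, angularGap θ₂ θ' ≤ angularGap θ₂ ψ) : θ₁ = θ₂ := by
  have a1 := hm₁ _ h₂
  have a2 := hm₂ _ h₁
  have b1 := hΘ h₁
  have b2 := hΘ h₂
  have b3 := hΘ h'
  unfold angularGap at a1 a2
  by_contra hne
  rcases lt_or_gt_of_ne hne with h | h <;> split_ifs at a1 a2 <;>
    linarith [b1.1, b1.2, b2.1, b2.2, b3.1, b3.2]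

/-- A right side exists at each direction of the star of `q`. -/
theorem exists_sideR {q : ℂ} {Θ : Set ℝ} (hΘ : Θ ⊆ Ioc (-Real.pi) Real.pi) (hfin : Θ.Finite)
    (hq : ∀ᶠ z : ℂ in 𝓝[≠] 0, (q + z ∈ M.graph ↔ z.arg ∈ Θ)) {θ : ℝ} (hθ : θ ∈ Θ) :
    ∃ F, M.SideR q θ F := by
  choose! f hf hmin using fun ψ (hψ : ψ ∈ Θ) => exists_next hfin hψ
  have hinj : InjOn f Θ := fun a ha b hb hab =>
    next_injective hΘ ha hb (hf a ha) (hmin a ha) (by rw [hab]; exact hmin b hb)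
  -- An injective self-map of a finite set is onto, so `θ` is the successor of some direction, and
  -- the sector between them is the right side sought.
  have hsurj : SurjOn f Θ Θ := ((hfin.injOn_iff_bijOn_of_mapsTo hf).1 hinj).surjOn
  obtain ⟨ψ, hψ, rfl⟩ := hsurj hθ
  obtain ⟨F, _, h2⟩ := exists_sector hΘ hq hψ hθ (hmin ψ hψ)
  exact ⟨F, h2⟩

theorem exists_sideL {q : ℂ} {Θ : Set ℝ} (hΘ : Θ ⊆ Ioc (-Real.pi) Real.pi) (hfin : Θ.Finite)
    (hq : ∀ᶠ z : ℂ in 𝓝[≠] 0, (q + z ∈ M.graph ↔ z.arg ∈ Θ)) {θ : ℝ} (hθ : θ ∈ Θ) :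
    ∃ F, M.SideL q θ F := by
  obtain ⟨θ', hθ', hmin⟩ := exists_next hfin hθ
  obtain ⟨F, h, _⟩ := exists_sector hΘ hq hθ hθ' hmin
  exact ⟨F, h⟩

end PlaneMap

theorem tendsto_ofReal_mul {a : ℂ} (ha : a ≠ 0) :
    Tendsto (fun t : ℝ => (t : ℂ) * a) (𝓝[>] 0) (𝓝[≠] 0) := by
  apply tendsto_nhdsWithin_iff.2
  constructor
  · have : Continuous fun t : ℝ => (t : ℂ) * a := by fun_prop
    exact (this.tendsto' 0 0 (by simp)).mono_left nhdsWithin_le_nhds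
  · filter_upwards [self_mem_nhdsWithin] with t ht
    have ht' : (t : ℂ) ≠ 0 := by exact_mod_cast (ne_of_gt ht)
    exact mul_ne_zero ht' ha

/-- Every direction is realised arbitrarily close to 0, so a germ described by its arguments
determines them; this is how directions are compared below. -/
theorem frequently_arg_eq {θ : ℝ} (hθ : θ ∈ Ioc (-Real.pi) Real.pi) :
    ∃ᶠ z : ℂ in 𝓝[≠] 0, z.arg = θ := by
  refine (tendsto_ofReal_mul (Complex.exp_ne_zero (θ * Complex.I))).frequently
    (Eventually.frequently ?_)
  filter_upwards [self_mem_nhdsWithin] with t ht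
  rw [PlaneMap.arg_mul_exp ht hθ.1 hθ.2]

/-! ### Following a face along one segment -/

namespace PlaneMap

variable {M : PlaneMap}

variable (M) in
/-- `F` lies to the right of the point at parameter `t` of the segment from `a` to `b`. -/
def RightAt (a b : ℂ) (t : ℝ) (F : Set ℂ) : Prop :=
  F ∈ M.faces ∧ ∀ᶠ s : ℝ in 𝓝[>] 0, a + (b - a) * (t - s * Complex.I) ∈ F

theorem RightAt.unique {a b : ℂ} {t : ℝ} {F F' : Set ℂ} (h : M.RightAt a b t F)
    (h' : M.RightAt a b t F') : F = F' := by
  obtain ⟨x, hx, hx'⟩ := (h.2.and h'.2).exists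
  exact face_eq h.1 h'.1 hx hx'

/-- Near an interior point of the segment the drawing is contained in the segment, while a point
displaced to the right lies off its line. Compactness of the parameter interval makes the admissible
displacement uniform. -/
theorem eventually_strip {a b : ℂ} (hab : a ≠ b)
    (hreg : ∀ z ∈ openSegment ℝ a b, ∀ᶠ w in 𝓝 z, w ∈ M.graph → w ∈ segment ℝ a b) {t₁ t₂ : ℝ}
    (h₁ : t₁ ∈ Ioo (0 : ℝ) 1) (h₂ : t₂ ∈ Ioo (0 : ℝ) 1) :
    ∀ᶠ s : ℝ in 𝓝[>] 0, ∀ t ∈ uIcc t₁ t₂, a + (b - a) * (t - s * Complex.I) ∉ M.graph := by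
  have hsub : b - a ≠ 0 := sub_ne_zero.2 hab.symm
  have key : ∀ᶠ s : ℝ in 𝓝 0, ∀ t ∈ uIcc t₁ t₂, 0 < s →
      a + (b - a) * (t - s * Complex.I) ∉ M.graph := by
    apply isCompact_uIcc.eventually_forall_of_forall_eventually
    intro t ht
    have ht' : t ∈ Ioo (0 : ℝ) 1 := by
      rcases mem_uIcc.1 ht with h | h
      · exact ⟨h₁.1.trans_le h.1, h.2.trans_lt h₂.2⟩
      · exact ⟨h₂.1.trans_le h.1, h.2.trans_lt h₁.2⟩
    have hz : a + (b - a) * t ∈ openSegment ℝ a b := by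
      rw [openSegment_eq_image']
      exact ⟨t, ht', by simp [mul_comm]⟩
    have hc : Continuous fun x : ℝ × ℝ => a + (b - a) * (x.2 - x.1 * Complex.I) := by fun_prop
    have hT : Tendsto (fun x : ℝ × ℝ => a + (b - a) * (x.2 - x.1 * Complex.I)) (𝓝 (0, t))
        (𝓝 (a + (b - a) * t)) := hc.tendsto' _ _ (by simp)
    filter_upwards [hT.eventually (hreg _ hz)] with x hx hpos hmem
    obtain ⟨τ, _, hτ⟩ := (segment_eq_image' ℝ a b).le (hx hmem)
    simp only [Complex.real_smul] at hτ
    have h3 : (b - a) * (τ : ℂ) = (b - a) * (x.2 - x.1 * Complex.I) := by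
      rw [← add_left_cancel hτ, mul_comm]
    have h4 := congrArg Complex.im (mul_left_cancel₀ hsub h3)
    simp at h4
    exact hpos.ne' h4
  filter_upwards [key.filter_mono nhdsWithin_le_nhds, self_mem_nhdsWithin] with s hs hs0 t ht
  exact hs t ht hs0

/-- For small `s` the parallel segment at displacement `s` is connected and avoids the drawing, so
it stays in one face. -/
theorem RightAt.transport {a b : ℂ} (hab : a ≠ b)
    (hreg : ∀ z ∈ openSegment ℝ a b, ∀ᶠ w in 𝓝 z, w ∈ M.graph → w ∈ segment ℝ a b) {t₁ t₂ : ℝ}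
    (h₁ : t₁ ∈ Ioo (0 : ℝ) 1) (h₂ : t₂ ∈ Ioo (0 : ℝ) 1) {F : Set ℂ} (h : M.RightAt a b t₁ F) :
    M.RightAt a b t₂ F := by
  refine ⟨h.1, ?_⟩
  filter_upwards [eventually_strip hab hreg h₁ h₂, h.2] with s hs hF
  let f : ℝ → ℂ := fun t => a + (b - a) * (t - s * Complex.I)
  have hf : Continuous f := by fun_prop
  have hS : IsPreconnected (f '' uIcc t₁ t₂) := isPreconnected_uIcc.image f hf.continuousOn
  refine subset_face h.1 hS ?_ ⟨_, mem_image_of_mem f left_mem_uIcc, hF⟩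
    (mem_image_of_mem f right_mem_uIcc)
  rintro _ ⟨t, ht, rfl⟩
  exact hs t ht

/-- In polar coordinates at `a`, the point with parameter `t - s * I` has an angle that tends to
that of `b - a` from below and a radius that tends to `‖b - a‖ * t`. For small `t` it enters the
sector as `s` decreases to 0. The angle need not be reduced modulo `2π`, since only its exponential
occurs. -/
theorem SideR.exists_rightAt {a b : ℂ} (hab : a ≠ b) {F : Set ℂ}
    (h : M.SideR a (b - a).arg F) : ∃ t ∈ Ioo (0 : ℝ) 1, M.RightAt a b t F := by
  have hsub : b - a ≠ 0 := sub_ne_zero.2 hab.symm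
  have hpos : 0 < ‖b - a‖ := norm_pos_iff.2 hsub
  obtain ⟨U, hU, V, hV, hUV⟩ := mem_prod_iff.1 h.2
  obtain ⟨r, hr, hrU⟩ := mem_nhdsGT_iff_exists_Ioo_subset.1 hU
  have hr : 0 < r := hr
  obtain ⟨t, ht0, ht1⟩ := exists_between (lt_min (div_pos hr hpos) one_pos)
  have ht2 : ‖b - a‖ * t < r := by
    have := ht1.trans_le (min_le_left _ _)
    rw [lt_div_iff₀ hpos] at this
    linarith
  refine ⟨t, ⟨ht0, ht1.trans_le (min_le_right _ _)⟩, h.1, ?_⟩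
  have hc : Continuous fun s : ℝ => (t : ℂ) - s * Complex.I := by fun_prop
  have hc0 : Tendsto (fun s : ℝ => (t : ℂ) - s * Complex.I) (𝓝[>] 0) (𝓝 t) :=
    (hc.tendsto' 0 _ (by simp)).mono_left nhdsWithin_le_nhds
  have harg : Tendsto (fun s : ℝ => (b - a).arg + ((t : ℂ) - s * Complex.I).arg) (𝓝[>] 0)
      (𝓝[<] (b - a).arg) := by
    apply tendsto_nhdsWithin_iff.2
    constructor
    · have h1 := (Complex.continuousAt_arg (Complex.ofReal_mem_slitPlane.2 ht0)).tendsto.comp hc0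
      rw [Complex.arg_ofReal_of_nonneg ht0.le] at h1
      simpa using h1.const_add (b - a).arg
    · filter_upwards [self_mem_nhdsWithin] with s hs
      have : ((t : ℂ) - s * Complex.I).arg < 0 := by
        rw [Complex.arg_neg_iff]
        simpa using hs
      simp only [mem_Iio]
      linarith
  have hn : Tendsto (fun s : ℝ => ‖b - a‖ * ‖(t : ℂ) - s * Complex.I‖) (𝓝[>] 0)
      (𝓝 (‖b - a‖ * t)) := by
    have := (hc0.norm).const_mul ‖b - a‖
    rwa [Complex.norm_real, Real.norm_eq_abs, abs_of_pos ht0] at this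
  filter_upwards [harg.eventually hV, hn.eventually_lt_const ht2,
    hn.eventually_const_lt (mul_pos hpos ht0)] with s hs1 hs2 hs3
  have := hUV (show (‖b - a‖ * ‖(t : ℂ) - s * Complex.I‖,
    (b - a).arg + ((t : ℂ) - s * Complex.I).arg) ∈ U ×ˢ V from ⟨hrU ⟨hs3, hs2⟩, hs1⟩)
  have e1 := Complex.norm_mul_exp_arg_mul_I (b - a)
  have e2 := Complex.norm_mul_exp_arg_mul_I ((t : ℂ) - s * Complex.I)
  have e3 : a + (b - a) * (t - s * Complex.I) = a + ((‖b - a‖ * ‖(t : ℂ) - s * Complex.I‖ : ℝ) : ℂ) *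
      Complex.exp (((b - a).arg + ((t : ℂ) - s * Complex.I).arg : ℝ) * Complex.I) := by
    conv_lhs => rw [← e1, ← e2]
    push_cast
    rw [add_mul, Complex.exp_add]
    ring
  rw [e3]
  exact this

/-- Seen from the end `b`, the right of the segment is its counterclockwise side; the argument is
that at the start, with parameter `1 - t`. -/
theorem SideL.exists_rightAt {a b : ℂ} (hab : a ≠ b) {F : Set ℂ}
    (h : M.SideL b (a - b).arg F) : ∃ t ∈ Ioo (0 : ℝ) 1, M.RightAt a b t F := by
  have hsub : a - b ≠ 0 := sub_ne_zero.2 hab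
  have hpos : 0 < ‖a - b‖ := norm_pos_iff.2 hsub
  obtain ⟨U, hU, V, hV, hUV⟩ := mem_prod_iff.1 h.2
  obtain ⟨r, hr, hrU⟩ := mem_nhdsGT_iff_exists_Ioo_subset.1 hU
  have hr : 0 < r := hr
  obtain ⟨t, ht0, ht1⟩ := exists_between (lt_min (div_pos hr hpos) one_pos)
  have ht2 : ‖a - b‖ * t < r := by
    have := ht1.trans_le (min_le_left _ _)
    rw [lt_div_iff₀ hpos] at this
    linarith
  refine ⟨1 - t, ⟨by linarith [ht1.trans_le (min_le_right _ _)], by linarith⟩, h.1, ?_⟩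
  have hc : Continuous fun s : ℝ => (t : ℂ) + s * Complex.I := by fun_prop
  have hc0 : Tendsto (fun s : ℝ => (t : ℂ) + s * Complex.I) (𝓝[>] 0) (𝓝 t) :=
    (hc.tendsto' 0 _ (by simp)).mono_left nhdsWithin_le_nhds
  have harg : Tendsto (fun s : ℝ => (a - b).arg + ((t : ℂ) + s * Complex.I).arg) (𝓝[>] 0)
      (𝓝[>] (a - b).arg) := by
    apply tendsto_nhdsWithin_iff.2
    constructor
    · have h1 := (Complex.continuousAt_arg (Complex.ofReal_mem_slitPlane.2 ht0)).tendsto.comp hc0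
      rw [Complex.arg_ofReal_of_nonneg ht0.le] at h1
      simpa using h1.const_add (a - b).arg
    · filter_upwards [self_mem_nhdsWithin] with s hs
      have h0 : 0 ≤ ((t : ℂ) + s * Complex.I).arg := by
        rw [Complex.arg_nonneg_iff]
        simpa using (le_of_lt hs)
      have h1 : ((t : ℂ) + s * Complex.I).arg ≠ 0 := by
        intro h2
        rw [Complex.arg_eq_zero_iff] at h2
        have := h2.2
        simp at this
        exact (ne_of_gt hs) this
      have := lt_of_le_of_ne h0 h1.symm
      simp only [mem_Ioi]
      linarith
  have hn : Tendsto (fun s : ℝ => ‖a - b‖ * ‖(t : ℂ) + s * Complex.I‖) (𝓝[>] 0)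
      (𝓝 (‖a - b‖ * t)) := by
    have := (hc0.norm).const_mul ‖a - b‖
    rwa [Complex.norm_real, Real.norm_eq_abs, abs_of_pos ht0] at this
  filter_upwards [harg.eventually hV, hn.eventually_lt_const ht2,
    hn.eventually_const_lt (mul_pos hpos ht0)] with s hs1 hs2 hs3
  have := hUV (show (‖a - b‖ * ‖(t : ℂ) + s * Complex.I‖,
    (a - b).arg + ((t : ℂ) + s * Complex.I).arg) ∈ U ×ˢ V from ⟨hrU ⟨hs3, hs2⟩, hs1⟩)
  have e1 := Complex.norm_mul_exp_arg_mul_I (a - b)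
  have e2 := Complex.norm_mul_exp_arg_mul_I ((t : ℂ) + s * Complex.I)
  have e4 : a + (b - a) * (((1 - t : ℝ) : ℂ) - s * Complex.I) =
      b + (a - b) * (t + s * Complex.I) := by
    push_cast
    ring
  have e3 : a + (b - a) * (((1 - t : ℝ) : ℂ) - s * Complex.I) =
      b + ((‖a - b‖ * ‖(t : ℂ) + s * Complex.I‖ : ℝ) : ℂ) *
      Complex.exp (((a - b).arg + ((t : ℂ) + s * Complex.I).arg : ℝ) * Complex.I) := by
    rw [e4]
    conv_lhs => rw [← e1, ← e2]
    push_cast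
    rw [add_mul, Complex.exp_add]
    ring
  rw [e3]
  exact this

/-- The faces on the right of a segment, at its start, at its midpoint and at its end, agree. -/
theorem segment_sides {a b : ℂ} (hab : a ≠ b)
    (hreg : ∀ z ∈ openSegment ℝ a b, ∀ᶠ w in 𝓝 z, w ∈ M.graph → w ∈ segment ℝ a b) {F F' : Set ℂ}
    (h : M.SideR a (b - a).arg F) (h' : M.SideL b (a - b).arg F') :
    F = F' ∧ M.RightAt a b (1 / 2) F := by
  obtain ⟨t, ht, h1⟩ := h.exists_rightAt hab
  obtain ⟨t', ht', h1'⟩ := h'.exists_rightAt hab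
  have hm : (1 / 2 : ℝ) ∈ Ioo (0 : ℝ) 1 := by norm_num
  have h2 := h1.transport hab hreg ht hm
  exact ⟨h2.unique (h1'.transport hab hreg ht' hm), h2⟩

end PlaneMap

namespace PlaneMap

variable {M : PlaneMap}

/-! ### The sides of an edge -/

theorem eventually_graph_imp_mem_edge {e : Set ℂ} (he : e ∈ M.E) {q : ℂ} (hq : q ∈ e)
    (hqV : q ∉ M.V) : ∀ᶠ z in 𝓝 q, (z ∈ M.graph ↔ z ∈ e) := by
  filter_upwards [M.eventually_mem_edge q] with z hz
  constructor
  · rintro (hv | ⟨e', he', hze⟩)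
    · exact hz.1 hv ▸ hq
    · by_cases hee : e' = e
      · exact hee ▸ hze
      · exact absurd (M.edge_inter e' he' e he hee ⟨hz.2 e' he' hze, hq⟩) hqV
  · exact fun h => edge_subset_graph he h

section Arc

variable {n : ℕ} {p : ℕ → ℂ} {e : Set ℂ}

theorem corner_notMem (hp : IsPolygonalArc n p e) (hV : e ∩ M.V = {p 0, p n}) {i : ℕ}
    (hi : i + 1 < n) : p (i + 1) ∉ M.V := by
  intro h
  have h1 : p (i + 1) ∈ e ∩ M.V := ⟨hp.corner_mem hi.le, h⟩
  rw [hV] at h1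
  rcases h1 with h1 | h1
  · exact hp.corner_ne (Nat.succ_pos i) hi.le h1.symm
  · exact hp.corner_ne hi le_rfl h1

theorem openSegment_notMem (hp : IsPolygonalArc n p e) (hV : e ∩ M.V = {p 0, p n}) {i : ℕ}
    (hi : i < n) {z : ℂ} (hz : z ∈ openSegment ℝ (p i) (p (i + 1))) : z ∈ e ∧ z ∉ M.V := by
  have hz' := openSegment_subset_segment ℝ _ _ hz
  have hze : z ∈ e := hp.mem_iff.2 ⟨i, hi, hz'⟩
  refine ⟨hze, fun h => ?_⟩
  have key : ∀ j ≤ n, z ≠ p j := by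
    rintro j hj rfl
    rcases (hp.corner_mem_segment_iff hi hj).1 hz' with rfl | rfl
    · exact hp.2.1 _ hi (left_mem_openSegment_iff.1 hz)
    · exact hp.2.1 _ hi (right_mem_openSegment_iff.1 hz)
  have h1 : z ∈ e ∩ M.V := ⟨hze, h⟩
  rw [hV] at h1
  rcases h1 with h1 | h1
  · exact key 0 (Nat.zero_le _) h1
  · exact key n le_rfl h1

theorem segment_regular (he : e ∈ M.E) (hp : IsPolygonalArc n p e) (hV : e ∩ M.V = {p 0, p n})
    {i : ℕ} (hi : i < n) : ∀ z ∈ openSegment ℝ (p i) (p (i + 1)),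
      ∀ᶠ w in 𝓝 z, w ∈ M.graph → w ∈ segment ℝ (p i) (p (i + 1)) := by
  intro z hz
  obtain ⟨hze, hzV⟩ := openSegment_notMem hp hV hi hz
  filter_upwards [eventually_graph_imp_mem_edge he hze hzV, hp.eventually_mem_iff z] with w h1 h2 hw
  obtain ⟨k, hk, h3, h4⟩ := h2.1 (h1.1 hw)
  obtain rfl := hp.eq_of_mem_openSegment hi hk hz h3
  exact h4

theorem corner_star (he : e ∈ M.E) (hp : IsPolygonalArc n p e) (hV : e ∩ M.V = {p 0, p n}) {i : ℕ}
    (hi : i + 1 < n) : ∀ᶠ z : ℂ in 𝓝[≠] 0, (p (i + 1) + z ∈ M.graph ↔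
      z.arg ∈ ({(p i - p (i + 1)).arg, (p (i + 2) - p (i + 1)).arg} : Set ℝ)) := by
  have h1 := ((tendsto_const_add_nhds_zero (p (i + 1))).eventually
    (eventually_graph_imp_mem_edge he (hp.corner_mem hi.le) (corner_notMem hp hV hi))).filter_mono
    (nhdsWithin_le_nhds (s := {0}ᶜ))
  filter_upwards [h1, hp.eventually_mem_iff_corner hi] with z hz1 hz2
  rw [hz1, hz2]
  rfl

/-- At an inner corner the star has only the backward and the forward direction, so these are
cyclically consecutive and one sector joins the right of the incoming segment to the right of the
outgoing one. -/
theorem corner_sides (he : e ∈ M.E) (hp : IsPolygonalArc n p e) (hV : e ∩ M.V = {p 0, p n}) {i : ℕ}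
    (hi : i + 1 < n) : ∃ F, M.SideL (p (i + 1)) (p i - p (i + 1)).arg F ∧
      M.SideR (p (i + 1)) (p (i + 2) - p (i + 1)).arg F := by
  have hΘ : ({(p i - p (i + 1)).arg, (p (i + 2) - p (i + 1)).arg} : Set ℝ) ⊆
      Ioc (-Real.pi) Real.pi := by
    rintro θ (rfl | rfl) <;> exact Complex.arg_mem_Ioc _
  have hne := hp.corner_arg_ne hi
  have m1 := Complex.arg_mem_Ioc (p i - p (i + 1))
  have m2 := Complex.arg_mem_Ioc (p (i + 2) - p (i + 1))
  refine exists_sector hΘ (corner_star he hp hV hi) (Or.inl rfl) (Or.inr rfl) ?_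
  rintro ψ (rfl | rfl)
  · unfold angularGap
    rcases lt_or_gt_of_ne hne with h | h
    · rw [if_pos h, if_neg (lt_irrefl _)]
      linarith [m1.1, m2.2]
    · rw [if_neg h.le.not_gt, if_neg (lt_irrefl _)]
      linarith
  · exact le_rfl

theorem exists_sideL_corner (he : e ∈ M.E) (hp : IsPolygonalArc n p e)
    (hV : e ∩ M.V = {p 0, p n}) (hend : ∃ F, M.SideL (p n) (p (n - 1) - p n).arg F) {i : ℕ}
    (hi : i < n) : ∃ F, M.SideL (p (i + 1)) (p i - p (i + 1)).arg F := by
  by_cases h : i + 1 < n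
  · obtain ⟨F, hF, _⟩ := corner_sides he hp hV h
    exact ⟨F, hF⟩
  · obtain rfl : n = i + 1 := by omega
    exact hend

/-- The face on the right of an arc is the same all along the arc. -/
theorem arc_sides (he : e ∈ M.E) (hp : IsPolygonalArc n p e) (hV : e ∩ M.V = {p 0, p n})
    (hstart : ∃ F, M.SideR (p 0) (p 1 - p 0).arg F)
    (hend : ∃ F, M.SideL (p n) (p (n - 1) - p n).arg F) : ∃ F,
      M.SideR (p 0) (p 1 - p 0).arg F ∧ M.SideL (p n) (p (n - 1) - p n).arg F ∧
      ∀ i < n, M.RightAt (p i) (p (i + 1)) (1 / 2) F := by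
  obtain ⟨F, hF⟩ := hstart
  have key : ∀ i < n, M.SideR (p i) (p (i + 1) - p i).arg F := by
    intro i
    induction i with
    | zero => exact fun _ => hF
    | succ i ih =>
      intro hi
      obtain ⟨G, hG1, hG2⟩ := corner_sides he hp hV hi
      have := (segment_sides (hp.2.1 i (by omega)) (segment_regular he hp hV (by omega))
        (ih (by omega)) hG1).1
      exact this ▸ hG2
  have h0 := hp.1
  obtain ⟨G, hG⟩ := hend
  obtain ⟨m, rfl⟩ : ∃ m, n = m + 1 := ⟨n - 1, by omega⟩
  rw [Nat.add_sub_cancel] at hG ⊢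
  have h1 := (segment_sides (hp.2.1 m (by omega)) (segment_regular he hp hV (by omega))
        (key m (by omega)) hG).1
  refine ⟨F, hF, h1 ▸ hG, fun i hi => ?_⟩
  obtain ⟨G', hG'⟩ := exists_sideL_corner he hp hV ⟨G, by rw [Nat.add_sub_cancel]; exact hG⟩ hi
  exact (segment_sides (hp.2.1 i hi) (segment_regular he hp hV hi) (key i hi) hG').2

end Arc

/-! ### Directed edges at a vertex -/

theorem DirEdge.exists_arc (d : M.DirEdge) : ∃ n p, IsPolygonalArc n p d.edge ∧ p 0 = d.vertex ∧
    d.edge ∩ M.V = {p 0, p n} := by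
  obtain ⟨n, p, hp, hV⟩ := M.edge_arc d.edge d.edge_mem
  have h1 : d.vertex ∈ d.edge ∩ M.V := ⟨d.mem, d.vertex_mem⟩
  rw [hV] at h1
  rcases h1 with h1 | h1
  · exact ⟨n, p, hp, h1.symm, hV⟩
  · refine ⟨n, _, hp.reverse, h1.symm, ?_⟩
    simp only [Nat.sub_zero, Nat.sub_self]
    rw [hV, pair_comm]

/-- An arc leaves an inner corner, or an inner point of a segment, in two distinct directions.
Having a single direction therefore identifies the ends from the point set alone. -/
theorem _root_.IsPolygonalArc.eq_end_of_germ {n : ℕ} {p : ℕ → ℂ} {e : Set ℂ}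
    (hp : IsPolygonalArc n p e) {z : ℂ} (hz : z ∈ e) {θ : ℝ}
    (hθ : ∀ᶠ w : ℂ in 𝓝[≠] 0, (z + w ∈ e ↔ w.arg = θ)) : z = p 0 ∨ z = p n := by
  obtain ⟨i, hi, hzi⟩ := hp.mem_iff.1 hz
  have corner : ∀ j ≤ n, z = p j → z = p 0 ∨ z = p n := by
    rintro j hj rfl
    rcases Nat.eq_zero_or_pos j with rfl | hj0
    · exact Or.inl rfl
    rcases hj.eq_or_lt with rfl | hjn
    · exact Or.inr rfl
    obtain ⟨k, rfl⟩ : ∃ k, j = k + 1 := ⟨j - 1, by omega⟩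
    exfalso
    have h1 := hp.eventually_mem_iff_corner hjn
    have h2 : ∀ ψ ∈ Ioc (-Real.pi) Real.pi,
        (ψ = (p k - p (k + 1)).arg ∨ ψ = (p (k + 2) - p (k + 1)).arg) → ψ = θ := by
      intro ψ hψ hor
      obtain ⟨w, hw, h3, h4⟩ := ((frequently_arg_eq hψ).and_eventually (h1.and hθ)).exists
      rw [← hw] at hor ⊢
      exact h4.1 (h3.2 hor)
    exact hp.corner_arg_ne hjn ((h2 _ (Complex.arg_mem_Ioc _) (Or.inl rfl)).trans
      (h2 _ (Complex.arg_mem_Ioc _) (Or.inr rfl)).symm)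
  rw [← insert_endpoints_openSegment] at hzi
  rcases hzi with h | h | h
  · exact corner i hi.le h
  · exact corner (i + 1) hi h
  exfalso
  have hne : p (i + 1) - p i ≠ 0 := sub_ne_zero.2 (hp.2.1 i hi).symm
  obtain ⟨τ, hτ, rfl⟩ := (openSegment_eq_image' ℝ _ _).le h
  -- Inside a segment both the forward and the backward direction belong to the germ, and opposite
  -- directions have different arguments.
  have key : ∀ σ : ℝ, (σ = 1 ∨ σ = -1) → (σ * (p (i + 1) - p i)).arg = θ := by
    intro σ hσ
    have hσ0 : (σ : ℂ) ≠ 0 := by rcases hσ with rfl | rfl <;> norm_num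
    have h1 := (tendsto_ofReal_mul (mul_ne_zero hσ0 hne)).eventually hθ
    have h2 : ∀ᶠ t : ℝ in 𝓝[>] 0, τ + t * σ ∈ Icc (0 : ℝ) 1 := by
      have hc : Continuous fun t : ℝ => τ + t * σ := by fun_prop
      exact ((hc.tendsto' 0 τ (by simp)).mono_left nhdsWithin_le_nhds).eventually
        (Icc_mem_nhds hτ.1 hτ.2)
    obtain ⟨t, ht, h3, h4⟩ := (Eventually.and
      (show ∀ᶠ t : ℝ in 𝓝[>] 0, 0 < t from self_mem_nhdsWithin) (h1.and h2)).exists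
    rw [← Complex.arg_real_mul _ ht]
    refine h3.1 (hp.mem_iff.2 ⟨i, hi, ?_⟩)
    rw [segment_eq_image']
    refine ⟨_, h4, ?_⟩
    simp only [Complex.real_smul]
    push_cast
    ring
  have h1 := (key 1 (Or.inl rfl)).trans (key (-1) (Or.inr rfl)).symm
  simp only [Complex.ofReal_one, one_mul, Complex.ofReal_neg, neg_mul] at h1
  rw [Complex.arg_eq_arg_iff hne (neg_ne_zero.2 hne), norm_neg,
    div_self (by exact_mod_cast norm_ne_zero_iff.2 hne), one_mul] at h1
  exact hne (self_eq_neg.1 h1)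

theorem _root_.IsPolygonalArc.eventually_mem_iff_end {n : ℕ} {p : ℕ → ℂ} {e : Set ℂ}
    (hp : IsPolygonalArc n p e) :
    ∀ᶠ z : ℂ in 𝓝[≠] 0, (p n + z ∈ e ↔ z.arg = (p (n - 1) - p n).arg) := by
  simpa using hp.reverse.eventually_mem_iff_start

/-- `edge_arc` gives the ends for one parametrisation only, whereas `OnRight` allows any; germs show
that all parametrisations have the same ends. -/
theorem arc_inter {n : ℕ} {p : ℕ → ℂ} {e : Set ℂ} (he : e ∈ M.E) (hp : IsPolygonalArc n p e) :
    e ∩ M.V = {p 0, p n} := by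
  obtain ⟨m, q, hq, hV⟩ := M.edge_arc e he
  have h0 := hq.eq_end_of_germ (hp.corner_mem (Nat.zero_le n)) hp.eventually_mem_iff_start
  have h1 := hq.eq_end_of_germ (hp.corner_mem le_rfl) hp.eventually_mem_iff_end
  have hne := hp.corner_ne hp.1 le_rfl
  rw [hV]
  rcases h0 with h0 | h0 <;> rcases h1 with h1 | h1
  · exact absurd (h0.trans h1.symm) hne
  · rw [h0, h1]
  · rw [h0, h1, pair_comm]
  · exact absurd (h0.trans h1.symm) hne

theorem DirEdge.ext' {d d' : M.DirEdge} (hv : d.vertex = d'.vertex) (he : d.edge = d'.edge) :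
    d = d' := by
  cases d
  cases d'
  simp_all

theorem DirEdge.exists_angle (d : M.DirEdge) : ∃ θ ∈ Ioc (-Real.pi) Real.pi,
    ∀ᶠ z : ℂ in 𝓝[≠] 0, (d.vertex + z ∈ d.edge ↔ z.arg = θ) := by
  obtain ⟨n, p, hp, h0, _⟩ := d.exists_arc
  exact ⟨_, Complex.arg_mem_Ioc _, h0 ▸ hp.eventually_mem_iff_start⟩

/-- The direction in which the directed edge `d` leaves its vertex. -/
noncomputable def DirEdge.angle (d : M.DirEdge) : ℝ := d.exists_angle.choose

theorem DirEdge.angle_mem (d : M.DirEdge) : d.angle ∈ Ioc (-Real.pi) Real.pi :=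
  d.exists_angle.choose_spec.1

theorem DirEdge.eventually_mem_iff (d : M.DirEdge) :
    ∀ᶠ z : ℂ in 𝓝[≠] 0, (d.vertex + z ∈ d.edge ↔ z.arg = d.angle) :=
  d.exists_angle.choose_spec.2

theorem DirEdge.angle_eq (d : M.DirEdge) {n : ℕ} {p : ℕ → ℂ} (hp : IsPolygonalArc n p d.edge)
    (h0 : p 0 = d.vertex) : (p 1 - p 0).arg = d.angle := by
  have h1 := hp.eventually_mem_iff_start
  rw [h0] at h1
  obtain ⟨w, hw, h3, h4⟩ := ((frequently_arg_eq d.angle_mem).and_eventually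
    (h1.and d.eventually_mem_iff)).exists
  rw [h0, ← hw]
  exact (h3.1 (h4.2 hw)).symm

theorem finite_dirEdge_at (v : ℂ) : {d : M.DirEdge | d.vertex = v}.Finite := by
  refine Set.Finite.of_finite_image (f := fun d : M.DirEdge => d.edge)
    ((finite_edges_meeting (M := M) (isCompact_singleton (x := v))).subset ?_) ?_
  · rintro _ ⟨d, rfl, rfl⟩
    exact ⟨d.edge_mem, d.vertex, d.mem, rfl⟩
  · rintro d rfl d' hd' he
    exact DirEdge.ext' (Eq.symm hd') he

/-- Distinct edges leaving in the same direction would share points near the vertex; these would be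
vertices, although vertices are isolated. -/
theorem DirEdge.angle_injective {d d' : M.DirEdge} (hv : d.vertex = d'.vertex)
    (ha : d.angle = d'.angle) : d = d' := by
  by_contra hne
  have he : d.edge ≠ d'.edge := fun h => hne (DirEdge.ext' hv h)
  have h1 := d'.eventually_mem_iff
  rw [← hv, ← ha] at h1
  have h2 := ((tendsto_const_add_nhds_zero d.vertex).eventually
    (M.eventually_mem_edge d.vertex)).filter_mono (nhdsWithin_le_nhds (s := {0}ᶜ))
  obtain ⟨w, hw, h3, h4, h5, h6⟩ := ((frequently_arg_eq d.angle_mem).and_eventually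
    (d.eventually_mem_iff.and (h1.and (h2.and self_mem_nhdsWithin)))).exists
  have := h5.1 (M.edge_inter _ d.edge_mem _ d'.edge_mem he ⟨h3.2 hw, h4.2 hw⟩)
  exact h6 (by simpa using this)

theorem vertex_star {v : ℂ} (hv : v ∈ M.V) : ∀ᶠ z : ℂ in 𝓝[≠] 0, (v + z ∈ M.graph ↔
    z.arg ∈ DirEdge.angle '' {d : M.DirEdge | d.vertex = v}) := by
  have h2 := ((tendsto_const_add_nhds_zero v).eventually
    (M.eventually_mem_edge v)).filter_mono (nhdsWithin_le_nhds (s := {0}ᶜ))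
  have h1 : ∀ᶠ z : ℂ in 𝓝[≠] 0, ∀ d ∈ {d : M.DirEdge | d.vertex = v},
      (v + z ∈ d.edge ↔ z.arg = d.angle) := by
    rw [Filter.eventually_all_finite (finite_dirEdge_at v)]
    rintro d rfl
    exact d.eventually_mem_iff
  filter_upwards [h1, h2, self_mem_nhdsWithin] with z hz1 hz2 hz3
  constructor
  · rintro (h | ⟨e, he, hze⟩)
    · exact absurd (by simpa using hz2.1 h) hz3
    · exact ⟨⟨v, e, hv, he, hz2.2 e he hze⟩, rfl,
        ((hz1 ⟨v, e, hv, he, hz2.2 e he hze⟩ rfl).1 hze).symm⟩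
  · rintro ⟨d, hd, ha⟩
    exact edge_subset_graph d.edge_mem ((hz1 d hd).2 ha.symm)

theorem angles_subset (v : ℂ) :
    DirEdge.angle '' {d : M.DirEdge | d.vertex = v} ⊆ Ioc (-Real.pi) Real.pi := by
  rintro _ ⟨d, _, rfl⟩
  exact d.angle_mem

theorem DirEdge.exists_sideR (d : M.DirEdge) : ∃ F, M.SideR d.vertex d.angle F :=
  PlaneMap.exists_sideR (angles_subset _) ((finite_dirEdge_at _).image _) (vertex_star d.vertex_mem)
    ⟨d, rfl, rfl⟩

theorem DirEdge.exists_sideL (d : M.DirEdge) : ∃ F, M.SideL d.vertex d.angle F :=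
  PlaneMap.exists_sideL (angles_subset _) ((finite_dirEdge_at _).image _) (vertex_star d.vertex_mem)
    ⟨d, rfl, rfl⟩

/-! ### Reversal -/

theorem DirEdge.exists_rev (d : M.DirEdge) :
    ∃ d', IsReverse d d' ∧ ∀ d'', IsReverse d d'' → d'' = d' := by
  obtain ⟨n, p, hp, h0, hV⟩ := d.exists_arc
  have h1 : p n ∈ d.edge ∩ M.V := hV ▸ Or.inr rfl
  have hne := hp.corner_ne hp.1 le_rfl
  refine ⟨⟨p n, d.edge, h1.2, d.edge_mem, h1.1⟩, ⟨rfl, h0 ▸ hne⟩, ?_⟩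
  rintro d'' ⟨he, hv⟩
  have h2 : d''.vertex ∈ d.edge ∩ M.V := ⟨he ▸ d''.mem, d''.vertex_mem⟩
  rw [hV] at h2
  rcases h2 with h2 | h2
  · exact absurd (h2.trans h0).symm hv
  · exact DirEdge.ext' h2 he.symm

/-- The directed edge `d` with its direction reversed. -/
noncomputable def DirEdge.rev (d : M.DirEdge) : M.DirEdge := d.exists_rev.choose

theorem DirEdge.isReverse_rev (d : M.DirEdge) : IsReverse d d.rev := d.exists_rev.choose_spec.1

theorem IsReverse.eq_rev {d d' : M.DirEdge} (h : IsReverse d d') : d' = d.rev :=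
  d.exists_rev.choose_spec.2 d' h

theorem DirEdge.rev_edge (d : M.DirEdge) : d.rev.edge = d.edge := d.isReverse_rev.1.symm

theorem DirEdge.rev_vertex_ne (d : M.DirEdge) : d.rev.vertex ≠ d.vertex := d.isReverse_rev.2.symm

theorem DirEdge.rev_rev (d : M.DirEdge) : d.rev.rev = d :=
  (IsReverse.eq_rev ⟨d.rev_edge, d.rev_vertex_ne⟩ : d = d.rev.rev).symm

theorem DirEdge.eq_or_eq_rev {d d' : M.DirEdge} (h : d'.edge = d.edge) : d' = d ∨ d' = d.rev := by
  by_cases hv : d.vertex = d'.vertex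
  · exact Or.inl (DirEdge.ext' hv.symm h)
  · exact Or.inr (IsReverse.eq_rev ⟨h.symm, hv⟩)

theorem DirEdge.rev_vertex_eq (d : M.DirEdge) {n : ℕ} {p : ℕ → ℂ} (hp : IsPolygonalArc n p d.edge)
    (h0 : p 0 = d.vertex) : d.rev.vertex = p n := by
  have hV := arc_inter d.edge_mem hp
  have h1 : d.rev.vertex ∈ d.edge ∩ M.V := ⟨d.rev_edge ▸ d.rev.mem, d.rev.vertex_mem⟩
  rw [hV] at h1
  rcases h1 with h1 | h1
  · exact absurd (h1.trans h0) d.rev_vertex_ne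
  · exact h1

theorem DirEdge.sides (d : M.DirEdge) {n : ℕ} {p : ℕ → ℂ} (hp : IsPolygonalArc n p d.edge)
    (h0 : p 0 = d.vertex) : ∃ F, M.SideR d.vertex d.angle F ∧
      M.SideL d.rev.vertex d.rev.angle F ∧ ∀ i < n, M.RightAt (p i) (p (i + 1)) (1 / 2) F := by
  have h1 := d.angle_eq hp h0
  have hr : IsPolygonalArc n (fun i => p (n - i)) d.rev.edge := d.rev_edge ▸ hp.reverse
  have h2 := d.rev.angle_eq hr (by simpa using (d.rev_vertex_eq hp h0).symm)
  simp only [Nat.sub_zero] at h2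
  have h3 := d.rev_vertex_eq hp h0
  have hs := d.exists_sideR
  have he := d.rev.exists_sideL
  rw [← h1, ← h0] at hs ⊢
  rw [← h2, h3] at he ⊢
  exact arc_sides d.edge_mem hp (arc_inter d.edge_mem hp) hs he

theorem midpoint_right (a b : ℂ) (s : ℝ) :
    (a + b) / 2 - (s : ℂ) * (Complex.I * (b - a)) =
      a + (b - a) * (((1 / 2 : ℝ) : ℂ) - s * Complex.I) := by
  push_cast
  ring

/-- One face runs along the whole arc, whatever its subdivision, so the choices of arc and segment
in `OnRight` do not matter. Together with `SideR.unique` this makes the right face a function of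
`d`. -/
theorem onRight_iff_sideR {d : M.DirEdge} {F : Set ℂ} :
    OnRight d F ↔ M.SideR d.vertex d.angle F := by
  constructor
  · rintro ⟨hF, n, p, hp, h0, i, hi, h⟩
    obtain ⟨G, hG1, _, hG2⟩ := d.sides hp h0
    simp only [midpoint_right] at h
    rwa [RightAt.unique ⟨hF, h⟩ (hG2 i hi)]
  · intro h
    obtain ⟨n, p, hp, h0, _⟩ := d.exists_arc
    obtain ⟨G, hG1, _, hG2⟩ := d.sides hp h0
    obtain rfl := h.unique hG1
    refine ⟨h.1, n, p, hp, h0, 0, hp.1, ?_⟩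
    simp only [midpoint_right]
    exact (hG2 0 hp.1).2

theorem onRight_rev_iff_sideL {d : M.DirEdge} {F : Set ℂ} :
    OnRight d.rev F ↔ M.SideL d.vertex d.angle F := by
  obtain ⟨n, p, hp, h0, _⟩ := d.rev.exists_arc
  obtain ⟨G, hG1, hG2, _⟩ := d.rev.sides hp h0
  rw [d.rev_rev] at hG2
  rw [onRight_iff_sideR]
  exact ⟨fun h => h.unique hG1 ▸ hG2, fun h => h.unique hG2 ▸ hG1⟩

theorem exists_onRight (d : M.DirEdge) : ∃ F, OnRight d F := by
  obtain ⟨F, hF⟩ := d.exists_sideR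
  exact ⟨F, onRight_iff_sideR.2 hF⟩

/-- The face on the right of a directed edge. -/
noncomputable def DirEdge.right (d : M.DirEdge) : Set ℂ := (exists_onRight d).choose

theorem DirEdge.onRight_right (d : M.DirEdge) : OnRight d d.right := (exists_onRight d).choose_spec

theorem onRight_iff {d : M.DirEdge} {F : Set ℂ} : OnRight d F ↔ d.right = F :=
  ⟨fun h => (onRight_iff_sideR.1 d.onRight_right).unique (onRight_iff_sideR.1 h),
    fun h => h ▸ d.onRight_right⟩

theorem DirEdge.right_mem_faces (d : M.DirEdge) : d.right ∈ M.faces := d.onRight_right.1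

theorem DirEdge.rightAt (d : M.DirEdge) {n : ℕ} {p : ℕ → ℂ} (hp : IsPolygonalArc n p d.edge)
    (h0 : p 0 = d.vertex) {i : ℕ} (hi : i < n) :
    M.RightAt (p i) (p (i + 1)) (1 / 2) d.right := by
  obtain ⟨G, hG1, _, hG2⟩ := d.sides hp h0
  rw [onRight_iff.1 (onRight_iff_sideR.2 hG1)]
  exact hG2 i hi

/-! ### Rotation around a vertex -/

theorem DirEdge.exists_rot (d : M.DirEdge) : ∃ d' : M.DirEdge, d'.vertex = d.vertex ∧
    ∀ c : M.DirEdge, c.vertex = d.vertex → angularGap d.angle d'.angle ≤ angularGap d.angle c.angle := by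
  obtain ⟨_, ⟨d', hd', rfl⟩, hmin⟩ := exists_next ((finite_dirEdge_at d.vertex).image DirEdge.angle)
    ⟨d, rfl, rfl⟩
  exact ⟨d', hd', fun c hc => hmin _ ⟨c, hc, rfl⟩⟩

/-- The next directed edge, counterclockwise around the vertex. -/
noncomputable def DirEdge.rot (d : M.DirEdge) : M.DirEdge := d.exists_rot.choose

theorem DirEdge.rot_vertex (d : M.DirEdge) : d.rot.vertex = d.vertex := d.exists_rot.choose_spec.1

theorem DirEdge.angularGap_rot_le (d c : M.DirEdge) (h : c.vertex = d.vertex) :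
    angularGap d.angle d.rot.angle ≤ angularGap d.angle c.angle := d.exists_rot.choose_spec.2 c h

/-- The sector from `d` to its successor lies both to the left of `d` and to the right of `d.rot`.
-/
theorem DirEdge.right_rot (d : M.DirEdge) : d.rot.right = d.rev.right := by
  obtain ⟨F, h1, h2⟩ := exists_sector (angles_subset d.vertex) (vertex_star d.vertex_mem)
    (mem_image_of_mem _ rfl) (mem_image_of_mem _ d.rot_vertex)
    (by rintro _ ⟨c, hc, rfl⟩; exact d.angularGap_rot_le c hc)
  rw [onRight_iff.1 (onRight_rev_iff_sideL.2 h1), ← onRight_iff, onRight_iff_sideR, d.rot_vertex]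
  exact h2

/-- Among the directed edges at the vertex with property `P`, take the one with the smallest gap to
`c`. Unless its successor is `c`, that successor has a still smaller gap. -/
theorem rot_transitive {P : M.DirEdge → Prop} (hrot : ∀ d, P d → P d.rot) {d c : M.DirEdge}
    (hd : P d) (hv : c.vertex = d.vertex) : P c := by
  by_contra hc
  have hfin : {a : M.DirEdge | a.vertex = d.vertex ∧ P a}.Finite :=
    (finite_dirEdge_at d.vertex).subset fun a ha => ha.1
  obtain ⟨a, ⟨hav, ha⟩, hmin⟩ := Set.exists_min_image _ (fun a => angularGap a.angle c.angle) hfin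
    ⟨d, rfl, hd⟩
  have h1 := hmin a.rot ⟨a.rot_vertex.trans hav, hrot a ha⟩
  have h2 := a.angularGap_rot_le c (hv.trans hav.symm)
  have h3 : a.rot.angle ≠ c.angle := fun h =>
    hc (DirEdge.angle_injective (a.rot_vertex.trans (hav.trans hv.symm)) h ▸ hrot a ha)
  have m1 := a.angle_mem
  have m2 := c.angle_mem
  have m3 := a.rot.angle_mem
  simp only [angularGap] at h1 h2
  rcases lt_or_gt_of_ne h3 with h | h <;> split_ifs at h1 h2 <;>
    linarith [m1.1, m1.2, m2.1, m2.2, m3.1, m3.2]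

/-- A property preserved by `rot` and `rev` that holds for one directed edge holds for all. -/
theorem dirEdge_induction {P : M.DirEdge → Prop} (hrot : ∀ d, P d → P d.rot)
    (hrev : ∀ d, P d → P d.rev) {d₀ : M.DirEdge} (h₀ : P d₀) (d : M.DirEdge) : P d := by
  have key : ∀ v, Relation.ReflTransGen
      (fun a b : ℂ => a ∈ M.V ∧ b ∈ M.V ∧ ∃ e ∈ M.E, a ∈ e ∧ b ∈ e) d₀.vertex v →
      ∀ c : M.DirEdge, c.vertex = v → P c := by
    intro v hv
    induction hv with
    | refl => exact fun c hc => rot_transitive hrot h₀ hc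
    | tail _ hab ih =>
      rename_i a b _
      intro c hc
      obtain ⟨ha, hb, e, he, hae, hbe⟩ := hab
      by_cases hab' : a = b
      · exact ih c (hc.trans hab'.symm)
      · have h1 : P ⟨a, e, ha, he, hae⟩ := ih _ rfl
        have h2 : (⟨b, e, hb, he, hbe⟩ : M.DirEdge) = (⟨a, e, ha, he, hae⟩ : M.DirEdge).rev :=
          IsReverse.eq_rev ⟨rfl, hab'⟩
        exact rot_transitive hrot (h2 ▸ hrev _ h1) hc
  exact key _ (M.connected _ d₀.vertex_mem _ d.vertex_mem) d rfl

end PlaneMap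

/-! ### The logarithm of an arc -/

/-- The integral of `1 / (ζ - z)` along the segment from `a` to `b`. -/
noncomputable def segLog (a b z : ℂ) : ℂ := Complex.log ((b - z) / (a - z))

/-- If the ratio were `-r` with `r ≥ 0`, then `z` would be the barycentre of `a` and `b` with
weights `r` and `1`. Hence the principal logarithm has its cut exactly where needed. -/
theorem div_mem_slitPlane {a b z : ℂ} (h : z ∉ segment ℝ a b) :
    (b - z) / (a - z) ∈ Complex.slitPlane := by
  have ha : a - z ≠ 0 := by
    intro h0
    rw [sub_eq_zero] at h0
    exact h (h0 ▸ left_mem_segment ℝ _ _)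
  rw [Complex.mem_slitPlane_iff]
  by_contra hc
  push Not at hc
  obtain ⟨h1, h2⟩ := hc
  set r : ℝ := -((b - z) / (a - z)).re with hr
  have hr0 : 0 ≤ r := by linarith
  have h3 : (b - z) / (a - z) = -(r : ℂ) := by
    apply Complex.ext <;> simp [hr, h2]
  rw [div_eq_iff ha] at h3
  apply h
  have hr1 : (1 + r : ℝ) ≠ 0 := by positivity
  have hr1' : (1 + (r : ℂ)) ≠ 0 := by exact_mod_cast hr1
  refine ⟨r / (1 + r), 1 / (1 + r), by positivity, by positivity, by field_simp; ring, ?_⟩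
  simp only [Complex.real_smul]
  push_cast
  field_simp
  linear_combination h3

theorem hasDerivAt_segLog {a b z : ℂ} (h : z ∉ segment ℝ a b) :
    HasDerivAt (segLog a b) (1 / (a - z) - 1 / (b - z)) z := by
  have ha : a - z ≠ 0 := by
    intro h0
    rw [sub_eq_zero] at h0
    exact h (h0 ▸ left_mem_segment ℝ _ _)
  have hb : b - z ≠ 0 := by
    intro h0
    rw [sub_eq_zero] at h0
    exact h (h0 ▸ right_mem_segment ℝ _ _)
  have h1 : HasDerivAt (fun z => (b - z) / (a - z)) ((-1 * (a - z) - (b - z) * -1) / (a - z) ^ 2) z :=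
    ((hasDerivAt_id z).const_sub b).div ((hasDerivAt_id z).const_sub a) ha
  have h2 := h1.clog (div_mem_slitPlane h)
  have h3 : 1 / (a - z) - 1 / (b - z) =
      (-1 * (a - z) - (b - z) * -1) / (a - z) ^ 2 / ((b - z) / (a - z)) := by
    field_simp
    ring
  rw [h3]
  exact h2

theorem tendsto_segLog_cobounded (a b : ℂ) :
    Tendsto (segLog a b) (Bornology.cobounded ℂ) (𝓝 0) := by
  have h1 : Tendsto (fun z : ℂ => 1 + (b - a) / (a - z)) (Bornology.cobounded ℂ) (𝓝 1) := by
    have h2 : Tendsto (fun z : ℂ => a - z) (Bornology.cobounded ℂ) (Bornology.cobounded ℂ) := by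
      simp
    have h3 := (tendsto_inv₀_cobounded.comp h2).const_mul (b - a)
    simpa [div_eq_mul_inv] using h3.const_add 1
  have h2 : Tendsto (fun z : ℂ => Complex.log (1 + (b - a) / (a - z))) (Bornology.cobounded ℂ)
      (𝓝 0) := by
    have := (continuousAt_clog Complex.one_mem_slitPlane).tendsto.comp h1
    rwa [Complex.log_one] at this
  refine h2.congr' ?_
  have h3 : ∀ᶠ z : ℂ in Bornology.cobounded ℂ, z ≠ a := by
    exact Bornology.eventually_ne_cobounded a
  filter_upwards [h3] with z hz
  have : a - z ≠ 0 := sub_ne_zero.2 hz.symm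
  unfold segLog
  congr 1
  field_simp
  ring

/-- The jump of `segLog` across the midpoint of the segment. -/
theorem tendsto_segLog_jump {a b : ℂ} (hab : a ≠ b) :
    Tendsto (fun s : ℝ => segLog a b (a + (b - a) * (((1 / 2 : ℝ) : ℂ) + s * Complex.I)) -
      segLog a b (a + (b - a) * (((1 / 2 : ℝ) : ℂ) - s * Complex.I))) (𝓝[>] 0)
      (𝓝 (2 * Real.pi * Complex.I)) := by
  have hsub : b - a ≠ 0 := sub_ne_zero.2 hab.symm
  -- This is the ratio on the right side; on the left side it is the conjugate. It tends to `-1`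
  -- through the lower half-plane, so its argument tends to `-π` and the difference of logarithms,
  -- `-2i * arg`, tends to `2πi`.
  let f : ℝ → ℂ := fun s => (1 / 2 + s * Complex.I) / (-(1 / 2) + s * Complex.I)
  have hd : ∀ s : ℝ, (-(1 / 2) + s * Complex.I : ℂ) ≠ 0 := fun s h => by
    have := congrArg Complex.re h
    norm_num at this
  have hfc : Continuous f := by
    apply Continuous.div (by fun_prop) (by fun_prop) hd
  have him : ∀ s : ℝ, 0 < s → (f s).im < 0 := by
    intro s hs
    simp only [f, Complex.div_im]
    have hn : 0 < Complex.normSq (-(1 / 2) + s * Complex.I) := Complex.normSq_pos.2 (hd s)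
    have e1 : (1 / 2 + (s : ℂ) * Complex.I).im = s := by simp
    have e2 : (1 / 2 + (s : ℂ) * Complex.I).re = 1 / 2 := by simp
    have e3 : (-(1 / 2) + (s : ℂ) * Complex.I).im = s := by simp
    have e4 : (-(1 / 2) + (s : ℂ) * Complex.I).re = -(1 / 2) := by simp
    rw [e1, e2, e3, e4]
    have : s * -(1 / 2) / Complex.normSq (-(1 / 2) + s * Complex.I) -
      1 / 2 * s / Complex.normSq (-(1 / 2) + s * Complex.I) =
      -(s / Complex.normSq (-(1 / 2) + s * Complex.I)) := by ring
    rw [this]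
    exact neg_lt_zero.2 (div_pos hs hn)
  have h1 : ∀ s : ℝ, segLog a b (a + (b - a) * (((1 / 2 : ℝ) : ℂ) - s * Complex.I)) =
      Complex.log (f s) := by
    intro s
    unfold segLog
    congr 1
    have e1 : b - (a + (b - a) * (((1 / 2 : ℝ) : ℂ) - s * Complex.I)) =
        (b - a) * (1 / 2 + s * Complex.I) := by push_cast; ring
    have e2 : a - (a + (b - a) * (((1 / 2 : ℝ) : ℂ) - s * Complex.I)) =
        (b - a) * (-(1 / 2) + s * Complex.I) := by push_cast; ring
    rw [e1, e2, mul_div_mul_left _ _ hsub]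
  have h2 : ∀ s : ℝ, segLog a b (a + (b - a) * (((1 / 2 : ℝ) : ℂ) + s * Complex.I)) =
      Complex.log ((starRingEnd ℂ) (f s)) := by
    intro s
    unfold segLog
    congr 1
    have e1 : b - (a + (b - a) * (((1 / 2 : ℝ) : ℂ) + s * Complex.I)) =
        (b - a) * (1 / 2 - s * Complex.I) := by push_cast; ring
    have e2 : a - (a + (b - a) * (((1 / 2 : ℝ) : ℂ) + s * Complex.I)) =
        (b - a) * (-(1 / 2) - s * Complex.I) := by push_cast; ring
    rw [e1, e2, mul_div_mul_left _ _ hsub]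
    simp [f, sub_eq_add_neg, Complex.conj_ofNat]
  have h3 : ∀ᶠ s : ℝ in 𝓝[>] 0, -2 * ((f s).arg : ℂ) * Complex.I =
      segLog a b (a + (b - a) * (((1 / 2 : ℝ) : ℂ) + s * Complex.I)) -
      segLog a b (a + (b - a) * (((1 / 2 : ℝ) : ℂ) - s * Complex.I)) := by
    filter_upwards [self_mem_nhdsWithin] with s hs
    have h4 : (f s).arg ≠ Real.pi := by
      intro h
      rw [Complex.arg_eq_pi_iff] at h
      exact (him s hs).ne h.2
    rw [h1, h2, Complex.log_conj _ h4]
    apply Complex.ext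
    · simp [Complex.log_re]
    · simp [Complex.log_im]
      ring
  refine Tendsto.congr' h3 ?_
  have h5 : Tendsto f (𝓝[>] 0) (𝓝[{z : ℂ | z.im < 0}] (-1)) := by
    apply tendsto_nhdsWithin_iff.2
    refine ⟨(hfc.tendsto' 0 (-1) (by simp [f])).mono_left nhdsWithin_le_nhds, ?_⟩
    filter_upwards [self_mem_nhdsWithin] with s hs
    exact him s hs
  have h6 := (Complex.tendsto_arg_nhdsWithin_im_neg_of_re_neg_of_im_zero
    (z := -1) (by simp) (by simp)).comp h5
  have h7 := (((Complex.continuous_ofReal.tendsto _).comp h6).const_mul (-2 : ℂ)).mul_const Complex.I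
  have h8 : 2 * Real.pi * Complex.I = -2 * ((-Real.pi : ℝ) : ℂ) * Complex.I := by
    push_cast
    ring
  rw [h8]
  exact h7

/-- The integral of `1 / (ζ - z)` along a polygonal arc. -/
noncomputable def arcLog (n : ℕ) (p : ℕ → ℂ) (z : ℂ) : ℂ :=
  ∑ i ∈ Finset.range n, segLog (p i) (p (i + 1)) z

namespace IsPolygonalArc

variable {n : ℕ} {p : ℕ → ℂ} {e : Set ℂ}

/-- The derivatives of the segment terms telescope, so the derivative sees only the ends of the arc.
This turns vertex conditions on coefficients into local constancy. -/
theorem hasDerivAt_arcLog (h : IsPolygonalArc n p e) {z : ℂ} (hz : z ∉ e) :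
    HasDerivAt (arcLog n p) (1 / (p 0 - z) - 1 / (p n - z)) z := by
  rw [← Finset.sum_range_sub' (fun i => 1 / (p i - z)) n]
  have : arcLog n p = fun z => ∑ i ∈ Finset.range n, segLog (p i) (p (i + 1)) z := rfl
  rw [this]
  apply HasDerivAt.fun_sum
  intro i hi
  exact hasDerivAt_segLog fun hzi => hz (h.mem_iff.2 ⟨i, Finset.mem_range.1 hi, hzi⟩)

theorem tendsto_arcLog_cobounded (n : ℕ) (p : ℕ → ℂ) :
    Tendsto (arcLog n p) (Bornology.cobounded ℂ) (𝓝 0) := by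
  have := tendsto_finsetSum (Finset.range n) fun i _ => tendsto_segLog_cobounded (p i) (p (i + 1))
  rw [Finset.sum_const_zero] at this
  exact this

/-- The midpoint of the first segment lies on no other segment, so all other terms are continuous
there. -/
theorem tendsto_arcLog_jump (h : IsPolygonalArc n p e) :
    Tendsto (fun s : ℝ => arcLog n p (p 0 + (p 1 - p 0) * (((1 / 2 : ℝ) : ℂ) + s * Complex.I)) -
      arcLog n p (p 0 + (p 1 - p 0) * (((1 / 2 : ℝ) : ℂ) - s * Complex.I))) (𝓝[>] 0)
      (𝓝 (2 * Real.pi * Complex.I)) := by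
  have hne := h.2.1 0 h.1
  have hm : p 0 + (p 1 - p 0) * ((1 / 2 : ℝ) : ℂ) ∈ openSegment ℝ (p 0) (p (0 + 1)) := by
    rw [openSegment_eq_image']
    exact ⟨1 / 2, by norm_num, by simp [mul_comm]⟩
  have h1 : ∀ i ∈ Finset.range n, Tendsto (fun s : ℝ =>
      segLog (p i) (p (i + 1)) (p 0 + (p 1 - p 0) * (((1 / 2 : ℝ) : ℂ) + s * Complex.I)) -
      segLog (p i) (p (i + 1)) (p 0 + (p 1 - p 0) * (((1 / 2 : ℝ) : ℂ) - s * Complex.I)))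
      (𝓝[>] 0) (𝓝 (if i = 0 then 2 * Real.pi * Complex.I else 0)) := by
    intro i hi
    rw [Finset.mem_range] at hi
    split_ifs with hi0
    · subst hi0
      exact tendsto_segLog_jump hne
    · have hns : p 0 + (p 1 - p 0) * ((1 / 2 : ℝ) : ℂ) ∉ segment ℝ (p i) (p (i + 1)) :=
        fun hmi => hi0 (h.eq_of_mem_openSegment h.1 hi hm hmi)
      have hc := (hasDerivAt_segLog hns).continuousAt.tendsto
      have c1 : Continuous fun s : ℝ => p 0 + (p 1 - p 0) * (((1 / 2 : ℝ) : ℂ) + s * Complex.I) := by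
        fun_prop
      have c2 : Continuous fun s : ℝ => p 0 + (p 1 - p 0) * (((1 / 2 : ℝ) : ℂ) - s * Complex.I) := by
        fun_prop
      have t1 := hc.comp (c1.tendsto' 0 _ (by simp))
      have t2 := hc.comp (c2.tendsto' 0 _ (by simp))
      have := (t1.sub t2).mono_left (nhdsWithin_le_nhds (s := Ioi 0))
      rwa [sub_self] at this
  have h2 := tendsto_finsetSum _ h1
  simp only [Finset.sum_sub_distrib] at h2
  rw [Finset.sum_ite_eq' (Finset.range n) 0, if_pos (Finset.mem_range.2 h.1)] at h2
  exact h2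

end IsPolygonalArc

/-! ### Potentials -/

/-- The potential is a preimage of `w` under the transpose of the boundary map `D`. The range of the
transpose is the annihilator of the kernel of `D`, which over a field needs no finiteness. -/
theorem exists_potential {ι X : Type*} (s t : ι → X) (w : ι → ℝ)
    (h : ∀ c : ι →₀ ℝ, Finsupp.linearCombination ℝ
      (fun i => Finsupp.single (s i) (1 : ℝ) - Finsupp.single (t i) 1) c = 0 →
      c.sum (fun i a => a * w i) = 0) :
    ∃ f : X → ℝ, ∀ i, f (s i) - f (t i) = w i := by
  set D := Finsupp.linearCombination ℝ
      (fun i => Finsupp.single (s i) (1 : ℝ) - Finsupp.single (t i) 1) with hD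
  have h1 : Finsupp.linearCombination ℝ w ∈ LinearMap.range D.dualMap := by
    rw [LinearMap.range_dualMap_eq_dualAnnihilator_ker, Submodule.mem_dualAnnihilator]
    intro c hc
    rw [Finsupp.linearCombination_apply]
    exact h c hc
  obtain ⟨φ, hφ⟩ := h1
  refine ⟨fun x => φ (Finsupp.single x 1), fun i => ?_⟩
  have h2 := LinearMap.congr_fun hφ (Finsupp.single i 1)
  simp [hD] at h2
  exact h2

namespace PlaneMap

variable {M : PlaneMap}

/-! ### Orientation of the edges -/

theorem exists_orient (e : M.E) : ∃ (d : M.DirEdge) (n : ℕ) (p : ℕ → ℂ), d.edge = e ∧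
    IsPolygonalArc n p d.edge ∧ p 0 = d.vertex ∧ p n = d.rev.vertex := by
  obtain ⟨n, p, hp, hV⟩ := M.edge_arc e e.2
  have h1 : p 0 ∈ (e : Set ℂ) ∩ M.V := hV ▸ Or.inl rfl
  refine ⟨⟨p 0, e, h1.2, e.2, h1.1⟩, n, p, rfl, hp, rfl, ?_⟩
  exact (DirEdge.rev_vertex_eq ⟨p 0, e, h1.2, e.2, h1.1⟩ hp rfl).symm

/-- A choice of a direction of the edge `e`. -/
noncomputable def orient (e : M.E) : M.DirEdge := (exists_orient e).choose

/-- The number of segments of the edge `e`. -/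
noncomputable def arcLength (e : M.E) : ℕ := (exists_orient e).choose_spec.choose

/-- The corners of the edge `e`, in the order given by `orient e`. -/
noncomputable def arcCorner (e : M.E) : ℕ → ℂ := (exists_orient e).choose_spec.choose_spec.choose

theorem orient_edge (e : M.E) : (orient e).edge = e :=
  (exists_orient e).choose_spec.choose_spec.choose_spec.1

theorem isPolygonalArc_orient (e : M.E) :
    IsPolygonalArc (arcLength e) (arcCorner e) (orient e).edge :=
  (exists_orient e).choose_spec.choose_spec.choose_spec.2.1

theorem arcCorner_zero (e : M.E) : arcCorner e 0 = (orient e).vertex :=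
  (exists_orient e).choose_spec.choose_spec.choose_spec.2.2.1

theorem arcCorner_last (e : M.E) : arcCorner e (arcLength e) = (orient e).rev.vertex :=
  (exists_orient e).choose_spec.choose_spec.choose_spec.2.2.2

/-- The edge underlying a directed edge. -/
def DirEdge.edge' (d : M.DirEdge) : M.E := ⟨d.edge, d.edge_mem⟩

theorem orient_edge' (e : M.E) : (orient e).edge' = e := Subtype.ext (orient_edge e)

theorem DirEdge.eq_orient_or (d : M.DirEdge) : d = orient d.edge' ∨ d = (orient d.edge').rev :=
  DirEdge.eq_or_eq_rev (orient_edge d.edge').symm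

/-- The logarithm of the arc of the edge `e`. -/
noncomputable def edgeLog (e : M.E) : ℂ → ℂ := arcLog (arcLength e) (arcCorner e)

theorem hasDerivAt_edgeLog (e : M.E) {z : ℂ} (hz : z ∉ (e : Set ℂ)) : HasDerivAt (edgeLog e)
    (1 / ((orient e).vertex - z) - 1 / ((orient e).rev.vertex - z)) z := by
  rw [← arcCorner_zero, ← arcCorner_last]
  exact (isPolygonalArc_orient e).hasDerivAt_arcLog (by rwa [orient_edge])

/-- The midpoint of the first segment of `e`. -/
noncomputable def edgeMid (e : M.E) : ℂ :=
  arcCorner e 0 + (arcCorner e 1 - arcCorner e 0) * ((1 / 2 : ℝ) : ℂ)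

theorem edgeMid_mem (e : M.E) : edgeMid e ∈ (e : Set ℂ) ∧ edgeMid e ∉ M.V := by
  have hp := isPolygonalArc_orient e
  rw [← orient_edge e]
  refine openSegment_notMem hp (arc_inter (orient e).edge_mem hp) hp.1 ?_
  rw [openSegment_eq_image']
  exact ⟨1 / 2, by norm_num, by simp [edgeMid, mul_comm]⟩

theorem eventually_right_orient (e : M.E) : ∀ᶠ s : ℝ in 𝓝[>] 0, arcCorner e 0 +
    (arcCorner e 1 - arcCorner e 0) * (((1 / 2 : ℝ) : ℂ) - s * Complex.I) ∈ (orient e).right :=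
  ((orient e).rightAt (isPolygonalArc_orient e) (arcCorner_zero e)
    (isPolygonalArc_orient e).1).2

theorem eventually_left_orient (e : M.E) : ∀ᶠ s : ℝ in 𝓝[>] 0, arcCorner e 0 +
    (arcCorner e 1 - arcCorner e 0) * (((1 / 2 : ℝ) : ℂ) + s * Complex.I) ∈
      (orient e).rev.right := by
  have hp := isPolygonalArc_orient e
  have h0 := hp.1
  have hr : IsPolygonalArc (arcLength e) (fun i => arcCorner e (arcLength e - i))
      (orient e).rev.edge := (orient e).rev_edge ▸ hp.reverse
  have h1 := ((orient e).rev.rightAt hr (by simpa using arcCorner_last e)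
    (i := arcLength e - 1) (by omega)).2
  filter_upwards [h1] with s hs
  rw [show arcLength e - (arcLength e - 1) = 1 by omega,
    show arcLength e - (arcLength e - 1 + 1) = 0 by omega] at hs
  convert hs using 1
  push_cast
  ring

/-- The jump, across an edge, of a combination of logarithms of edges. -/
theorem jump_eq (S : Finset M.E) (c : M.E → ℝ) (g : ℂ → ℂ) (e₀ : M.E)
    (hg : ContinuousAt g (edgeMid e₀)) {kR kL : ℂ}
    (hR : ∀ z ∈ (orient e₀).right, ∑ e ∈ S, (c e : ℂ) * edgeLog e z + g z = kR)
    (hL : ∀ z ∈ (orient e₀).rev.right, ∑ e ∈ S, (c e : ℂ) * edgeLog e z + g z = kL) :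
    kL - kR = if e₀ ∈ S then (c e₀ : ℂ) * (2 * Real.pi * Complex.I) else 0 := by
  let zR : ℝ → ℂ := fun s => arcCorner e₀ 0 +
    (arcCorner e₀ 1 - arcCorner e₀ 0) * (((1 / 2 : ℝ) : ℂ) - s * Complex.I)
  let zL : ℝ → ℂ := fun s => arcCorner e₀ 0 +
    (arcCorner e₀ 1 - arcCorner e₀ 0) * (((1 / 2 : ℝ) : ℂ) + s * Complex.I)
  have cR : Continuous zR := by fun_prop
  have cL : Continuous zL := by fun_prop
  have tR : Tendsto zR (𝓝[>] 0) (𝓝 (edgeMid e₀)) :=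
    (cR.tendsto' 0 _ (by simp [zR, edgeMid])).mono_left nhdsWithin_le_nhds
  have tL : Tendsto zL (𝓝[>] 0) (𝓝 (edgeMid e₀)) :=
    (cL.tendsto' 0 _ (by simp [zL, edgeMid])).mono_left nhdsWithin_le_nhds
  have h1 : ∀ e ∈ S, Tendsto (fun s => (c e : ℂ) * edgeLog e (zL s) - (c e : ℂ) * edgeLog e (zR s))
      (𝓝[>] 0) (𝓝 (if e = e₀ then (c e₀ : ℂ) * (2 * Real.pi * Complex.I) else 0)) := by
    intro e _
    simp only [← mul_sub]
    split_ifs with he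
    · subst he
      exact (isPolygonalArc_orient e).tendsto_arcLog_jump.const_mul _
    · have hm : edgeMid e₀ ∉ (e : Set ℂ) := fun h => (edgeMid_mem e₀).2
        (M.edge_inter e e.2 e₀ e₀.2 (fun h => he (Subtype.ext h)) ⟨h, (edgeMid_mem e₀).1⟩)
      have hc := (hasDerivAt_edgeLog e hm).continuousAt.tendsto
      have := ((hc.comp tL).sub (hc.comp tR)).const_mul (c e : ℂ)
      rwa [sub_self, mul_zero] at this
  have h2 := (tendsto_finsetSum S h1).add ((hg.tendsto.comp tL).sub (hg.tendsto.comp tR))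
  rw [sub_self, add_zero, Finset.sum_ite_eq'] at h2
  refine tendsto_nhds_unique (Tendsto.congr' ?_ tendsto_const_nhds) h2
  filter_upwards [eventually_right_orient e₀, eventually_left_orient e₀] with s hsR hsL
  rw [← hR _ hsR, ← hL _ hsL, Finset.sum_sub_distrib]
  simp only [zL, zR, Function.comp]
  ring

theorem edge_inter_closure_right (d : M.DirEdge) : (d.edge ∩ closure d.right).Nonempty := by
  obtain ⟨n, p, hp, h0, _⟩ := d.exists_arc
  have h1 := (d.rightAt hp h0 hp.1).2
  refine ⟨p 0 + (p (0 + 1) - p 0) * ((1 / 2 : ℝ) : ℂ), hp.mem_iff.2 ⟨0, hp.1, ?_⟩, ?_⟩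
  · rw [segment_eq_image']
    exact ⟨1 / 2, by norm_num, by simp [mul_comm]⟩
  · have hc : Continuous fun s : ℝ => p 0 + (p (0 + 1) - p 0) * (((1 / 2 : ℝ) : ℂ) - s * Complex.I) := by
      fun_prop
    exact mem_closure_of_tendsto ((hc.tendsto' 0 _ (by simp)).mono_left nhdsWithin_le_nhds) h1

/-! ### Sums over directed edges -/

theorem finite_dirEdge_of_edge {S : Set (Set ℂ)} (hS : S.Finite) :
    {d : M.DirEdge | d.edge ∈ S}.Finite := by
  have : {d : M.DirEdge | d.edge ∈ S} = ⋃ e ∈ S, {d : M.DirEdge | d.edge = e} := by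
    ext d
    simp
  rw [this]
  refine hS.biUnion fun e _ => ?_
  by_cases h : ∃ d : M.DirEdge, d.edge = e
  · obtain ⟨d, rfl⟩ := h
    refine (Set.toFinite {d, d.rev}).subset ?_
    intro d' hd'
    exact DirEdge.eq_or_eq_rev hd'
  · refine Set.Finite.subset Set.finite_empty ?_
    intro d hd
    exact h ⟨d, hd⟩

theorem finite_dirEdge_right {F : Set ℂ} (hF : F ∈ M.faces) :
    {d : M.DirEdge | d.right = F}.Finite := by
  have hK : IsCompact (closure F) := (M.face_bounded F hF).isCompact_closure
  refine (finite_dirEdge_of_edge (finite_edges_meeting (M := M) hK)).subset ?_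
  rintro d rfl
  exact ⟨d.edge_mem, edge_inter_closure_right d⟩

theorem setOf_onRight (F : Set ℂ) : {d : M.DirEdge | OnRight d F} = {d | d.right = F} := by
  ext d
  exact onRight_iff

theorem IsHarmonic.rev {w : M.DirEdge → ℝ} (hw : IsHarmonic w) (d : M.DirEdge) :
    w d.rev = -w d := by
  have h1 := hw.2.1 d.edge d.edge_mem
  have h2 : {d' : M.DirEdge | d'.edge = d.edge} = {d, d.rev} := by
    ext d'
    constructor
    · exact fun h => DirEdge.eq_or_eq_rev h
    · rintro (rfl | rfl)
      · rfl
      · exact d.rev_edge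
  have hne : d ≠ d.rev := fun h => d.rev_vertex_ne (congrArg DirEdge.vertex h).symm
  rw [h2, finsum_mem_pair hne] at h1
  linarith

open Classical in
/-- Summation by parts: the pairing of `w` with a coboundary vanishes if `w` has zero sums over
the fibres of `π` that matter. -/
theorem sum_coboundary_eq_zero {A X : Type*} [AddCommGroup A] [Module ℝ A] (S : Finset M.E)
    {w : M.DirEdge → ℝ} (hw : ∀ d, w d.rev = -w d) (π : M.DirEdge → X) (k : X → A)
    (hk : ∀ d₀, k (π d₀) ≠ 0 → (∀ d, π d = π d₀ → d.edge' ∈ S) ∧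
      ∑ᶠ d ∈ {d | π d = π d₀}, w d = 0) :
    ∑ e ∈ S, w (orient e) • (k (π (orient e)) - k (π (orient e).rev)) = 0 := by
  have hne : ∀ d : M.DirEdge, d ≠ d.rev := fun d h => d.rev_vertex_ne (congrArg DirEdge.vertex h).symm
  let D : Finset M.DirEdge := S.biUnion fun e => {orient e, (orient e).rev}
  have hD : ∀ d : M.DirEdge, d ∈ D ↔ d.edge' ∈ S := by
    intro d
    simp only [D, Finset.mem_biUnion, Finset.mem_insert, Finset.mem_singleton]
    constructor
    · rintro ⟨e, he, rfl | rfl⟩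
      · rwa [orient_edge']
      · have : (orient e).rev.edge' = (orient e).edge' := Subtype.ext (orient e).rev_edge
        rwa [this, orient_edge']
    · intro h
      exact ⟨_, h, d.eq_orient_or⟩
  -- By antisymmetry of `w`, each edge contributes the sum over its two directions; the sum can then
  -- be regrouped by fibres of `π`.
  have h1 : ∑ e ∈ S, w (orient e) • (k (π (orient e)) - k (π (orient e).rev)) =
      ∑ d ∈ D, w d • k (π d) := by
    rw [Finset.sum_biUnion]
    · refine Finset.sum_congr rfl fun e _ => ?_
      rw [Finset.sum_pair (hne _), hw, smul_sub, neg_smul, sub_eq_add_neg]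
    · intro e _ e' _ hee
      rw [Function.onFun, Finset.disjoint_left]
      intro d hd hd'
      have key : ∀ e : M.E, d ∈ ({orient e, (orient e).rev} : Finset M.DirEdge) → d.edge' = e := by
        intro e h
        simp only [Finset.mem_insert, Finset.mem_singleton] at h
        rcases h with rfl | rfl
        · exact orient_edge' e
        · exact Subtype.ext ((orient e).rev_edge.trans (orient_edge e))
      exact hee ((key e hd).symm.trans (key e' hd'))
  rw [h1, ← Finset.sum_fiberwise_of_maps_to (t := D.image π)
    (fun d hd => Finset.mem_image_of_mem π hd)]
  refine Finset.sum_eq_zero fun x hx => ?_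
  obtain ⟨d₀, _, rfl⟩ := Finset.mem_image.1 hx
  have h2 : ∑ d ∈ D with π d = π d₀, w d • k (π d) =
      (∑ d ∈ D with π d = π d₀, w d) • k (π d₀) := by
    rw [Finset.sum_smul]
    refine Finset.sum_congr rfl fun d hd => ?_
    rw [(Finset.mem_filter.1 hd).2]
  rw [h2]
  by_cases h0 : k (π d₀) = 0
  · rw [h0, smul_zero]
  · obtain ⟨h3, h4⟩ := hk d₀ h0
    have h5 : {d | π d = π d₀} = ((D.filter fun d => π d = π d₀ : Finset M.DirEdge) :
        Set M.DirEdge) := by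
      ext d
      simp only [mem_ofPred_eq, Finset.coe_filter]
      exact ⟨fun h => ⟨(hD d).2 (h3 d h), h⟩, fun h => h.2⟩
    rw [h5, finsum_mem_coe_finset] at h4
    rw [h4, zero_smul]

end PlaneMap

namespace PlaneMap

variable {M : PlaneMap}

/-! ### Existence of the tiling -/

theorem const_on_face {N : ℂ → ℂ} {F : Set ℂ} (hF : F ∈ M.faces)
    (hN : ∀ z ∈ F, HasDerivAt N 0 z) : ∃ k, ∀ z ∈ F, N z = k := by
  obtain ⟨z₀, hz₀⟩ := face_nonempty hF
  refine ⟨N z₀, fun z hz => ?_⟩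
  exact (isOpen_face hF).is_const_of_deriv_eq_zero (isPreconnected_face hF)
    (fun x hx => (hN x hx).differentiableAt.differentiableWithinAt) (fun x hx => (hN x hx).deriv)
    hz hz₀

open Classical in
/-- The value on faces of a function that is constant on faces, up to the factor `2πi`. -/
noncomputable def faceValue (M : PlaneMap) (N : ℂ → ℂ) (F : Set ℂ) : ℝ :=
  if h : F ∈ M.faces then (N (face_nonempty h).some).im / (2 * Real.pi) else 0

theorem faceValue_eq {N : ℂ → ℂ} {F : Set ℂ} (hF : F ∈ M.faces) {k : ℂ} (hk : ∀ z ∈ F, N z = k) :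
    faceValue M N F = k.im / (2 * Real.pi) := by
  rw [faceValue, dif_pos hF, hk _ (face_nonempty hF).some_mem]

theorem faceValue_sub (S : Finset M.E) (c : M.E → ℝ) (g : ℂ → ℂ) (e : M.E) (he : c e ≠ 0 → e ∈ S)
    (hg : ContinuousAt g (edgeMid e)) {kR kL : ℂ}
    (hR : ∀ z ∈ (orient e).right, ∑ e ∈ S, (c e : ℂ) * edgeLog e z + g z = kR)
    (hL : ∀ z ∈ (orient e).rev.right, ∑ e ∈ S, (c e : ℂ) * edgeLog e z + g z = kL) :
    faceValue M (fun z => ∑ e ∈ S, (c e : ℂ) * edgeLog e z + g z) (orient e).rev.right -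
      faceValue M (fun z => ∑ e ∈ S, (c e : ℂ) * edgeLog e z + g z) (orient e).right = c e := by
  rw [faceValue_eq (orient e).rev.right_mem_faces hL, faceValue_eq (orient e).right_mem_faces hR,
    ← sub_div, ← Complex.sub_im, jump_eq S c g e hg hR hL]
  have hpi : Real.pi ≠ 0 := Real.pi_ne_zero
  split_ifs with h
  · have : ((c e : ℂ) * (2 * Real.pi * Complex.I)).im = c e * (2 * Real.pi) := by simp
    rw [this]
    field_simp
  · have : c e = 0 := by
      by_contra h'
      exact h (he h')
    rw [this]
    simp

open Classical in
/-- The edges that meet the closed ball of radius `R`. -/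
noncomputable def edgesNear (M : PlaneMap) (R : ℝ) : Finset M.E :=
  ((finite_edges_meeting (M := M) (isCompact_closedBall (0 : ℂ) R)).preimage
    (Subtype.val_injective.injOn (s := (Subtype.val : M.E → Set ℂ) ⁻¹' _))).toFinset

theorem mem_edgesNear {R : ℝ} {e : M.E} :
    e ∈ edgesNear M R ↔ ((e : Set ℂ) ∩ Metric.closedBall 0 R).Nonempty := by
  simp [edgesNear]

theorem exists_radius (S : Finset M.E) : ∃ R > 0, ∀ e ∈ S, (e : Set ℂ) ⊆ Metric.ball 0 R ∧
    (orient e).right ⊆ Metric.ball 0 R ∧ (orient e).rev.right ⊆ Metric.ball 0 R := by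
  have h : Bornology.IsBounded (⋃ e ∈ S, ((e : Set ℂ) ∪ ((orient e).right ∪ (orient e).rev.right))) := by
    rw [Bornology.isBounded_biUnion_finset]
    intro e _
    exact (isCompact_edge e.2).isBounded.union
      ((M.face_bounded _ (orient e).right_mem_faces).union
        (M.face_bounded _ (orient e).rev.right_mem_faces))
  obtain ⟨R, hR, hsub⟩ := h.subset_ball_lt 0 0
  refine ⟨R, hR, fun e he => ?_⟩
  have h1 := (subset_biUnion_of_mem (u := fun e : M.E =>
    ((e : Set ℂ) ∪ ((orient e).right ∪ (orient e).rev.right))) he).trans hsub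
  exact ⟨subset_union_left.trans h1, (subset_union_left.trans subset_union_right).trans h1,
    (subset_union_right.trans subset_union_right).trans h1⟩

theorem hasDerivAt_sum_edgeLog (S : Finset M.E) (c : M.E → ℝ) {z : ℂ}
    (hz : ∀ e ∈ S, z ∉ (e : Set ℂ)) :
    HasDerivAt (fun z => ∑ e ∈ S, (c e : ℂ) * edgeLog e z) (∑ e ∈ S, (c e : ℂ) *
      (1 / ((orient e).vertex - z) - 1 / ((orient e).rev.vertex - z))) z := by
  apply HasDerivAt.fun_sum
  intro e he
  exact (hasDerivAt_edgeLog e (hz e he)).const_mul _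

/-- Along the ray from `z` to infinity the function is constant, and its limit is 0; no
connectedness of the exterior of the disc is needed. -/
theorem eq_zero_of_ray {N : ℂ → ℂ} {R : ℝ} (hR : 0 < R)
    (hN : ∀ z, R < ‖z‖ → HasDerivAt N 0 z) (hlim : Tendsto N (Bornology.cobounded ℂ) (𝓝 0))
    {z : ℂ} (hz : R < ‖z‖) : N z = 0 := by
  have hz0 : 0 < ‖z‖ := hR.trans hz
  have key : ∀ t : ℝ, 1 ≤ t → HasDerivAt (fun t : ℝ => N (t * z)) 0 t := by
    intro t ht
    have h1 : R < ‖(t : ℂ) * z‖ := by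
      rw [norm_mul, Complex.norm_real, Real.norm_eq_abs, abs_of_pos (by linarith)]
      nlinarith
    have h2 : HasDerivAt (fun t : ℝ => (t : ℂ) * z) (1 * z) t :=
      (Complex.ofRealCLM.hasDerivAt (x := t)).mul_const z
    have h3 := (hN _ h1).comp t h2
    rw [zero_mul] at h3
    exact h3
  have hconst : ∀ t : ℝ, 1 ≤ t → N (t * z) = N z := by
    intro t ht
    have := constant_of_has_deriv_right_zero (f := fun t : ℝ => N (t * z)) (a := 1) (b := t)
      (fun s hs => (key s hs.1).continuousAt.continuousWithinAt)
      (fun s hs => (key s hs.1).hasDerivWithinAt) t ⟨ht, le_rfl⟩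
    simpa using this
  have hT : Tendsto (fun t : ℝ => (t : ℂ) * z) atTop (Bornology.cobounded ℂ) := by
    rw [← tendsto_norm_atTop_iff_cobounded]
    have h1 : Tendsto (fun t : ℝ => t * ‖z‖) atTop atTop := tendsto_id.atTop_mul_const hz0
    refine h1.congr' ?_
    filter_upwards [eventually_ge_atTop 0] with t ht
    rw [norm_mul, Complex.norm_real, Real.norm_eq_abs, abs_of_nonneg ht]
  have h2 := hlim.comp hT
  refine tendsto_nhds_unique (Tendsto.congr' ?_ tendsto_const_nhds) h2
  filter_upwards [eventually_ge_atTop 1] with t ht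
  exact (hconst t ht).symm

theorem sum_pairing {ι X : Type*} {A : Type*} [AddCommGroup A] [Module ℝ A] (s t : ι → X)
    (c : ι →₀ ℝ) (k : X → A) (h : Finsupp.linearCombination ℝ
      (fun i => Finsupp.single (s i) (1 : ℝ) - Finsupp.single (t i) 1) c = 0) :
    ∑ i ∈ c.support, c i • (k (s i) - k (t i)) = 0 := by
  have h1 := congrArg (Finsupp.linearCombination ℝ k) h
  rw [map_zero, Finsupp.linearCombination_apply ℝ c, Finsupp.sum, map_sum] at h1
  rw [← h1]
  refine Finset.sum_congr rfl fun i _ => ?_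
  simp

/-- A finite cycle `c` is the coboundary of its winding number, a function on faces that vanishes
far away. Summation by parts moves the pairing with `w` to the face sums of `w`, which are zero. -/
theorem exists_height {w : M.DirEdge → ℝ} (hw : IsHarmonic w) :
    ∃ y : ℂ → ℝ, ∀ d : M.DirEdge, y d.vertex - y d.rev.vertex = w d := by
  have hrev := hw.rev
  suffices h : ∃ y : ℂ → ℝ, ∀ e : M.E, y (orient e).vertex - y (orient e).rev.vertex =
      w (orient e) by
    obtain ⟨y, hy⟩ := h
    refine ⟨y, fun d => ?_⟩
    rcases d.eq_orient_or with h | h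
    · rw [h, hy]
    · have h2 : d.rev = orient d.edge' := by rw [h, DirEdge.rev_rev, ← h]
      have h3 := hy d.edge'
      rw [← h2, DirEdge.rev_rev, hrev] at h3
      linarith
  refine exists_potential _ _ _ fun c hc => ?_
  obtain ⟨R, hR, hSR⟩ := exists_radius c.support
  -- The zero summand stands for the correction term `g` of `faceValue_sub`, which is needed only
  -- for the abscissas.
  set N : ℂ → ℂ := fun z => ∑ e ∈ c.support, (c e : ℂ) * edgeLog e z + (fun _ => 0) z with hNdef
  have hder : ∀ z, (∀ e ∈ c.support, z ∉ (e : Set ℂ)) → HasDerivAt N 0 z := by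
    intro z hz
    have h1 := hasDerivAt_sum_edgeLog c.support c hz
    have h2 := sum_pairing (fun e : M.E => (orient e).vertex) (fun e : M.E => (orient e).rev.vertex)
      c (fun v : ℂ => 1 / (v - z)) hc
    simp only [Complex.real_smul] at h2
    rw [h2] at h1
    simpa [hNdef] using h1
  have hface : ∀ F ∈ M.faces, ∃ k, ∀ z ∈ F, N z = k := fun F hF =>
    const_on_face hF fun z hz => hder z fun e _ hze =>
      face_subset hF hz (edge_subset_graph e.2 hze)
  have hfar : ∀ z, R < ‖z‖ → N z = 0 := by
    intro z hz
    refine eq_zero_of_ray hR (fun z hz => hder z fun e he hze => ?_) ?_ hz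
    · have := (hSR e he).1 hze
      rw [mem_ball_zero_iff] at this
      linarith
    · have h1 := tendsto_finsetSum c.support fun e _ =>
        (IsPolygonalArc.tendsto_arcLog_cobounded (arcLength e) (arcCorner e)).const_mul (c e : ℂ)
      simpa [hNdef, edgeLog] using h1
  have hjump : ∀ e : M.E, faceValue M N (orient e).rev.right - faceValue M N (orient e).right =
      c e := by
    intro e
    obtain ⟨kR, hkR⟩ := hface _ (orient e).right_mem_faces
    obtain ⟨kL, hkL⟩ := hface _ (orient e).rev.right_mem_faces
    exact faceValue_sub c.support c (fun _ => 0) e (fun h => Finsupp.mem_support_iff.2 h)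
      continuousAt_const hkR hkL
  -- A face with nonzero value cannot reach outside the ball, where `N` vanishes, so all edges
  -- around it meet the closed ball.
  have hsum := sum_coboundary_eq_zero (edgesNear M R) hrev DirEdge.right (faceValue M N) (by
    intro d₀ hd₀
    constructor
    · intro d hd
      rw [mem_edgesNear]
      obtain ⟨z, hz, hzc⟩ := edge_inter_closure_right d
      refine ⟨z, hz, ?_⟩
      have hsub : d.right ⊆ Metric.closedBall 0 R := by
        intro x hx
        rw [mem_closedBall_zero_iff]
        by_contra hcon
        push Not at hcon
        obtain ⟨k, hk⟩ := hface _ d.right_mem_faces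
        apply hd₀
        rw [← hd, faceValue_eq d.right_mem_faces hk, ← hk x hx, hfar x hcon]
        simp
      exact closure_minimal hsub Metric.isClosed_closedBall hzc
    · have := hw.2.2 d₀.right d₀.right_mem_faces
      rwa [setOf_onRight] at this)
  have h1 : ∑ e ∈ edgesNear M R, c e * w (orient e) = 0 := by
    rw [← neg_eq_zero, ← hsum, ← Finset.sum_neg_distrib]
    refine Finset.sum_congr rfl fun e _ => ?_
    rw [← hjump e, smul_eq_mul]
    ring
  rw [Finsupp.sum, ← h1]
  refine Finset.sum_subset (fun e he => ?_) fun e _ he => ?_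
  · rw [mem_edgesNear]
    have hm := (edgeMid_mem e).1
    exact ⟨_, hm, Metric.ball_subset_closedBall ((hSR e he).1 hm)⟩
  · rw [Finsupp.notMem_support_iff.1 he, zero_mul]

/-- A primitive of `- 1 / (v - z)` in the disc of radius `R`, if `v` lies outside. -/
noncomputable def outerLog (R : ℝ) (v z : ℂ) : ℂ := if ‖v‖ < R then 0 else Complex.log (1 - z / v)

theorem hasDerivAt_outerLog {R : ℝ} (v : ℂ) {z : ℂ} (hz : ‖z‖ < R) :
    HasDerivAt (outerLog R v) (if ‖v‖ < R then 0 else -(1 / (v - z))) z := by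
  unfold outerLog
  split_ifs with h
  · exact hasDerivAt_const z 0
  · have hv : ‖z‖ < ‖v‖ := by linarith
    have hv0 : v ≠ 0 := norm_pos_iff.1 ((norm_nonneg z).trans_lt hv)
    have hvz : v - z ≠ 0 := sub_ne_zero.2 fun h => by rw [h] at hv; exact lt_irrefl _ hv
    have h1 : 1 - z / v ∈ Complex.slitPlane := by
      rw [sub_eq_add_neg]
      apply Complex.mem_slitPlane_of_norm_lt_one
      rw [norm_neg, norm_div]
      exact (div_lt_one ((norm_nonneg z).trans_lt hv)).2 hv
    have h2 : HasDerivAt (fun z => 1 - z / v) (-(1 / v)) z :=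
      ((hasDerivAt_id z).div_const v).const_sub 1
    have h3 := h2.clog h1
    convert h3 using 1
    have : 1 - z / v ≠ 0 := Complex.slitPlane_ne_zero h1
    field_simp

/-- It suffices to solve the problem on the finitely many faces adjacent to the support of `c`. In a
disc that contains them, the logarithmic integrals weighted by `w` give a solution: vertices inside
cancel by the vertex sums, and vertices outside contribute terms with a primitive in the disc. -/
theorem exists_abscissa {w : M.DirEdge → ℝ} (hw : IsHarmonic w) :
    ∃ x : Set ℂ → ℝ, ∀ d : M.DirEdge, x d.rev.right - x d.right = w d := by
  have hrev := hw.rev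
  suffices h : ∃ x : Set ℂ → ℝ, ∀ e : M.E, x (orient e).rev.right - x (orient e).right =
      w (orient e) by
    obtain ⟨x, hx⟩ := h
    refine ⟨x, fun d => ?_⟩
    rcases d.eq_orient_or with h | h
    · rw [h, hx]
    · have h2 : d.rev = orient d.edge' := by rw [h, DirEdge.rev_rev, ← h]
      have h3 := hx d.edge'
      rw [← h2, DirEdge.rev_rev, hrev] at h3
      linarith
  refine exists_potential _ _ _ fun c hc => ?_
  obtain ⟨R, hR, hSR⟩ := exists_radius c.support
  let S := edgesNear M R
  -- Edges near the rim have ends outside the disc whose vertex sum is incomplete over `S`; `g`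
  -- removes exactly their contributions to the derivative.
  let g : ℂ → ℂ := fun z => ∑ e ∈ S, (w (orient e) : ℂ) *
    (outerLog R (orient e).vertex z - outerLog R (orient e).rev.vertex z)
  let N : ℂ → ℂ := fun z => ∑ e ∈ S, (w (orient e) : ℂ) * edgeLog e z + g z
  have hg : ∀ z, ‖z‖ < R → HasDerivAt g (∑ e ∈ S, (w (orient e) : ℂ) *
      ((if ‖(orient e).vertex‖ < R then 0 else -(1 / ((orient e).vertex - z))) -
      (if ‖(orient e).rev.vertex‖ < R then 0 else -(1 / ((orient e).rev.vertex - z))))) z := by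
    intro z hz
    apply HasDerivAt.fun_sum
    intro e _
    exact ((hasDerivAt_outerLog _ hz).sub (hasDerivAt_outerLog _ hz)).const_mul _
  have hder : ∀ z, ‖z‖ < R → z ∉ M.graph → HasDerivAt N 0 z := by
    intro z hz hzg
    have h1 := (hasDerivAt_sum_edgeLog S (fun e => w (orient e))
      fun e _ hze => hzg (edge_subset_graph e.2 hze)).add (hg z hz)
    have h2 := sum_coboundary_eq_zero S hrev DirEdge.vertex
      (fun v : ℂ => if ‖v‖ < R then 1 / (v - z) else 0) (by
        intro d₀ hd₀
        have hlt : ‖d₀.vertex‖ < R := by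
          by_contra h
          exact hd₀ (if_neg h)
        refine ⟨fun d hd => ?_, hw.1 _ d₀.vertex_mem⟩
        rw [mem_edgesNear]
        refine ⟨d.vertex, d.mem, ?_⟩
        rw [hd, mem_closedBall_zero_iff]
        exact hlt.le)
    rw [← Finset.sum_add_distrib] at h1
    have h4 : (0 : ℂ) = ∑ e ∈ S, ((w (orient e) : ℂ) *
        (1 / ((orient e).vertex - z) - 1 / ((orient e).rev.vertex - z)) + (w (orient e) : ℂ) *
        ((if ‖(orient e).vertex‖ < R then 0 else -(1 / ((orient e).vertex - z))) -
        (if ‖(orient e).rev.vertex‖ < R then 0 else -(1 / ((orient e).rev.vertex - z))))) := by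
      refine h2.symm.trans (Finset.sum_congr rfl fun e _ => ?_)
      rw [Complex.real_smul]
      split_ifs <;> ring
    rw [h4]
    exact h1
  have hface : ∀ F ∈ M.faces, F ⊆ Metric.ball 0 R → ∃ k, ∀ z ∈ F, N z = k := fun F hF hFR =>
    const_on_face hF fun z hz => hder z (mem_ball_zero_iff.1 (hFR hz)) (face_subset hF hz)
  have hjump : ∀ e ∈ c.support, faceValue M N (orient e).rev.right -
      faceValue M N (orient e).right = w (orient e) := by
    intro e he
    obtain ⟨h1, h2, h3⟩ := hSR e he
    obtain ⟨kR, hkR⟩ := hface _ (orient e).right_mem_faces h2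
    obtain ⟨kL, hkL⟩ := hface _ (orient e).rev.right_mem_faces h3
    have hm := (edgeMid_mem e).1
    refine faceValue_sub S (fun e => w (orient e)) g e (fun _ => ?_)
      (hg _ (mem_ball_zero_iff.1 (h1 hm))).continuousAt hkR hkL
    rw [mem_edgesNear]
    exact ⟨_, hm, Metric.ball_subset_closedBall (h1 hm)⟩
  -- Having zero boundary on faces, `c` pairs to zero with every difference of face values, and on
  -- its support these differences equal `w`.
  have h1 := sum_pairing (fun e : M.E => (orient e).rev.right) (fun e : M.E => (orient e).right)
      c (faceValue M N) hc
  rw [Finsupp.sum, ← h1]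
  refine Finset.sum_congr rfl fun e he => ?_
  rw [hjump e he, smul_eq_mul]

theorem nonempty_squareTiling {w : M.DirEdge → ℝ} (hw : IsHarmonic w) :
    Nonempty (M.SquareTiling w) := by
  obtain ⟨y, hy⟩ := exists_height hw
  obtain ⟨x, hx⟩ := exists_abscissa hw
  refine ⟨⟨y, x, ?_, ?_⟩⟩
  · intro d d' h
    rw [h.eq_rev]
    exact hy d
  · intro d d' F F' h hF hF'
    rw [h.eq_rev, onRight_iff] at hF'
    rw [onRight_iff] at hF
    rw [← hF, ← hF']
    exact hx d

end PlaneMap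

/-! ### Isometries of the plane -/

/-- `f` is an orientation-preserving isometry. -/
def IsDirect (f : ℂ ≃ᵢ ℂ) : Prop := ∃ a b : ℂ, ‖a‖ = 1 ∧ ∀ z, f z = a * z + b

/-- `f` is an orientation-reversing isometry. -/
def IsOpposite (f : ℂ ≃ᵢ ℂ) : Prop :=
  ∃ a b : ℂ, ‖a‖ = 1 ∧ ∀ z, f z = a * (starRingEnd ℂ) z + b

theorem isDirect_or_isOpposite (f : ℂ ≃ᵢ ℂ) : IsDirect f ∨ IsOpposite f := by
  obtain ⟨a, ha⟩ := linear_isometry_complex f.toRealLinearIsometryEquiv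
  have h : ∀ z, f z = f.toRealLinearIsometryEquiv z + f 0 := by
    intro z
    simp [IsometryEquiv.toRealLinearIsometryEquiv_apply]
  rcases ha with ha | ha
  · refine Or.inl ⟨a, f 0, Circle.norm_coe a, fun z => ?_⟩
    rw [h, ha, rotation_apply]
  · refine Or.inr ⟨a, f 0, Circle.norm_coe a, fun z => ?_⟩
    rw [h, ha]
    simp

theorem image_segment_isometry (f : ℂ ≃ᵢ ℂ) (a b : ℂ) :
    f '' segment ℝ a b = segment ℝ (f a) (f b) := by
  have := image_segment ℝ f.toRealAffineIsometryEquiv.toAffineEquiv.toAffineMap a b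
  simpa using this

theorem IsPolygonalArc.image {n : ℕ} {p : ℕ → ℂ} {e : Set ℂ} (h : IsPolygonalArc n p e)
    (f : ℂ ≃ᵢ ℂ) : IsPolygonalArc n (fun i => f (p i)) (f '' e) := by
  refine ⟨h.1, fun i hi => f.injective.ne (h.2.1 i hi), fun i j hij hj => ?_, ?_⟩
  · simp only
    rw [← image_segment_isometry, ← image_segment_isometry, ← image_inter f.injective,
      h.2.2.1 i j hij hj]
    split_ifs <;> simp
  · rw [h.2.2.2, image_iUnion₂]
    simp only [image_segment_isometry]

namespace PlaneMap

variable {M : PlaneMap}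

theorem mapDir_rev (f : M.symmetryGroup) (d : M.DirEdge) :
    mapDir f d.rev = (mapDir f d).rev := by
  apply IsReverse.eq_rev
  refine ⟨?_, fun h => d.rev_vertex_ne (f.1.injective h).symm⟩
  change f.1 '' d.edge = f.1 '' d.rev.edge
  rw [d.rev_edge]

theorem mapDir_inv_mapDir (f : M.symmetryGroup) (d : M.DirEdge) : mapDir f⁻¹ (mapDir f d) = d := by
  apply DirEdge.ext'
  · exact f.1.symm_apply_apply d.vertex
  · change f.1.symm '' (f.1 '' d.edge) = d.edge
    rw [image_image]
    simp

theorem mapDir_mapDir_inv (f : M.symmetryGroup) (d : M.DirEdge) : mapDir f (mapDir f⁻¹ d) = d := by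
  apply DirEdge.ext'
  · exact f.1.apply_symm_apply d.vertex
  · change f.1 '' (f.1.symm '' d.edge) = d.edge
    rw [image_image]
    simp

theorem pushforward_eq_iff (f : M.symmetryGroup) (w w' : M.DirEdge → ℝ) :
    pushforward f w = w' ↔ ∀ d, w' (mapDir f d) = w d := by
  constructor
  · rintro rfl d
    rw [pushforward, mapDir_inv_mapDir]
  · intro h
    funext d
    rw [pushforward, ← h, mapDir_mapDir_inv]

theorem mem_graph_symm (f : M.symmetryGroup) {z : ℂ} (hz : z ∈ M.graph) : f.1 z ∈ M.graph := by
  rcases hz with hz | ⟨e, he, hz⟩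
  · exact Or.inl (symm_vertex f.2 hz)
  · exact Or.inr ⟨_, symm_edge f.2 he, mem_image_of_mem _ hz⟩

theorem image_compl_graph (f : M.symmetryGroup) : f.1 '' M.graphᶜ = M.graphᶜ := by
  have h1 : ∀ g : M.symmetryGroup, ∀ z, g.1 z ∈ M.graph → z ∈ M.graph := by
    intro g z hz
    have := mem_graph_symm g⁻¹ hz
    have h2 : (g⁻¹ : M.symmetryGroup).1 (g.1 z) = z := g.1.symm_apply_apply z
    rwa [h2] at this
  ext z
  constructor
  · rintro ⟨x, hx, rfl⟩ hz
    exact hx (h1 f x hz)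
  · intro hz
    refine ⟨f.1.symm z, fun h => hz ?_, f.1.apply_symm_apply z⟩
    have := mem_graph_symm f h
    rwa [f.1.apply_symm_apply] at this

theorem image_mem_faces (f : M.symmetryGroup) {F : Set ℂ} (hF : F ∈ M.faces) :
    f.1 '' F ∈ M.faces := by
  obtain ⟨z, hz, rfl⟩ := hF
  refine ⟨f.1 z, ?_, ?_⟩
  · have := mem_image_of_mem f.1 hz
    change f.1 z ∈ f.1 '' M.graphᶜ at this
    rwa [image_compl_graph] at this
  · have := f.1.toHomeomorph.image_connectedComponentIn hz
    change f.1 '' connectedComponentIn M.graphᶜ z =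
      connectedComponentIn (f.1 '' M.graphᶜ) (f.1 z) at this
    rw [image_compl_graph] at this
    exact this

theorem right_mapDir_of_direct {f : M.symmetryGroup} (hf : IsDirect f.1) (d : M.DirEdge) :
    (mapDir f d).right = f.1 '' d.right := by
  obtain ⟨a, b, _, hab⟩ := hf
  obtain ⟨n, p, hp, h0, _⟩ := d.exists_arc
  rw [← onRight_iff]
  refine ⟨image_mem_faces f d.right_mem_faces, n, _, hp.image f.1, congrArg f.1 h0, 0, hp.1, ?_⟩
  filter_upwards [(d.rightAt hp h0 hp.1).2] with s hs
  rw [midpoint_right]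
  refine ⟨_, hs, ?_⟩
  simp only [hab]
  ring

theorem right_mapDir_of_opposite {f : M.symmetryGroup} (hf : IsOpposite f.1) (d : M.DirEdge) :
    (mapDir f d).rev.right = f.1 '' d.right := by
  obtain ⟨a, b, _, hab⟩ := hf
  obtain ⟨n, p, hp, h0, _⟩ := d.exists_arc
  have hn := hp.1
  rw [← onRight_iff]
  have harc : IsPolygonalArc n (fun i => f.1 (p (n - i))) (mapDir f d).rev.edge := by
    rw [DirEdge.rev_edge]
    exact hp.reverse.image f.1
  refine ⟨image_mem_faces f d.right_mem_faces, n, _, harc, ?_, n - 1, by omega, ?_⟩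
  · rw [← mapDir_rev, Nat.sub_zero, ← d.rev_vertex_eq hp h0]
    rfl
  filter_upwards [(d.rightAt hp h0 hp.1).2] with s hs
  rw [midpoint_right, show n - (n - 1) = 1 by omega, show n - (n - 1 + 1) = 0 by omega]
  refine ⟨_, hs, ?_⟩
  simp only [hab, map_add, map_mul, map_sub, Complex.conj_ofReal, Complex.conj_I]
  push_cast
  ring

theorem right_rev_mapDir_of_opposite {f : M.symmetryGroup} (hf : IsOpposite f.1) (d : M.DirEdge) :
    (mapDir f d).right = f.1 '' d.rev.right := by
  rw [← right_mapDir_of_opposite hf, mapDir_rev, DirEdge.rev_rev]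

/-! ### Heights and abscissas under a symmetry of the map -/

namespace SquareTiling

variable {w w' : M.DirEdge → ℝ}

theorem height_sub_rev (T : M.SquareTiling w) (d : M.DirEdge) :
    T.height d.vertex - T.height d.rev.vertex = w d := T.height_sub d _ d.isReverse_rev

theorem abscissa_sub_rev (T : M.SquareTiling w) (d : M.DirEdge) :
    T.abscissa d.rev.right - T.abscissa d.right = w d :=
  T.abscissa_sub d _ _ _ d.isReverse_rev d.onRight_right d.rev.onRight_right

theorem weight_rev (T : M.SquareTiling w) (d : M.DirEdge) : w d.rev = -w d := by
  rw [← T.height_sub_rev, ← T.height_sub_rev, d.rev_rev]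
  ring

/-- Both sides have the same differences along edges, and the map is connected. Two tilings are
allowed so that `f = 1` compares two positions of the same tiling. -/
theorem exists_height_shift (T : M.SquareTiling w) (T' : M.SquareTiling w') (f : M.symmetryGroup)
    (ε : ℝ) (h : ∀ d, w' (mapDir f d) = ε * w d) :
    ∃ c, ∀ d : M.DirEdge, T'.height (f.1 d.vertex) = ε * T.height d.vertex + c := by
  by_cases hne : Nonempty M.DirEdge
  · obtain ⟨d₀⟩ := hne
    refine ⟨T'.height (f.1 d₀.vertex) - ε * T.height d₀.vertex, fun d => ?_⟩
    refine dirEdge_induction (P := fun d : M.DirEdge => T'.height (f.1 d.vertex) =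
      ε * T.height d.vertex + (T'.height (f.1 d₀.vertex) - ε * T.height d₀.vertex))
      (fun d hd => ?_) (fun d hd => ?_) (d₀ := d₀) (by ring) d
    · simp only [d.rot_vertex]
      exact hd
    · have h1 := T.height_sub_rev d
      have h2 : T'.height (f.1 d.vertex) - T'.height (f.1 d.rev.vertex) = w' (mapDir f d) := by
        have := T'.height_sub_rev (mapDir f d)
        rwa [← mapDir_rev] at this
      rw [h, ← h1] at h2
      linarith
  · exact ⟨0, fun d => absurd ⟨d⟩ hne⟩

theorem exists_abscissa_shift_of (T : M.SquareTiling w) (T' : M.SquareTiling w')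
    (f : M.symmetryGroup) (ε : ℝ)
    (h : ∀ d : M.DirEdge, T'.abscissa (f.1 '' d.rev.right) - T'.abscissa (f.1 '' d.right) =
      ε * w d) :
    ∃ c, ∀ d : M.DirEdge, T'.abscissa (f.1 '' d.right) = ε * T.abscissa d.right + c := by
  by_cases hne : Nonempty M.DirEdge
  · obtain ⟨d₀⟩ := hne
    refine ⟨T'.abscissa (f.1 '' d₀.right) - ε * T.abscissa d₀.right, fun d => ?_⟩
    have key : ∀ d : M.DirEdge, T'.abscissa (f.1 '' d.right) = ε * T.abscissa d.right +
        (T'.abscissa (f.1 '' d₀.right) - ε * T.abscissa d₀.right) →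
        T'.abscissa (f.1 '' d.rev.right) = ε * T.abscissa d.rev.right +
        (T'.abscissa (f.1 '' d₀.right) - ε * T.abscissa d₀.right) := by
      intro d hd
      have h1 := T.abscissa_sub_rev d
      have h2 := h d
      rw [← h1] at h2
      linarith
    refine dirEdge_induction (P := fun d : M.DirEdge => T'.abscissa (f.1 '' d.right) =
      ε * T.abscissa d.right + (T'.abscissa (f.1 '' d₀.right) - ε * T.abscissa d₀.right))
      (fun d hd => ?_) key (d₀ := d₀) (by ring) d
    simp only [d.right_rot]
    exact key d hd
  · exact ⟨0, fun d => absurd ⟨d⟩ hne⟩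

theorem exists_abscissa_shift_direct (T : M.SquareTiling w) (T' : M.SquareTiling w')
    {f : M.symmetryGroup} (hf : IsDirect f.1) (ε : ℝ) (h : ∀ d, w' (mapDir f d) = ε * w d) :
    ∃ c, ∀ d : M.DirEdge, T'.abscissa (f.1 '' d.right) = ε * T.abscissa d.right + c := by
  refine T.exists_abscissa_shift_of T' f ε fun d => ?_
  rw [← right_mapDir_of_direct hf, ← right_mapDir_of_direct hf, ← h, mapDir_rev]
  exact T'.abscissa_sub_rev _

/-- An orientation-reversing symmetry exchanges the two sides of an edge, which costs a sign
compared with the heights. -/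
theorem exists_abscissa_shift_opposite (T : M.SquareTiling w) (T' : M.SquareTiling w')
    {f : M.symmetryGroup} (hf : IsOpposite f.1) (ε : ℝ) (h : ∀ d, w' (mapDir f d) = ε * w d) :
    ∃ c, ∀ d : M.DirEdge, T'.abscissa (f.1 '' d.right) = -ε * T.abscissa d.right + c := by
  refine T.exists_abscissa_shift_of T' f (-ε) fun d => ?_
  rw [← right_mapDir_of_opposite hf d, ← right_rev_mapDir_of_opposite hf, neg_mul, ← h,
    ← T'.abscissa_sub_rev]
  ring

/-- Unordered intervals are insensitive to reversal, so the square can be described from either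
direction of the edge, without asking that the weight be positive. -/
theorem mem_square_iff (T : M.SquareTiling w) (d : M.DirEdge) (z : ℂ) :
    z ∈ T.square d.edge ↔ w d ≠ 0 ∧ z.re ∈ uIcc (T.abscissa d.right) (T.abscissa d.rev.right) ∧
      z.im ∈ uIcc (T.height d.vertex) (T.height d.rev.vertex) := by
  have key : ∀ c : M.DirEdge, 0 < w c → ((z.re ∈ Icc (T.abscissa c.right) (T.abscissa c.right + w c) ∧
      z.im ∈ Icc (T.height c.vertex - w c) (T.height c.vertex)) ↔
      (z.re ∈ uIcc (T.abscissa c.right) (T.abscissa c.rev.right) ∧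
      z.im ∈ uIcc (T.height c.vertex) (T.height c.rev.vertex))) := by
    intro c hc
    have h1 := T.abscissa_sub_rev c
    have h2 := T.height_sub_rev c
    rw [uIcc_of_le (by linarith), uIcc_of_ge (by linarith),
      show T.abscissa c.right + w c = T.abscissa c.rev.right by linarith,
      show T.height c.vertex - w c = T.height c.rev.vertex by linarith]
  constructor
  · rintro ⟨c, F, hc, hw, hF, hz⟩
    rw [onRight_iff] at hF
    subst hF
    rw [key c hw] at hz
    rcases DirEdge.eq_or_eq_rev hc with rfl | rfl
    · exact ⟨hw.ne', hz⟩
    · rw [T.weight_rev] at hw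
      rw [DirEdge.rev_rev, uIcc_comm, uIcc_comm (T.height _)] at hz
      exact ⟨(neg_pos.1 hw).ne, hz⟩
  · rintro ⟨hw, hz⟩
    rcases lt_or_gt_of_ne hw with h | h
    · have h' : 0 < w d.rev := by rw [T.weight_rev]; linarith
      refine ⟨d.rev, _, d.rev_edge, h', d.rev.onRight_right, (key _ h').2 ?_⟩
      rw [DirEdge.rev_rev, uIcc_comm, uIcc_comm (T.height _)]
      exact hz
    · exact ⟨d, _, rfl, h, d.onRight_right, (key d h).2 hz⟩

theorem square_nonempty_iff (T : M.SquareTiling w) (d : M.DirEdge) :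
    (T.square d.edge).Nonempty ↔ w d ≠ 0 := by
  constructor
  · rintro ⟨z, hz⟩
    exact ((T.mem_square_iff d z).1 hz).1
  · intro h
    exact ⟨⟨T.abscissa d.right, T.height d.vertex⟩,
      (T.mem_square_iff d _).2 ⟨h, left_mem_uIcc, left_mem_uIcc⟩⟩

end SquareTiling

end PlaneMap

theorem image_eq_of_mem_iff {g : ℂ ≃ᵢ ℂ} {A B : Set ℂ} (h : ∀ z, g z ∈ B ↔ z ∈ A) : g '' A = B := by
  ext z
  constructor
  · rintro ⟨x, hx, rfl⟩
    exact (h x).2 hx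
  · intro hz
    refine ⟨g.symm z, (h _).1 ?_, g.apply_symm_apply z⟩
    rwa [g.apply_symm_apply]

theorem exists_axis_isometry {s t : ℝ} (hs : s = 1 ∨ s = -1) (ht : t = 1 ∨ t = -1) (c d : ℝ) :
    ∃ g : ℂ ≃ᵢ ℂ, ∀ z, (g z).re = s * z.re + c ∧ (g z).im = t * z.im + d := by
  have hs2 : s * s = 1 := by rcases hs with rfl | rfl <;> norm_num
  have ht2 : t * t = 1 := by rcases ht with rfl | rfl <;> norm_num
  refine ⟨IsometryEquiv.mk' (fun z => ⟨s * z.re + c, t * z.im + d⟩)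
    (fun z => ⟨s * (z.re - c), t * (z.im - d)⟩) ?_ ?_, fun z => ⟨rfl, rfl⟩⟩
  · intro z
    apply Complex.ext
    · simp only
      linear_combination (z.re - c) * hs2
    · simp only
      linear_combination (z.im - d) * ht2
  · apply Isometry.of_dist_eq
    intro x y
    rw [Complex.dist_eq_re_im, Complex.dist_eq_re_im]
    congr 1
    simp only
    linear_combination (x.re - y.re) ^ 2 * hs2 + (x.im - y.im) ^ 2 * ht2

theorem mem_uIcc_affine_iff {s : ℝ} (hs : s = 1 ∨ s = -1) (c a b u : ℝ) :
    s * u + c ∈ uIcc (s * a + c) (s * b + c) ↔ u ∈ uIcc a b := by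
  simp only [mem_uIcc]
  rcases hs with rfl | rfl <;> constructor <;> rintro (⟨h1, h2⟩ | ⟨h1, h2⟩) <;>
    first
    | (left; constructor <;> linarith)
    | (right; constructor <;> linarith)

/-! ### Symmetries of the tiling induced by symmetries of the map -/

namespace PlaneMap

variable {M : PlaneMap}

/-- If `f` reverses orientation, the image edge has to be run through backwards for right sides to
go to right sides. -/
theorem exists_sides_mapDir (f : M.symmetryGroup) (d : M.DirEdge) :
    ∃ c : M.DirEdge, c.edge = f.1 '' d.edge ∧ c.right = f.1 '' d.right ∧
      c.rev.right = f.1 '' d.rev.right := by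
  rcases isDirect_or_isOpposite f.1 with hf | hf
  · exact ⟨mapDir f d, rfl, right_mapDir_of_direct hf d,
      by rw [← right_mapDir_of_direct hf, mapDir_rev]⟩
  · refine ⟨(mapDir f d).rev, (mapDir f d).rev_edge, right_mapDir_of_opposite hf d, ?_⟩
    rw [DirEdge.rev_rev]
    exact right_rev_mapDir_of_opposite hf d

namespace SquareTiling

variable {w : M.DirEdge → ℝ} (T : M.SquareTiling w)

/-- An isometry that moves heights and abscissas as `f` does is the symmetry induced by `f`. -/
theorem induced_of_shift (f : M.symmetryGroup) {s t c k : ℝ} (hs : s = 1 ∨ s = -1)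
    (ht : t = 1 ∨ t = -1) (hw : ∀ d, w (mapDir f d) = 0 ↔ w d = 0)
    (hx : ∀ d : M.DirEdge, T.abscissa (f.1 '' d.right) = s * T.abscissa d.right + c)
    (hy : ∀ d : M.DirEdge, T.height (f.1 d.vertex) = t * T.height d.vertex + k)
    {g : ℂ ≃ᵢ ℂ} (hg : ∀ z, (g z).re = s * z.re + c ∧ (g z).im = t * z.im + k) :
    g ∈ T.symmetryGroup ∧ (∀ e ∈ M.E, g '' T.square e = T.square (f.1 '' e)) ∧
    (∀ v ∈ M.V, g '' T.horizontalFace v = T.horizontalFace (f.1 v)) ∧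
    (∀ F ∈ M.faces, g '' T.verticalFace F = T.verticalFace (f.1 '' F)) := by
  have hs0 : s ≠ 0 := by rcases hs with rfl | rfl <;> norm_num
  have ht0 : t ≠ 0 := by rcases ht with rfl | rfl <;> norm_num
  have sq : ∀ (d : M.DirEdge) (z : ℂ), g z ∈ T.square (f.1 '' d.edge) ↔ z ∈ T.square d.edge := by
    intro d z
    have h1 : f.1 '' d.edge = (mapDir f d).edge := rfl
    rw [h1, T.mem_square_iff, T.mem_square_iff, ← mapDir_rev]
    have h2 : uIcc (T.abscissa (mapDir f d).right) (T.abscissa (mapDir f d.rev).right) =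
        uIcc (s * T.abscissa d.right + c) (s * T.abscissa d.rev.right + c) := by
      -- In the opposite case the two side faces are swapped, which the unordered interval absorbs.
      rcases isDirect_or_isOpposite f.1 with hf | hf
      · rw [right_mapDir_of_direct hf, right_mapDir_of_direct hf, hx, hx]
      · rw [mapDir_rev, right_mapDir_of_opposite hf, right_rev_mapDir_of_opposite hf, hx, hx,
          uIcc_comm]
    have h3 : uIcc (T.height (mapDir f d).vertex) (T.height (mapDir f d.rev).vertex) =
        uIcc (t * T.height d.vertex + k) (t * T.height d.rev.vertex + k) := by
      rw [← hy, ← hy]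
      rfl
    rw [h2, h3, (hg z).1, (hg z).2, mem_uIcc_affine_iff hs, mem_uIcc_affine_iff ht, Ne, Ne, hw]
  have sqE : ∀ e ∈ M.E, g '' T.square e = T.square (f.1 '' e) := by
    intro e he
    have h1 := orient_edge ⟨e, he⟩
    simp only at h1
    rw [← h1]
    exact image_eq_of_mem_iff (sq _)
  refine ⟨?_, sqE, ?_, ?_⟩
  · change (fun S : Set ℂ => g '' S) '' T.tiles = T.tiles
    apply Subset.antisymm
    · rintro _ ⟨_, ⟨e, he, rfl, hn⟩, rfl⟩
      exact ⟨f.1 '' e, symm_edge f.2 he, sqE e he, hn.image _⟩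
    · rintro _ ⟨e, he, rfl, hn⟩
      have he' : f.1.symm '' e ∈ M.E := symm_edge (f⁻¹).2 he
      have h1 : f.1 '' (f.1.symm '' e) = e := by
        rw [image_image]
        simp
      have h2 := sqE _ he'
      rw [h1] at h2
      refine ⟨_, ⟨_, he', rfl, ?_⟩, h2⟩
      rw [← h2] at hn
      exact hn.of_image
  · intro v _
    refine image_eq_of_mem_iff fun z => ?_
    constructor
    · rintro ⟨h1, c', hc', hz⟩
      obtain ⟨d, rfl⟩ : ∃ d, c' = mapDir f d := ⟨_, (mapDir_mapDir_inv f c').symm⟩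
      have hv : d.vertex = v := f.1.injective hc'
      subst hv
      refine ⟨?_, d, rfl, (sq d z).1 hz⟩
      rw [hy, (hg z).2] at h1
      exact mul_left_cancel₀ ht0 (add_right_cancel h1)
    · rintro ⟨h1, d, rfl, hz⟩
      refine ⟨?_, mapDir f d, rfl, (sq d z).2 hz⟩
      rw [hy, (hg z).2, h1]
  · intro F _
    refine image_eq_of_mem_iff fun z => ?_
    constructor
    · rintro ⟨h1, c', hc', hz⟩
      rw [onRight_iff] at hc'
      obtain ⟨d, hd1, hd2⟩ : ∃ d : M.DirEdge, f.1 '' d.edge = c'.edge ∧ f.1 '' d.right = c'.right := by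
        obtain ⟨d, hd1, hd2, _⟩ := exists_sides_mapDir f⁻¹ c'
        refine ⟨d, ?_, ?_⟩
        · rw [hd1]
          change f.1 '' (f.1.symm '' _) = _
          rw [image_image]
          simp
        · rw [hd2]
          change f.1 '' (f.1.symm '' _) = _
          rw [image_image]
          simp
      have hF : d.right = F := f.1.injective.image_injective (hd2.trans hc')
      subst hF
      refine ⟨?_, d, d.onRight_right, (sq d z).1 (hd1 ▸ hz)⟩
      rw [hx, (hg z).1] at h1
      exact mul_left_cancel₀ hs0 (add_right_cancel h1)
    · rintro ⟨h1, d, hd, hz⟩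
      rw [onRight_iff] at hd
      subst hd
      obtain ⟨c', h2, h3, _⟩ := exists_sides_mapDir f d
      refine ⟨?_, c', onRight_iff.2 h3, ?_⟩
      · rw [hx, (hg z).1, h1]
      · rw [h2]
        exact (sq d z).2 hz

theorem exists_abscissa_shift (f : M.symmetryGroup) {ε : ℝ} (hε : ε = 1 ∨ ε = -1)
    (h : ∀ d, w (mapDir f d) = ε * w d) : ∃ s, (s = 1 ∨ s = -1) ∧
    ∃ c, ∀ d : M.DirEdge, T.abscissa (f.1 '' d.right) = s * T.abscissa d.right + c := by
  rcases isDirect_or_isOpposite f.1 with hf | hf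
  · exact ⟨ε, hε, T.exists_abscissa_shift_direct T hf ε h⟩
  · refine ⟨-ε, ?_, T.exists_abscissa_shift_opposite T hf ε h⟩
    rcases hε with rfl | rfl <;> norm_num

theorem induces_of_pushforward (f : M.symmetryGroup) {ε : ℝ} (hε : ε = 1 ∨ ε = -1)
    (h : ∀ d, w (mapDir f d) = ε * w d) : T.Induces f := by
  obtain ⟨s, hs, c, hx⟩ := T.exists_abscissa_shift f hε h
  obtain ⟨k, hy⟩ := T.exists_height_shift T f ε h
  obtain ⟨g, hg⟩ := exists_axis_isometry hs hε c k
  have hε0 : ε ≠ 0 := by rcases hε with rfl | rfl <;> norm_num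
  exact ⟨g, T.induced_of_shift f hs hε (fun d => by rw [h]; simp [hε0]) hx hy hg⟩

/-- One horizontal direction kept horizontal forces the unit coefficient of `g` to be real, hence
`±1`. -/
theorem exists_im_eq {g : ℂ ≃ᵢ ℂ} {z₁ z₂ : ℂ} (hre : z₁.re ≠ z₂.re) (him : z₁.im = z₂.im)
    (hg : (g z₁).im = (g z₂).im) : ∃ ε k : ℝ, (ε = 1 ∨ ε = -1) ∧ ∀ z, (g z).im = ε * z.im + k := by
  have aux : ∀ a : ℂ, ‖a‖ = 1 → a.im = 0 → a.re = 1 ∨ a.re = -1 := by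
    intro a h1 h2
    have h3 := Complex.sq_norm a
    rw [h1, Complex.normSq_apply, h2] at h3
    exact mul_self_eq_one_iff.1 (by linarith)
  rcases isDirect_or_isOpposite g with ⟨a, b, ha, hab⟩ | ⟨a, b, ha, hab⟩
  · simp only [hab, Complex.add_im, Complex.mul_im] at hg ⊢
    have h1 : a.im = 0 := by
      have : a.im * (z₁.re - z₂.re) = 0 := by
        rw [him] at hg
        linarith
      exact (mul_eq_zero.1 this).resolve_right (sub_ne_zero.2 hre)
    exact ⟨a.re, b.im, aux a ha h1, fun z => by rw [h1]; ring⟩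
  · simp only [hab, Complex.add_im, Complex.mul_im, Complex.conj_re, Complex.conj_im] at hg ⊢
    have h1 : a.im = 0 := by
      have : a.im * (z₁.re - z₂.re) = 0 := by
        rw [him] at hg
        linarith
      exact (mul_eq_zero.1 this).resolve_right (sub_ne_zero.2 hre)
    refine ⟨-a.re, b.im, ?_, fun z => by rw [h1]; ring⟩
    rcases aux a ha h1 with h | h
    · exact Or.inr (by rw [h])
    · exact Or.inl (by rw [h, neg_neg])

theorem exists_weight_ne_zero (hw : w ≠ 0) : ∃ d, w d ≠ 0 := Function.ne_iff.1 hw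

/-- Both ends of a horizontal edge of one square go to the height of one vertex, so `g` acts on all
heights with a slope `±1`; weights are differences of heights. -/
theorem pushforward_of_induces (hw : w ≠ 0) {f : M.symmetryGroup} (h : T.Induces f) :
    ∃ ε : ℝ, (ε = 1 ∨ ε = -1) ∧ ∀ d, w (mapDir f d) = ε * w d := by
  obtain ⟨g, _, hsq, hh, _⟩ := h
  have top : ∀ d : M.DirEdge, w d ≠ 0 → ∀ x, x = T.abscissa d.right ∨ x = T.abscissa d.rev.right →
      (g ⟨x, T.height d.vertex⟩).im = T.height (f.1 d.vertex) := by
    intro d hd x hx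
    have h1 : (⟨x, T.height d.vertex⟩ : ℂ) ∈ T.horizontalFace d.vertex := by
      refine ⟨rfl, d, rfl, (T.mem_square_iff d _).2 ⟨hd, ?_, left_mem_uIcc⟩⟩
      rcases hx with rfl | rfl
      · exact left_mem_uIcc
      · exact right_mem_uIcc
    have h2 := mem_image_of_mem g h1
    rw [hh _ d.vertex_mem] at h2
    exact h2.1
  obtain ⟨d₀, hd₀⟩ := exists_weight_ne_zero hw
  obtain ⟨ε, k, hε, him⟩ := exists_im_eq (g := g)
    (z₁ := ⟨T.abscissa d₀.right, T.height d₀.vertex⟩)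
    (z₂ := ⟨T.abscissa d₀.rev.right, T.height d₀.vertex⟩)
    (fun h => hd₀ (by rw [← T.abscissa_sub_rev]; simp only at h; linarith)) rfl
    ((top d₀ hd₀ _ (Or.inl rfl)).trans (top d₀ hd₀ _ (Or.inr rfl)).symm)
  refine ⟨ε, hε, fun d => ?_⟩
  -- Edges of zero weight have no square whose position could be followed; here it is the emptiness
  -- of the square that `g` carries over.
  by_cases hd : w d = 0
  · rw [hd, mul_zero]
    by_contra hne
    have h1 := (T.square_nonempty_iff (mapDir f d)).2 hne
    have h2 := hsq d.edge d.edge_mem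
    have h3 : (mapDir f d).edge = f.1 '' d.edge := rfl
    rw [h3, ← h2] at h1
    exact (T.square_nonempty_iff d).1 h1.of_image hd
  · have hd' : w d.rev ≠ 0 := by
      rw [T.weight_rev]
      exact neg_ne_zero.2 hd
    have h1 := top d hd _ (Or.inl rfl)
    have h2 := top d.rev hd' _ (Or.inl rfl)
    rw [him] at h1 h2
    simp only at h1 h2
    have h3 := T.height_sub_rev (mapDir f d)
    rw [← mapDir_rev] at h3
    change T.height (f.1 d.vertex) - T.height (f.1 d.rev.vertex) = _ at h3
    rw [← h3, ← h1, ← h2, ← T.height_sub_rev]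
    ring

theorem induces_iff (hw : w ≠ 0) (f : M.symmetryGroup) :
    T.Induces f ↔ (pushforward f w = w ∨ pushforward f w = -w) := by
  rw [pushforward_eq_iff, pushforward_eq_iff]
  constructor
  · intro h
    obtain ⟨ε, rfl | rfl, h1⟩ := T.pushforward_of_induces hw h
    · exact Or.inl fun d => by rw [h1, one_mul]
    · exact Or.inr fun d => by rw [Pi.neg_apply, h1]; ring
  · rintro (h | h)
    · exact T.induces_of_pushforward f (Or.inl rfl) fun d => by rw [h, one_mul]
    · refine T.induces_of_pushforward f (Or.inr rfl) fun d => ?_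
      have := h d
      rw [Pi.neg_apply] at this
      linarith

end SquareTiling

end PlaneMap

/-! ### Lattices -/

@[simp] theorem planeTranslation_apply (t z : ℂ) : planeTranslation t z = z + t := rfl

theorem exists_real_coords {t₁ t₂ : ℂ} (h : LinearIndependent ℝ ![t₁, t₂]) (z : ℂ) :
    ∃ a b : ℝ, z = a * t₁ + b * t₂ := by
  have h1 := h.span_eq_top_of_card_eq_finrank (by simp [Complex.finrank_real_complex])
  have h2 : z ∈ Submodule.span ℝ (Set.range ![t₁, t₂]) := h1 ▸ Submodule.mem_top
  rw [Matrix.range_cons, Matrix.range_cons, Matrix.range_empty, union_empty, singleton_union,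
    Submodule.mem_span_pair] at h2
  obtain ⟨a, b, hab⟩ := h2
  exact ⟨a, b, by rw [← hab]; simp⟩

theorem exists_fundamental_domain {t₁ t₂ : ℂ} (h : LinearIndependent ℝ ![t₁, t₂]) :
    ∃ K : Set ℂ, IsCompact K ∧ ∀ z, ∃ m n : ℤ, z + (m * t₁ + n * t₂) ∈ K := by
  let f : ℝ × ℝ → ℂ := fun x => x.1 * t₁ + x.2 * t₂
  have hf : Continuous f := by fun_prop
  refine ⟨f '' (Icc 0 1 ×ˢ Icc 0 1), (isCompact_Icc.prod isCompact_Icc).image hf, fun z => ?_⟩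
  obtain ⟨a, b, rfl⟩ := exists_real_coords h z
  refine ⟨-⌊a⌋, -⌊b⌋, (Int.fract a, Int.fract b),
    ⟨⟨Int.fract_nonneg a, (Int.fract_lt_one a).le⟩, Int.fract_nonneg b, (Int.fract_lt_one b).le⟩, ?_⟩
  simp only [f, Int.fract]
  push_cast
  ring

theorem linearIndependent_pair_of_det {p q : ℂ} (h : p.re * q.im - p.im * q.re ≠ 0) :
    LinearIndependent ℝ ![p, q] := by
  rw [LinearIndependent.pair_iff]
  intro a b hab
  have h1 := congrArg Complex.re hab
  have h2 := congrArg Complex.im hab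
  simp at h1 h2
  constructor
  · have : a * (p.re * q.im - p.im * q.re) = 0 := by linear_combination q.im * h1 - q.re * h2
    exact (mul_eq_zero.1 this).resolve_right h
  · have : b * (p.re * q.im - p.im * q.re) = 0 := by linear_combination p.re * h2 - p.im * h1
    exact (mul_eq_zero.1 this).resolve_right h

/-- Dependent vectors lie on a line, the kernel of a nonzero linear form. The form will be applied
to height and abscissa. -/
theorem exists_annihilator {p q : ℂ} (h : ¬ LinearIndependent ℝ ![p, q]) :
    ∃ α β : ℝ, (α ≠ 0 ∨ β ≠ 0) ∧ α * p.im + β * p.re = 0 ∧ α * q.im + β * q.re = 0 := by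
  have hdet : p.re * q.im - p.im * q.re = 0 := by
    by_contra hd
    exact h (linearIndependent_pair_of_det hd)
  have key : ∀ z : ℂ, z ≠ 0 → z.re ≠ 0 ∨ -z.im ≠ 0 := by
    intro z hz
    by_contra hc
    push Not at hc
    exact hz (Complex.ext hc.1 (neg_eq_zero.1 hc.2))
  by_cases hp : p = 0
  · by_cases hq : q = 0
    · exact ⟨1, 0, Or.inl one_ne_zero, by simp [hp], by simp [hq]⟩
    · exact ⟨q.re, -q.im, key q hq, by simp [hp], by ring⟩
  · exact ⟨p.re, -p.im, key p hp, by ring, by linarith⟩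

namespace PlaneMap

variable {M : PlaneMap}

/-! ### Periodic functions on directed edges -/

theorem mapDir_mul (f g : M.symmetryGroup) (d : M.DirEdge) :
    mapDir (f * g) d = mapDir f (mapDir g d) := by
  apply DirEdge.ext'
  · rfl
  · change (f.1 ∘ g.1) '' d.edge = f.1 '' (g.1 '' d.edge)
    rw [image_comp]

theorem mapDir_one (d : M.DirEdge) : mapDir 1 d = d := by
  apply DirEdge.ext'
  · rfl
  · change id '' d.edge = d.edge
    rw [image_id]

/-- The symmetries of `M` that leave invariant a function of directed edges. -/
def invarianceGroup (u : M.DirEdge → ℝ) : Subgroup M.symmetryGroup where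
  carrier := {f | ∀ d, u (mapDir f d) = u d}
  one_mem' d := by rw [mapDir_one]
  mul_mem' {f g} hf hg d := by
    rw [mapDir_mul, hf, hg]
  inv_mem' {f} hf d := by
    rw [← hf, mapDir_mapDir_inv]

theorem zpow_mul_zpow_apply {f₁ f₂ : M.symmetryGroup} {t₁ t₂ : ℂ} (h₁ : f₁.1 = planeTranslation t₁)
    (h₂ : f₂.1 = planeTranslation t₂) (m n : ℤ) (z : ℂ) :
    (f₁ ^ m * f₂ ^ n).1 z = z + (m * t₁ + n * t₂) := by
  have key : ∀ (f : M.symmetryGroup) (t : ℂ), f.1 = planeTranslation t → ∀ (m : ℤ) (z : ℂ),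
      (f ^ m).1 z = z + m * t := by
    intro f t h m
    have hone : ∀ z, f.1 z = z + t := fun z => by rw [h]; rfl
    have hinv : ∀ z, (f⁻¹).1 z = z - t := fun z => by
      apply f.1.injective
      have : f.1 ((f⁻¹).1 z) = z := f.1.apply_symm_apply z
      rw [this, hone]
      ring
    induction m with
    | zero => intro z; simp
    | succ k ih =>
      intro z
      rw [zpow_add_one]
      change (f ^ (k : ℤ)).1 (f.1 z) = _
      rw [ih, hone]
      push_cast
      ring
    | pred k ih =>
      intro z
      rw [zpow_sub_one]
      change (f ^ (-(k : ℤ))).1 ((f⁻¹).1 z) = _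
      rw [ih, hinv]
      push_cast
      ring
  change (f₁ ^ m).1 ((f₂ ^ n).1 z) = _
  rw [key f₁ t₁ h₁, key f₂ t₂ h₂]
  ring

theorem finite_dirEdge_vertex_mem {K : Set ℂ} (hK : IsCompact K) :
    {d : M.DirEdge | d.vertex ∈ K}.Finite := by
  refine ((finite_vertices_inter (M := M) hK).biUnion
    (t := fun v => {d : M.DirEdge | d.vertex = v}) fun v _ => finite_dirEdge_at v).subset ?_
  intro d hd
  exact mem_biUnion ⟨d.vertex_mem, hd⟩ rfl

/-- Up to translations there are finitely many directed edges. -/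
theorem exists_finite_transversal {f₁ f₂ : M.symmetryGroup} {t₁ t₂ : ℂ}
    (h₁ : f₁.1 = planeTranslation t₁) (h₂ : f₂.1 = planeTranslation t₂)
    (hli : LinearIndependent ℝ ![t₁, t₂]) :
    ∃ D : Set M.DirEdge, D.Finite ∧ ∀ d, ∃ m n : ℤ, mapDir (f₁ ^ m * f₂ ^ n) d ∈ D := by
  obtain ⟨K, hK, hKz⟩ := exists_fundamental_domain hli
  refine ⟨_, finite_dirEdge_vertex_mem hK, fun d => ?_⟩
  obtain ⟨m, n, hmn⟩ := hKz d.vertex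
  refine ⟨m, n, ?_⟩
  change (f₁ ^ m * f₂ ^ n).1 d.vertex ∈ K
  rwa [zpow_mul_zpow_apply h₁ h₂]

theorem exists_dirEdge_max {f₁ f₂ : M.symmetryGroup} {t₁ t₂ : ℂ} (h₁ : f₁.1 = planeTranslation t₁)
    (h₂ : f₂.1 = planeTranslation t₂) (hli : LinearIndependent ℝ ![t₁, t₂]) {u : M.DirEdge → ℝ}
    (hu₁ : ∀ d, u (mapDir f₁ d) = u d) (hu₂ : ∀ d, u (mapDir f₂ d) = u d) (d₁ : M.DirEdge) :
    ∃ d₀, ∀ d, u d ≤ u d₀ := by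
  obtain ⟨D, hD, hmem⟩ := exists_finite_transversal h₁ h₂ hli
  have hinv : ∀ (m n : ℤ) d, u (mapDir (f₁ ^ m * f₂ ^ n) d) = u d := fun m n =>
    (invarianceGroup u).mul_mem ((invarianceGroup u).zpow_mem (x := f₁) hu₁ m)
      ((invarianceGroup u).zpow_mem (x := f₂) hu₂ n)
  obtain ⟨m₁, n₁, hd₁⟩ := hmem d₁
  obtain ⟨d₀, _, hmax⟩ := Set.exists_max_image D u hD ⟨_, hd₁⟩
  refine ⟨d₀, fun d => ?_⟩
  obtain ⟨m, n, hd⟩ := hmem d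
  rw [← hinv m n d]
  exact hmax _ hd

theorem eq_zero_of_finsum_eq_zero {s : Set M.DirEdge} (hs : s.Finite) {w : M.DirEdge → ℝ} {γ : ℝ}
    (hγ : γ ≠ 0) (hsum : ∑ᶠ d ∈ s, w d = 0) (hnn : ∀ d ∈ s, 0 ≤ γ * w d) : ∀ d ∈ s, w d = 0 := by
  rw [finsum_mem_eq_finite_toFinset_sum _ hs] at hsum
  have h1 : ∑ d ∈ hs.toFinset, γ * w d = 0 := by rw [← Finset.mul_sum, hsum, mul_zero]
  rw [Finset.sum_eq_zero_iff_of_nonneg fun d hd => hnn d (hs.mem_toFinset.1 hd)] at h1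
  intro d hd
  exact (mul_eq_zero.1 (h1 d (hs.mem_toFinset.2 hd))).resolve_left hγ

/-- The maximum principle: a periodic harmonic function of the vertices is constant. -/
theorem maximum_principle {f₁ f₂ : M.symmetryGroup} {t₁ t₂ : ℂ} (h₁ : f₁.1 = planeTranslation t₁)
    (h₂ : f₂.1 = planeTranslation t₂) (hli : LinearIndependent ℝ ![t₁, t₂]) {y : ℂ → ℝ}
    (hy₁ : ∀ d : M.DirEdge, y (f₁.1 d.vertex) = y d.vertex)
    (hy₂ : ∀ d : M.DirEdge, y (f₂.1 d.vertex) = y d.vertex)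
    (hsum : ∀ v ∈ M.V, ∑ᶠ d ∈ {d : M.DirEdge | d.vertex = v}, (y d.vertex - y d.rev.vertex) = 0)
    (d : M.DirEdge) : y d.vertex = y d.rev.vertex := by
  obtain ⟨d₀, hmax⟩ := exists_dirEdge_max h₁ h₂ hli (u := fun d => y d.vertex) hy₁ hy₂ d
  have hrev : ∀ d : M.DirEdge, y d.vertex = y d₀.vertex → y d.rev.vertex = y d₀.vertex := by
    intro d hd
    -- At a vertex of maximal value all differences are nonnegative with sum zero, so the maximum
    -- spreads to all neighbours.
    have h3 := eq_zero_of_finsum_eq_zero (finite_dirEdge_at d.vertex) one_ne_zero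
      (hsum _ d.vertex_mem) (by
        intro c hc
        have hc : c.vertex = d.vertex := hc
        rw [one_mul, hc, hd]
        exact sub_nonneg.2 (hmax c.rev)) d rfl
    linarith
  have key : ∀ d : M.DirEdge, y d.vertex = y d₀.vertex :=
    dirEdge_induction (P := fun d => y d.vertex = y d₀.vertex)
      (fun d hd => by rw [d.rot_vertex, hd]) hrev rfl
  exact (key d).trans (key d.rev).symm

theorem sum_mapDir_eq_zero {w : M.DirEdge → ℝ} (hw : IsHarmonic w) (f : M.symmetryGroup) {v : ℂ}
    (hv : v ∈ M.V) : ∑ᶠ d ∈ {d : M.DirEdge | d.vertex = v}, w (mapDir f d) = 0 := by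
  rw [← hw.1 (f.1 v) (symm_vertex f.2 hv)]
  refine finsum_mem_eq_of_bijOn (mapDir f) ⟨?_, ?_, ?_⟩ fun d _ => rfl
  · rintro d rfl
    rfl
  · intro d _ d' _ h
    rw [← mapDir_inv_mapDir f d, h, mapDir_inv_mapDir]
  · intro d hd
    refine ⟨mapDir f⁻¹ d, ?_, mapDir_mapDir_inv f d⟩
    have hd : d.vertex = f.1 v := hd
    change f.1.symm d.vertex = v
    rw [hd, f.1.symm_apply_apply]

/-- If `y ∘ f - ε y` is periodic for the height `y`, then `f` multiplies the vector by `ε`. -/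
theorem SquareTiling.weight_mapDir {w : M.DirEdge → ℝ} (T : M.SquareTiling w) (hw : IsHarmonic w)
    {f₁ f₂ : M.symmetryGroup} {t₁ t₂ : ℂ} (h₁ : f₁.1 = planeTranslation t₁)
    (h₂ : f₂.1 = planeTranslation t₂) (hli : LinearIndependent ℝ ![t₁, t₂]) (f : M.symmetryGroup)
    (ε : ℝ)
    (hy₁ : ∀ d : M.DirEdge, T.height (f.1 (f₁.1 d.vertex)) - ε * T.height (f₁.1 d.vertex) =
      T.height (f.1 d.vertex) - ε * T.height d.vertex)
    (hy₂ : ∀ d : M.DirEdge, T.height (f.1 (f₂.1 d.vertex)) - ε * T.height (f₂.1 d.vertex) =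
      T.height (f.1 d.vertex) - ε * T.height d.vertex)
    (d : M.DirEdge) : w (mapDir f d) = ε * w d := by
  -- The differences of `y ∘ f - ε y` along edges are those of a vector with zero vertex sums, so
  -- the maximum principle applies to it.
  have hdiff : ∀ d : M.DirEdge, (T.height (f.1 d.vertex) - ε * T.height d.vertex) -
      (T.height (f.1 d.rev.vertex) - ε * T.height d.rev.vertex) = w (mapDir f d) - ε * w d := by
    intro d
    have h3 := T.height_sub_rev (mapDir f d)
    rw [← mapDir_rev] at h3
    change T.height (f.1 d.vertex) - T.height (f.1 d.rev.vertex) = _ at h3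
    rw [← h3, ← T.height_sub_rev]
    ring
  have h3 := maximum_principle h₁ h₂ hli (y := fun v => T.height (f.1 v) - ε * T.height v) hy₁ hy₂
    (by
      intro v hv
      simp only [hdiff]
      rw [finsum_mem_sub_distrib _ _ (finite_dirEdge_at v), sum_mapDir_eq_zero hw f hv,
        ← mul_finsum_mem, hw.1 v hv]
      simp) d
  have h4 := hdiff d
  linarith

end PlaneMap

/-! ### Periods of the tiling -/

namespace PlaneMap

variable {M : PlaneMap}

theorem isDirect_planeTranslation (t : ℂ) : IsDirect (planeTranslation t) :=
  ⟨1, t, by simp, fun z => by simp⟩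

/-- The negation of `P` is closed under `rot`, so forward transitivity applies to it. -/
theorem rot_transitive_of_backward {P : M.DirEdge → Prop} (hback : ∀ d : M.DirEdge, P d.rot → P d)
    {d c : M.DirEdge} (hd : P d) (hv : c.vertex = d.vertex) : P c := by
  by_contra hc
  exact rot_transitive (P := fun d => ¬ P d) (fun d h h' => h (hback d h')) hc hv.symm hd

namespace SquareTiling

variable {w : M.DirEdge → ℝ} (T : M.SquareTiling w)

/-- The pairs of a translation of `M` and the translation of the tiling that it induces. -/
def periodGroup : AddSubgroup (ℂ × ℂ) where
  carrier := {x | ∃ f : M.symmetryGroup, f.1 = planeTranslation x.1 ∧ ∀ d : M.DirEdge,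
    T.height (mapDir f d).vertex = T.height d.vertex + x.2.im ∧
    T.abscissa (mapDir f d).right = T.abscissa d.right + x.2.re}
  zero_mem' := by
    refine ⟨1, ?_, fun d => ?_⟩
    · ext z
      simp
    · rw [mapDir_one]
      simp
  add_mem' := by
    rintro x y ⟨f, hf, hfx⟩ ⟨g, hg, hgy⟩
    refine ⟨f * g, ?_, fun d => ?_⟩
    · ext z
      change f.1 (g.1 z) = _
      rw [hf, hg]
      simp only [planeTranslation_apply, Prod.fst_add]
      ring
    · rw [mapDir_mul, (hfx _).1, (hgy _).1, (hfx _).2, (hgy _).2]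
      simp only [Prod.snd_add, Complex.add_im, Complex.add_re]
      constructor <;> ring
  neg_mem' := by
    rintro x ⟨f, hf, hfx⟩
    refine ⟨f⁻¹, ?_, fun d => ?_⟩
    · ext z
      change f.1.symm z = _
      rw [IsometryEquiv.symm_apply_eq, hf]
      simp
    · have h := hfx (mapDir f⁻¹ d)
      rw [mapDir_mapDir_inv] at h
      simp only [Prod.snd_neg, Complex.neg_im, Complex.neg_re]
      constructor <;> linarith [h.1, h.2]

theorem exists_period {f : M.symmetryGroup} {t : ℂ} (hf : f.1 = planeTranslation t)
    (hw : ∀ d, w (mapDir f d) = w d) : ∃ p, (t, p) ∈ T.periodGroup := by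
  have hd : IsDirect f.1 := hf ▸ isDirect_planeTranslation t
  obtain ⟨k, hk⟩ := T.exists_height_shift T f 1 (fun d => by rw [hw, one_mul])
  obtain ⟨c, hc⟩ := T.exists_abscissa_shift_direct T hd 1 (fun d => by rw [hw, one_mul])
  refine ⟨⟨c, k⟩, f, hf, fun d => ⟨?_, ?_⟩⟩
  · have := hk d
    rwa [one_mul] at this
  · rw [right_mapDir_of_direct hd, hc, one_mul]

theorem translation_mem_of_period {x : ℂ × ℂ} (hx : x ∈ T.periodGroup) :
    planeTranslation x.2 ∈ T.symmetryGroup ∧ ∃ f : M.symmetryGroup, f.1 = planeTranslation x.1 ∧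
      ∀ e ∈ M.E, planeTranslation x.2 '' T.square e = T.square (f.1 '' e) := by
  obtain ⟨f, hf, hfx⟩ := hx
  have hd : IsDirect f.1 := hf ▸ isDirect_planeTranslation x.1
  have hw : ∀ d, w (mapDir f d) = w d := by
    intro d
    rw [← T.height_sub_rev, ← mapDir_rev, (hfx _).1, (hfx _).1, ← T.height_sub_rev]
    ring
  have h := T.induced_of_shift f (s := 1) (t := 1) (c := x.2.re) (k := x.2.im) (Or.inl rfl)
    (Or.inl rfl) (fun d => by rw [hw]) (fun d => by rw [← right_mapDir_of_direct hd, (hfx d).2, one_mul])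
    (fun d => by rw [one_mul]; exact (hfx d).1) (g := planeTranslation x.2) (fun z => by simp)
  exact ⟨h.1, f, hf, h.2.1⟩

/-- The periods of the tiling of a nonzero harmonic vector in two independent directions are
independent. -/
theorem linearIndependent_periods (hw : IsHarmonic w) (hw0 : w ≠ 0) {x₁ x₂ : ℂ × ℂ}
    (hx₁ : x₁ ∈ T.periodGroup) (hx₂ : x₂ ∈ T.periodGroup)
    (hli : LinearIndependent ℝ ![x₁.1, x₂.1]) : LinearIndependent ℝ ![x₁.2, x₂.2] := by
  by_contra hdep
  obtain ⟨α, β, hαβ, ha₁, ha₂⟩ := exists_annihilator hdep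
  obtain ⟨f₁, hf₁, hp₁⟩ := hx₁
  obtain ⟨f₂, hf₂, hp₂⟩ := hx₂
  obtain ⟨d₁, hd₁⟩ := exists_weight_ne_zero hw0
  -- If the periods were dependent, this combination would be periodic and attain its maximum. The
  -- aim is that `w` vanishes at a maximum and that maximality spreads to all directed edges,
  -- contradicting `w ≠ 0`.
  let u : M.DirEdge → ℝ := fun d => α * T.height d.vertex + β * T.abscissa d.right
  have hu : ∀ d, u d = α * T.height d.vertex + β * T.abscissa d.right := fun _ => rfl
  obtain ⟨d₀, hmax⟩ := exists_dirEdge_max hf₁ hf₂ hli (u := u)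
    (fun d => by rw [hu, hu, (hp₁ d).1, (hp₁ d).2]; linarith)
    (fun d => by rw [hu, hu, (hp₂ d).1, (hp₂ d).2]; linarith) d₁
  have hrot : ∀ d : M.DirEdge, u d.rot = u d + β * w d := by
    intro d
    rw [hu, hu, d.rot_vertex, d.right_rot, ← T.abscissa_sub_rev]
    ring
  have hrev : ∀ d : M.DirEdge, u d.rev = u d + (β - α) * w d := by
    intro d
    have h1 := T.height_sub_rev d
    have h2 := T.abscissa_sub_rev d
    rw [hu, hu, show T.height d.rev.vertex = T.height d.vertex - w d by linarith,
      show T.abscissa d.rev.right = T.abscissa d.right + w d by linarith]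
    ring
  have hrotrev : ∀ d : M.DirEdge, u d.rev.rot = u d - α * w d := by
    intro d
    rw [hrot, hrev, T.weight_rev]
    ring
  have key : ∀ d : M.DirEdge, u d = u d₀ →
      w d = 0 ∧ u d.rot = u d₀ ∧ u d.rev = u d₀ := by
    intro d hd
    suffices h : (w d = 0 ∨ β = 0 ∧ α * w d = 0) from by
      rcases h with h | ⟨h, h'⟩
      · rw [hrot, hrev, h, mul_zero, mul_zero, add_zero]
        exact ⟨rfl, hd, hd⟩
      · have hα : α ≠ 0 := hαβ.resolve_right (not_not.2 h)
        have h0 : w d = 0 := (mul_eq_zero.1 h').resolve_left hα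
        rw [hrot, hrev, h0, mul_zero, mul_zero, add_zero]
        exact ⟨rfl, hd, hd⟩
    -- If one coefficient is zero, `u` depends only on the vertex or only on the face, and the sums
    -- of `w` there give the usual maximum principle.
    rcases eq_or_ne β 0 with hβ | hβ
    · have hα : α ≠ 0 := hαβ.resolve_right (not_not.2 hβ)
      left
      refine eq_zero_of_finsum_eq_zero (finite_dirEdge_at d.vertex) hα (hw.1 _ d.vertex_mem) ?_ d rfl
      intro c hc
      have hc : c.vertex = d.vertex := hc
      have h1 : u c = u d := by rw [hu, hu, hc, hβ]; ring
      have h2 := hmax c.rev.rot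
      rw [hrotrev, h1, hd] at h2
      linarith
    rcases eq_or_ne α 0 with hα | hα
    · left
      have h3 := hw.2.2 d.right d.right_mem_faces
      rw [setOf_onRight] at h3
      refine eq_zero_of_finsum_eq_zero (finite_dirEdge_right d.right_mem_faces) (neg_ne_zero.2 hβ) h3
        ?_ d rfl
      intro c hc
      have hc : c.right = d.right := hc
      have h1 : u c = u d := by rw [hu, hu, hc, hα]; ring
      have h2 := hmax c.rot
      rw [hrot, h1, hd] at h2
      linarith
    left
    -- For coefficients of the same sign, crossing to the other face or to the other vertex gives
    -- incompatible signs for `w d`. For opposite signs such a comparison works at `c` when `c.rot`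
    -- is maximal, so maximality is pushed clockwise around the vertex until it reaches `d.rot`.
    rcases lt_or_gt_of_ne (mul_ne_zero hα hβ) with hneg | hpos
    · have hback : ∀ c : M.DirEdge, u c.rot = u d₀ → w c = 0 ∧ u c = u d₀ := by
        intro c hc
        rw [hrot] at hc
        have h1 := hmax c
        have h2 := hmax c.rev
        rw [hrev] at h2
        have h3 : 0 ≤ β * w c := by linarith
        have h4 : 0 ≤ α * w c := by linarith
        have h5 : w c = 0 := by
          have h6 : 0 ≤ (α * β) * (w c * w c) := by
            have := mul_nonneg h3 h4
            linarith
          by_contra hne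
          have h7 : 0 < w c * w c := mul_self_pos.2 hne
          have := mul_neg_of_neg_of_pos hneg h7
          linarith
        rw [h5] at hc
        exact ⟨h5, by linarith⟩
      have h1 := rot_transitive_of_backward (P := fun c => u c = u d₀) (fun c hc => (hback c hc).2) hd
        d.rot_vertex
      exact (hback d h1).1
    · have h1 := hmax d.rot
      have h2 := hmax d.rev.rot
      rw [hrot, hd] at h1
      rw [hrotrev, hd] at h2
      have h3 : 0 ≤ -(β * w d) := by linarith
      have h4 : 0 ≤ α * w d := by linarith
      have h6 : 0 ≤ -((α * β) * (w d * w d)) := by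
        have := mul_nonneg h3 h4
        linarith
      by_contra hne
      have h7 : 0 < w d * w d := mul_self_pos.2 hne
      have := mul_pos hpos h7
      linarith
  refine hd₁ (key d₁ ?_).1
  exact dirEdge_induction (P := fun d => u d = u d₀) (fun d hd => (key d hd).2.1)
    (fun d hd => (key d hd).2.2) rfl d₁

end SquareTiling

/-! ### Translations and half-turns acting on harmonic vectors -/

/-- A vector in `harmPer` is invariant under all translations of `M`. -/
theorem harmPer_translation {w : M.DirEdge → ℝ} (hw : w ∈ M.harmPer) {f : M.symmetryGroup} {t : ℂ}
    (hf : f.1 = planeTranslation t) (d : M.DirEdge) : w (mapDir f d) = w d := by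
  obtain ⟨hh, f₁, f₂, t₁, t₂, h₁, h₂, hli, hw₁, hw₂⟩ := hw
  obtain ⟨T⟩ := nonempty_squareTiling hh
  rw [pushforward_eq_iff] at hw₁ hw₂
  have aux : ∀ (g : M.symmetryGroup) (s : ℂ), g.1 = planeTranslation s →
      (∀ d, w (mapDir g d) = w d) → ∀ d : M.DirEdge,
      T.height (f.1 (g.1 d.vertex)) - 1 * T.height (g.1 d.vertex) =
        T.height (f.1 d.vertex) - 1 * T.height d.vertex := by
    intro g s hg hwg d
    obtain ⟨k, hk⟩ := T.exists_height_shift T g 1 (fun d => by rw [hwg, one_mul])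
    have h3 := hk d
    have h4 := hk (mapDir f d)
    -- Translations commute, so the period `g` shifts `y ∘ f` and `y` by the same constant `k`.
    have h5 : f.1 (g.1 d.vertex) = g.1 (mapDir f d).vertex := by
      change _ = g.1 (f.1 d.vertex)
      rw [hf, hg]
      simp only [planeTranslation_apply]
      ring
    rw [h5, h3, h4]
    change 1 * T.height (f.1 d.vertex) + k - _ = _
    ring
  have := T.weight_mapDir hh h₁ h₂ hli f 1 (aux f₁ t₁ h₁ hw₁) (aux f₂ t₂ h₂ hw₂) d
  rwa [one_mul] at this

/-- A half-turn changes the sign of the vectors in `harmPer`. -/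
theorem harmPer_halfTurn {w : M.DirEdge → ℝ} (hw : w ∈ M.harmPer) {f : M.symmetryGroup} {b : ℂ}
    (hf : ∀ z, f.1 z = -z + b) (d : M.DirEdge) : w (mapDir f d) = -w d := by
  obtain ⟨hh, f₁, f₂, t₁, t₂, h₁, h₂, hli, hw₁, hw₂⟩ := hw
  obtain ⟨T⟩ := nonempty_squareTiling hh
  rw [pushforward_eq_iff] at hw₁ hw₂
  have aux : ∀ (g : M.symmetryGroup) (s : ℂ), g.1 = planeTranslation s →
      (∀ d, w (mapDir g d) = w d) → ∀ d : M.DirEdge,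
      T.height (f.1 (g.1 d.vertex)) - (-1) * T.height (g.1 d.vertex) =
        T.height (f.1 d.vertex) - (-1) * T.height d.vertex := by
    intro g s hg hwg d
    obtain ⟨k, hk⟩ := T.exists_height_shift T g 1 (fun d => by rw [hwg, one_mul])
    have h3 := hk d
    have h4 := hk (mapDir f (mapDir g d))
    -- A half-turn conjugates `g` to its inverse, so `g` shifts `y ∘ f` by `-k` and `y` by `k`: the
    -- sum is periodic.
    have h5 : g.1 (mapDir f (mapDir g d)).vertex = f.1 d.vertex := by
      change g.1 (f.1 (g.1 d.vertex)) = _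
      rw [hf, hf, hg]
      simp only [planeTranslation_apply]
      ring
    rw [h5] at h4
    change T.height (f.1 d.vertex) = 1 * T.height (f.1 (g.1 d.vertex)) + k at h4
    linarith
  have := T.weight_mapDir hh h₁ h₂ hli f (-1) (aux f₁ t₁ h₁ hw₁) (aux f₂ t₂ h₂ hw₂) d
  linarith

/-- The group generated by two translations and a half-turn. -/
def halfTurnGroup (p q b : ℂ) : Subgroup (ℂ ≃ᵢ ℂ) where
  carrier := {g | ∃ m n : ℤ, (∀ z, g z = z + (m * p + n * q)) ∨ ∀ z, g z = -z + (b + (m * p + n * q))}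
  one_mem' := ⟨0, 0, Or.inl fun z => by simp⟩
  mul_mem' := by
    rintro g h ⟨m, n, hg⟩ ⟨m', n', hh⟩
    rcases hg with hg | hg <;> rcases hh with hh | hh
    · refine ⟨m + m', n + n', Or.inl fun z => ?_⟩
      rw [IsometryEquiv.mul_apply, hg, hh]
      push_cast
      ring
    · refine ⟨m + m', n + n', Or.inr fun z => ?_⟩
      rw [IsometryEquiv.mul_apply, hg, hh]
      push_cast
      ring
    · refine ⟨m - m', n - n', Or.inr fun z => ?_⟩
      rw [IsometryEquiv.mul_apply, hg, hh]
      push_cast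
      ring
    · refine ⟨m - m', n - n', Or.inl fun z => ?_⟩
      rw [IsometryEquiv.mul_apply, hg, hh]
      push_cast
      ring
  inv_mem' := by
    rintro g ⟨m, n, hg | hg⟩
    · refine ⟨-m, -n, Or.inl fun z => ?_⟩
      apply g.injective
      rw [IsometryEquiv.apply_inv_self, hg]
      push_cast
      ring
    · refine ⟨m, n, Or.inr fun z => ?_⟩
      apply g.injective
      rw [IsometryEquiv.apply_inv_self, hg]
      ring

theorem isWallpaperP_halfTurnGroup {p q : ℂ} (h : LinearIndependent ℝ ![p, q]) (b : ℂ) :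
    IsWallpaperP 2 (halfTurnGroup p q b) := by
  refine ⟨⟨p, q, h, fun t => ?_⟩, ?_, ?_⟩
  · constructor
    · rintro ⟨m, n, ht | ht⟩
      · exact ⟨m, n, by simpa using ht 0⟩
      · have h0 := ht 0
        have h1 := ht 1
        simp only [planeTranslation_apply] at h0 h1
        have : (2 : ℂ) = 0 := by linear_combination h1 - h0
        norm_num at this
    · rintro ⟨m, n, rfl⟩
      exact ⟨m, n, Or.inl fun z => rfl⟩
  · rintro g ⟨m, n, hg | hg⟩
    · exact ⟨1, _, by norm_num, fun z => by rw [hg, one_mul]⟩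
    · exact ⟨-1, _, by norm_num, fun z => by rw [hg, neg_one_mul]⟩
  · obtain ⟨g, hg⟩ : ∃ g : ℂ ≃ᵢ ℂ, ∀ z, g z = -z + b := ⟨IsometryEquiv.trans (IsometryEquiv.neg ℂ)
      (planeTranslation b), fun z => rfl⟩
    refine ⟨g, ⟨0, 0, Or.inr fun z => by rw [hg]; simp⟩, -1, b, ?_, fun z => by rw [hg, neg_one_mul]⟩
    exact IsPrimitiveRoot.neg_one 0 (by norm_num)

/-- Two periods induced by translations remain independent. A half-turn negates `w` and preserves
orientation, so it negates both heights and abscissas up to shifts and induces a half-turn. -/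
theorem containsP2_tiling (h : ContainsP2 M.symmetryGroup) {w : M.DirEdge → ℝ}
    (hw : w ∈ M.harmPer) (hw0 : w ≠ 0) (T : M.SquareTiling w) : ContainsP2 T.symmetryGroup := by
  obtain ⟨H, hH, ⟨t₁, t₂, hli, ht⟩, _, g, hg, a, b, ha, hgz⟩ := h
  have ha' : a = -1 := ha.eq_neg_one_of_two_right
  subst ha'
  have hm₁ : planeTranslation t₁ ∈ M.symmetryGroup := hH ((ht t₁).2 ⟨1, 0, by simp⟩)
  have hm₂ : planeTranslation t₂ ∈ M.symmetryGroup := hH ((ht t₂).2 ⟨0, 1, by simp⟩)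
  obtain ⟨p, hp⟩ := T.exists_period (f := ⟨_, hm₁⟩) (t := t₁) rfl (harmPer_translation hw rfl)
  obtain ⟨q, hq⟩ := T.exists_period (f := ⟨_, hm₂⟩) (t := t₂) rfl (harmPer_translation hw rfl)
  have hpq := T.linearIndependent_periods hw.1 hw0 hp hq hli
  let f : M.symmetryGroup := ⟨g, hH hg⟩
  have hf : ∀ z, f.1 z = -z + b := fun z => by
    have := hgz z
    rwa [neg_one_mul] at this
  have hwf : ∀ d, w (mapDir f d) = -1 * w d := fun d => by
    rw [harmPer_halfTurn hw hf, neg_one_mul]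
  have hdir : IsDirect f.1 := ⟨-1, b, by simp, hgz⟩
  obtain ⟨k, hk⟩ := T.exists_height_shift T f (-1) hwf
  obtain ⟨c, hc⟩ := T.exists_abscissa_shift_direct T hdir (-1) hwf
  obtain ⟨g', hg'⟩ := exists_axis_isometry (s := -1) (t := -1) (Or.inr rfl) (Or.inr rfl) c k
  have hmem := (T.induced_of_shift f (Or.inr rfl) (Or.inr rfl) (fun d => by rw [hwf]; simp) hc hk
    hg').1
  refine ⟨halfTurnGroup p q ⟨c, k⟩, ?_, isWallpaperP_halfTurnGroup hpq _⟩
  have htr : ∀ m n : ℤ, planeTranslation (m * p + n * q) ∈ T.symmetryGroup := by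
    intro m n
    have h1 := T.periodGroup.add_mem (T.periodGroup.zsmul_mem hp m) (T.periodGroup.zsmul_mem hq n)
    have h2 := (T.translation_mem_of_period h1).1
    simpa using h2
  rintro s ⟨m, n, hs | hs⟩
  · have : s = planeTranslation (m * p + n * q) := by
      ext z
      rw [hs]
      rfl
    rw [this]
    exact htr m n
  · have : s = planeTranslation (m * p + n * q) * g' := by
      ext z
      rw [hs, IsometryEquiv.mul_apply, planeTranslation_apply]
      have h1 : g' z = -z + ⟨c, k⟩ := by
        apply Complex.ext
        · rw [(hg' z).1]
          simp
        · rw [(hg' z).2]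
          simp
      rw [h1]
      ring
    rw [this]
    exact T.symmetryGroup.mul_mem (htr m n) hmem

end PlaneMap

/-! ### Isometries that preserve squares and lattices -/

theorem unit_of_re_mul_im {a : ℂ} (ha : ‖a‖ = 1) (h : a.re * a.im = 0) :
    a = 1 ∨ a = -1 ∨ a = Complex.I ∨ a = -Complex.I := by
  have h1 := Complex.sq_norm a
  rw [ha, Complex.normSq_apply] at h1
  rcases mul_eq_zero.1 h with h | h
  · have h2 : a.im = 1 ∨ a.im = -1 := mul_self_eq_one_iff.1 (by rw [h] at h1; linarith)
    rcases h2 with h2 | h2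
    · exact Or.inr (Or.inr (Or.inl (Complex.ext (by simp [h]) (by simp [h2]))))
    · exact Or.inr (Or.inr (Or.inr (Complex.ext (by simp [h]) (by simp [h2]))))
  · have h2 : a.re = 1 ∨ a.re = -1 := mul_self_eq_one_iff.1 (by rw [h] at h1; linarith)
    rcases h2 with h2 | h2
    · exact Or.inl (Complex.ext (by simp [h2]) (by simp [h]))
    · exact Or.inr (Or.inl (Complex.ext (by simp [h2]) (by simp [h])))

/-- The closed square with lower left corner `x + iy` and side `s`. -/
def axisSquare (x y s : ℝ) : Set ℂ := {z | z.re ∈ Icc x (x + s) ∧ z.im ∈ Icc y (y + s)}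

theorem axisSquare_dist {x y s : ℝ} {z₁ z₂ : ℂ} (h₁ : z₁ ∈ axisSquare x y s)
    (h₂ : z₂ ∈ axisSquare x y s) :
    (z₂ - z₁).re ^ 2 ≤ s ^ 2 ∧ (z₂ - z₁).im ^ 2 ≤ s ^ 2 := by
  obtain ⟨⟨a1, a2⟩, a3, a4⟩ := h₁
  obtain ⟨⟨b1, b2⟩, b3, b4⟩ := h₂
  rw [Complex.sub_re, Complex.sub_im]
  constructor <;> apply sq_le_sq' <;> linarith

theorem isometry_norm_sub (g : ℂ ≃ᵢ ℂ) (z₁ z₂ : ℂ) :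
    (g z₂ - g z₁).re ^ 2 + (g z₂ - g z₁).im ^ 2 = (z₂ - z₁).re ^ 2 + (z₂ - z₁).im ^ 2 := by
  have h := g.dist_eq z₂ z₁
  rw [Complex.dist_eq, Complex.dist_eq] at h
  have h1 := Complex.sq_norm (g z₂ - g z₁)
  have h2 := Complex.sq_norm (z₂ - z₁)
  rw [h, h2, Complex.normSq_apply, Complex.normSq_apply] at h1
  linarith

/-- The image of a diagonal of an axis-parallel square, under an isometry that maps the square to
such a square. -/
theorem diagonal_image {g : ℂ ≃ᵢ ℂ} {x y s x' y' s' : ℝ} (hs : 0 < s) (hs' : 0 < s')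
    (h : g '' axisSquare x y s = axisSquare x' y' s') :
    (g ⟨x + s, y + s⟩ - g ⟨x, y⟩).re ^ 2 = s ^ 2 ∧ (g ⟨x + s, y + s⟩ - g ⟨x, y⟩).im ^ 2 = s ^ 2 := by
  have c1 : ∀ {x y s : ℝ}, 0 < s → (⟨x, y⟩ : ℂ) ∈ axisSquare x y s := fun {x y s} hs =>
    ⟨⟨le_rfl, by simp only; linarith⟩, le_rfl, by simp only; linarith⟩
  have c2 : ∀ {x y s : ℝ}, 0 < s → (⟨x + s, y + s⟩ : ℂ) ∈ axisSquare x y s := fun {x y s} hs =>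
    ⟨⟨by simp only; linarith, le_rfl⟩, by simp only; linarith, le_rfl⟩
  have h1 := axisSquare_dist (h ▸ mem_image_of_mem g (c1 (x := x) (y := y) hs))
    (h ▸ mem_image_of_mem g (c2 (x := x) (y := y) hs))
  have h2 := isometry_norm_sub g ⟨x, y⟩ ⟨x + s, y + s⟩
  -- Opposite corners of the image square come from points of the original one, whence `s' ≤ s`.
  -- Both coordinates of the image diagonal are thus at most `s` in absolute value, while their
  -- squares add up to `2 * s ^ 2`, so equality holds.
  obtain ⟨u₁, hu₁, e₁⟩ : (⟨x', y'⟩ : ℂ) ∈ g '' axisSquare x y s := h ▸ c1 hs'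
  obtain ⟨u₂, hu₂, e₂⟩ : (⟨x' + s', y' + s'⟩ : ℂ) ∈ g '' axisSquare x y s := h ▸ c2 hs'
  have h3 := axisSquare_dist hu₁ hu₂
  have h4 := isometry_norm_sub g u₁ u₂
  rw [e₁, e₂] at h4
  simp only [Complex.sub_re, Complex.sub_im, add_sub_cancel_left] at h1 h2 h3 h4 ⊢
  constructor <;> linarith [h1.1, h1.2, h3.1, h3.2]

/-- The coordinates of the image diagonal are, up to sign, `s` times the sum and the difference of
the two parts of `a`. Equality of their squares forces `a.re * a.im = 0`. -/
theorem unit_of_square_image {g : ℂ ≃ᵢ ℂ} {x y s x' y' s' : ℝ} (hs : 0 < s) (hs' : 0 < s')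
    (h : g '' axisSquare x y s = axisSquare x' y' s') {a b : ℂ} (ha : ‖a‖ = 1)
    (hg : (∀ z, g z = a * z + b) ∨ ∀ z, g z = a * (starRingEnd ℂ) z + b) :
    a = 1 ∨ a = -1 ∨ a = Complex.I ∨ a = -Complex.I := by
  apply unit_of_re_mul_im ha
  obtain ⟨h1, h2⟩ := diagonal_image hs hs' h
  have hs2 : s ^ 2 ≠ 0 := pow_ne_zero _ hs.ne'
  rcases hg with hg | hg
  · simp [hg] at h1 h2
    have h3 : a.re * a.im * s ^ 2 = 0 := by linarith
    exact (mul_eq_zero.1 h3).resolve_right hs2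
  · simp [hg] at h1 h2
    have h3 : a.re * a.im * s ^ 2 = 0 := by linarith
    exact (mul_eq_zero.1 h3).resolve_right hs2

/-- `z` lies on none of the axes of symmetry of the squares centred at the origin. -/
def IsGeneric (z : ℂ) : Prop := z.im ≠ 0 ∧ z.re ≠ 0 ∧ z.re ≠ z.im ∧ z.re ≠ -z.im

/-- The map `z ↦ a * conj z` is the reflection in one of the four axes; its eigenvectors for `1` and
`-1` lie on that axis or on the perpendicular one, which is again among the four. -/
theorem IsGeneric.mul_conj_ne {z a : ℂ} (hz : IsGeneric z)
    (ha : a = 1 ∨ a = -1 ∨ a = Complex.I ∨ a = -Complex.I) {ε : ℝ} (hε : ε = 1 ∨ ε = -1) :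
    a * (starRingEnd ℂ) z ≠ ε * z := by
  obtain ⟨h1, h2, h3, h4⟩ := hz
  intro h
  have hr := congrArg Complex.re h
  have hi := congrArg Complex.im h
  rcases ha with rfl | rfl | rfl | rfl <;> rcases hε with rfl | rfl <;> simp at hr hi <;>
    first
    | exact h1 (by linarith)
    | exact h2 (by linarith)
    | exact h3 (by linarith)
    | exact h4 (by linarith)

theorem eq_zero_of_image_add_eq {S : Set ℂ} (hS : Bornology.IsBounded S) (hn : S.Nonempty) {u : ℂ}
    (h : planeTranslation u '' S = S) : u = 0 := by
  obtain ⟨x, hx⟩ := hn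
  have key : ∀ n : ℕ, x + n * u ∈ S := by
    intro n
    induction n with
    | zero => simpa using hx
    | succ n ih =>
      rw [← h]
      refine ⟨_, ih, ?_⟩
      simp only [planeTranslation_apply]
      push_cast
      ring
  obtain ⟨C, hC⟩ := hS.exists_norm_le
  by_contra hu
  have hpos : 0 < ‖u‖ := norm_pos_iff.2 hu
  obtain ⟨n, hn⟩ := exists_nat_gt ((C + ‖x‖) / ‖u‖)
  rw [div_lt_iff₀ hpos] at hn
  have h1 := hC _ (key n)
  have h2 : ‖(n : ℂ) * u‖ ≤ ‖x + n * u‖ + ‖x‖ := by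
    have := norm_sub_le (x + n * u) x
    simpa using this
  rw [norm_mul, Complex.norm_natCast] at h2
  linarith

/-- A group of translations between a lattice and a multiple of it is a lattice. -/
theorem exists_lattice_basis (A : AddSubgroup ℂ) {p q : ℂ} (hpq : LinearIndependent ℝ ![p, q])
    (hp : p ∈ A) (hq : q ∈ A) {N : ℕ} (hN : N ≠ 0)
    (h : ∀ s ∈ A, ∃ m n : ℤ, N * s = m * p + n * q) :
    ∃ t₁ t₂ : ℂ, LinearIndependent ℝ ![t₁, t₂] ∧
      ∀ t, t ∈ A ↔ ∃ m n : ℤ, t = m * t₁ + n * t₂ := by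
  have hNC : (N : ℂ) ≠ 0 := by exact_mod_cast hN
  let b₀ : Module.Basis (Fin 2) ℝ ℂ := basisOfLinearIndependentOfCardEqFinrank hpq
    (by simp [Complex.finrank_real_complex])
  have hb₀ : ∀ i, b₀ i = ![p, q] i := fun i => by simp [b₀]
  -- Dividing the basis by `N` gives a lattice that contains `A`, hence `A` is discrete; containing
  -- `p` and `q`, it has full rank.
  let b : Module.Basis (Fin 2) ℝ ℂ := b₀.isUnitSMul (w := fun _ => ((N : ℝ)⁻¹))
    (fun _ => (inv_ne_zero (by exact_mod_cast hN)).isUnit)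
  have hb : ∀ i, b i = (N : ℂ)⁻¹ * ![p, q] i := by
    intro i
    simp [b, Module.Basis.isUnitSMul_apply, hb₀]
  let L : Submodule ℤ ℂ := AddSubgroup.toIntSubmodule A
  have hL : L ≤ Submodule.span ℤ (Set.range b) := by
    intro s hs
    obtain ⟨m, n, hmn⟩ := h s hs
    have h1 : s = m • b 0 + n • b 1 := by
      rw [hb, hb]
      simp only [Matrix.cons_val_zero, Matrix.cons_val_one, zsmul_eq_mul]
      field_simp
      linear_combination hmn
    rw [h1]
    exact add_mem (Submodule.smul_mem _ _ (Submodule.subset_span ⟨0, rfl⟩))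
      (Submodule.smul_mem _ _ (Submodule.subset_span ⟨1, rfl⟩))
  have hd : DiscreteTopology (Submodule.span ℤ (Set.range b)) := inferInstance
  have : DiscreteTopology L := DiscreteTopology.of_subset
    (s := ((Submodule.span ℤ (Set.range b) : Submodule ℤ ℂ) : Set ℂ)) hd hL
  have : IsZLattice ℝ L := by
    refine ⟨?_⟩
    rw [eq_top_iff, ← b₀.span_eq, Submodule.span_le]
    rintro _ ⟨i, rfl⟩
    apply Submodule.subset_span
    rw [hb₀]
    fin_cases i
    · exact hp
    · exact hq
  have := ZLattice.module_free ℝ L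
  have := ZLattice.module_finite ℝ L
  have hrank : Module.finrank ℤ L = 2 := by
    rw [ZLattice.rank ℝ L, Complex.finrank_real_complex]
  let c : Module.Basis (Fin 2) ℤ L := Module.finBasisOfFinrankEq ℤ L hrank
  refine ⟨c 0, c 1, ?_, fun t => ?_⟩
  · have h1 := (c.ofZLatticeBasis ℝ L).linearIndependent
    have h2 : ⇑(c.ofZLatticeBasis ℝ L) = ![(c 0 : ℂ), (c 1 : ℂ)] := by
      funext i
      rw [Module.Basis.ofZLatticeBasis_apply]
      fin_cases i <;> rfl
    rwa [h2] at h1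
  · constructor
    · intro ht
      refine ⟨c.repr ⟨t, ht⟩ 0, c.repr ⟨t, ht⟩ 1, ?_⟩
      have h1 := congrArg (Subtype.val : L → ℂ) (c.sum_repr ⟨t, ht⟩)
      rw [Fin.sum_univ_two] at h1
      simp only [Submodule.coe_add, Submodule.coe_smul, zsmul_eq_mul] at h1
      exact h1.symm
    · rintro ⟨m, n, rfl⟩
      have h1 := A.add_mem (A.zsmul_mem (c 0).2 m) (A.zsmul_mem (c 1).2 n)
      simpa only [zsmul_eq_mul] using h1

open MeasureTheory in
-- The exceptional set is a proper linear subspace, hence null.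
theorem ae_linear_ne_zero {A B : ℝ} (h : A ≠ 0 ∨ B ≠ 0) :
    ∀ᵐ α : ℝ × ℝ, α.1 * A + α.2 * B ≠ 0 := by
  let φ : ℝ × ℝ →ₗ[ℝ] ℝ := (LinearMap.fst ℝ ℝ ℝ).smulRight A + (LinearMap.snd ℝ ℝ ℝ).smulRight B
  have hφ : ∀ α, φ α = α.1 * A + α.2 * B := fun α => by simp [φ]
  have htop : LinearMap.ker φ ≠ ⊤ := by
    intro ht
    rcases h with h | h
    · have : ((1, 0) : ℝ × ℝ) ∈ LinearMap.ker φ := ht ▸ Submodule.mem_top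
      rw [LinearMap.mem_ker, hφ] at this
      exact h (by simpa using this)
    · have : ((0, 1) : ℝ × ℝ) ∈ LinearMap.ker φ := ht ▸ Submodule.mem_top
      rw [LinearMap.mem_ker, hφ] at this
      exact h (by simpa using this)
  have h0 := Measure.addHaar_submodule (volume : Measure (ℝ × ℝ)) _ htop
  rw [ae_iff]
  convert h0 using 2
  ext α
  simp [hφ]

/-! ### Point group of the tiling; tilings of linear combinations -/

namespace PlaneMap

variable {M : PlaneMap}

namespace SquareTiling

variable {w w₁ w₂ : M.DirEdge → ℝ} (T : M.SquareTiling w)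

theorem square_eq_axisSquare {d : M.DirEdge} (hd : w d ≠ 0) : T.square d.edge =
    axisSquare (min (T.abscissa d.right) (T.abscissa d.rev.right))
      (min (T.height d.vertex) (T.height d.rev.vertex)) |w d| := by
  have aux : ∀ a b : ℝ, |b - a| = |w d| → min a b + |w d| = max a b := by
    intro a b h
    rw [← h, ← max_sub_min_eq_abs]
    ring
  ext z
  rw [T.mem_square_iff]
  change _ ↔ z.re ∈ Icc _ _ ∧ z.im ∈ Icc _ _
  rw [aux _ _ (by rw [T.abscissa_sub_rev]), aux _ _ (by rw [abs_sub_comm, T.height_sub_rev])]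
  exact and_iff_right hd

theorem exists_square_of_mem_tiles {S : Set ℂ} (hS : S ∈ T.tiles) :
    ∃ d : M.DirEdge, w d ≠ 0 ∧ S = T.square d.edge := by
  obtain ⟨e, he, rfl, hn⟩ := hS
  have h := orient_edge ⟨e, he⟩
  simp only at h
  rw [← h] at hn ⊢
  exact ⟨_, (T.square_nonempty_iff _).1 hn, rfl⟩

theorem exists_axisSquare_of_mem_tiles {S : Set ℂ} (hS : S ∈ T.tiles) :
    ∃ x y s : ℝ, 0 < s ∧ S = axisSquare x y s := by
  obtain ⟨d, hd, rfl⟩ := T.exists_square_of_mem_tiles hS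
  exact ⟨_, _, _, abs_pos.2 hd, T.square_eq_axisSquare hd⟩

theorem tiles_nonempty (hw : w ≠ 0) : T.tiles.Nonempty := by
  obtain ⟨d, hd⟩ := exists_weight_ne_zero hw
  exact ⟨_, d.edge, d.edge_mem, rfl, (T.square_nonempty_iff d).2 hd⟩

theorem image_mem_tiles {g : ℂ ≃ᵢ ℂ} (hg : g ∈ T.symmetryGroup) {S : Set ℂ} (hS : S ∈ T.tiles) :
    g '' S ∈ T.tiles := by
  have h : (fun S : Set ℂ => g '' S) '' T.tiles = T.tiles := hg
  rw [← h]
  exact mem_image_of_mem _ hS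

/-- The point group of a square tiling consists of symmetries of the square. -/
theorem unit_of_mem_symmetryGroup (hw : w ≠ 0) {g : ℂ ≃ᵢ ℂ} (hg : g ∈ T.symmetryGroup) {a b : ℂ}
    (ha : ‖a‖ = 1) (h : (∀ z, g z = a * z + b) ∨ ∀ z, g z = a * (starRingEnd ℂ) z + b) :
    a = 1 ∨ a = -1 ∨ a = Complex.I ∨ a = -Complex.I := by
  obtain ⟨S, hS⟩ := T.tiles_nonempty hw
  obtain ⟨x', y', s', hs', h'⟩ := T.exists_axisSquare_of_mem_tiles (T.image_mem_tiles hg hS)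
  obtain ⟨x, y, s, hs, rfl⟩ := T.exists_axisSquare_of_mem_tiles hS
  exact unit_of_square_image hs hs' h' ha h

/-- The tiling of a linear combination of two vectors. -/
def combination (T₁ : M.SquareTiling w₁) (T₂ : M.SquareTiling w₂) (α : ℝ × ℝ) :
    M.SquareTiling (α.1 • w₁ + α.2 • w₂) where
  height v := α.1 * T₁.height v + α.2 * T₂.height v
  abscissa F := α.1 * T₁.abscissa F + α.2 * T₂.abscissa F
  height_sub d d' h := by
    simp only [Pi.add_apply, Pi.smul_apply, smul_eq_mul]
    rw [← T₁.height_sub d d' h, ← T₂.height_sub d d' h]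
    ring
  abscissa_sub d d' F F' h hF hF' := by
    simp only [Pi.add_apply, Pi.smul_apply, smul_eq_mul]
    rw [← T₁.abscissa_sub d d' F F' h hF hF', ← T₂.abscissa_sub d d' F F' h hF hF']
    ring

/-- For a fixed translation of the map, the period depends linearly on the coefficients. This is the
source of genericity in (iii). -/
theorem mem_periodGroup_combination {T₁ : M.SquareTiling w₁} {T₂ : M.SquareTiling w₂} {t p q : ℂ}
    (hp : (t, p) ∈ T₁.periodGroup) (hq : (t, q) ∈ T₂.periodGroup) (α : ℝ × ℝ) :
    (t, α.1 * p + α.2 * q) ∈ (T₁.combination T₂ α).periodGroup := by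
  obtain ⟨f, hf, hfp⟩ := hp
  obtain ⟨f', hf', hfq⟩ := hq
  have : f' = f := Subtype.ext (hf'.trans hf.symm)
  subst this
  refine ⟨f', hf, fun d => ?_⟩
  simp only [combination, hfp, hfq, Complex.add_im, Complex.add_re, Complex.re_ofReal_mul,
    Complex.im_ofReal_mul]
  constructor <;> ring

/-- Two tilings of the same vector differ by a translation, so periods found for the tiling
`combination` are valid for every other. -/
theorem mem_periodGroup_of_mem {T T' : M.SquareTiling w} {x : ℂ × ℂ} (hx : x ∈ T.periodGroup) :
    x ∈ T'.periodGroup := by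
  obtain ⟨f, hf, h⟩ := hx
  obtain ⟨k, hk⟩ := T.exists_height_shift T' 1 1 (fun d => by rw [mapDir_one, one_mul])
  obtain ⟨c, hc⟩ := T.exists_abscissa_shift_direct T' (f := 1)
    ⟨1, 0, by simp, fun z => by simp⟩ 1 (fun d => by rw [mapDir_one, one_mul])
  have hk' : ∀ d : M.DirEdge, T'.height d.vertex = 1 * T.height d.vertex + k := hk
  have hc' : ∀ d : M.DirEdge, T'.abscissa d.right = 1 * T.abscissa d.right + c := by
    intro d
    rw [← hc]
    congr 1
    exact (image_id _).symm
  refine ⟨f, hf, fun d => ?_⟩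
  rw [hk', hk', hc', hc', (h d).1, (h d).2]
  constructor <;> ring

end SquareTiling

end PlaneMap

/-! ### Translation lattices, wallpaper types and generic periods -/

theorem eq_of_image_add_eq {S : Set ℂ} (hS : Bornology.IsBounded S) (hn : S.Nonempty) {u v : ℂ}
    (h : planeTranslation u '' S = planeTranslation v '' S) : u = v := by
  have h1 : planeTranslation (u - v) '' S = S := by
    have h2 := congrArg (fun A => planeTranslation (-v) '' A) h
    simp only [image_image, planeTranslation_apply, add_neg_cancel_right, image_id'] at h2
    refine Eq.trans (image_congr fun z _ => ?_) h2
    simp only [planeTranslation_apply]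
    ring
  exact sub_eq_zero.1 (eq_zero_of_image_add_eq hS hn h1)

/-- The vectors of the translations in `G`. -/
def translationVectors (G : Subgroup (ℂ ≃ᵢ ℂ)) : AddSubgroup ℂ where
  carrier := {s | planeTranslation s ∈ G}
  zero_mem' := by
    have : planeTranslation 0 = 1 := by
      ext z
      simp
    change planeTranslation 0 ∈ G
    rw [this]
    exact G.one_mem
  add_mem' {s t} hs ht := by
    have : planeTranslation (s + t) = planeTranslation s * planeTranslation t := by
      ext z
      rw [IsometryEquiv.mul_apply]
      simp only [planeTranslation_apply]
      ring
    change planeTranslation (s + t) ∈ G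
    rw [this]
    exact G.mul_mem hs ht
  neg_mem' {s} hs := by
    have : planeTranslation (-s) = (planeTranslation s)⁻¹ := by
      ext z
      apply (planeTranslation s).injective
      rw [IsometryEquiv.apply_inv_self]
      simp
    change planeTranslation (-s) ∈ G
    rw [this]
    exact G.inv_mem hs

theorem mem_translationVectors {G : Subgroup (ℂ ≃ᵢ ℂ)} {s : ℂ} :
    s ∈ translationVectors G ↔ planeTranslation s ∈ G := Iff.rfl

theorem conj_mem_translationVectors {G : Subgroup (ℂ ≃ᵢ ℂ)} {g : ℂ ≃ᵢ ℂ} (hg : g ∈ G) {a b : ℂ}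
    (h : ∀ z, g z = a * (starRingEnd ℂ) z + b) {s : ℂ} (hs : s ∈ translationVectors G) :
    a * (starRingEnd ℂ) s ∈ translationVectors G := by
  have h1 : planeTranslation (a * (starRingEnd ℂ) s) = g * planeTranslation s * g⁻¹ := by
    ext z
    obtain ⟨u, rfl⟩ := g.surjective z
    rw [IsometryEquiv.mul_apply, IsometryEquiv.mul_apply, IsometryEquiv.inv_apply_self]
    simp only [planeTranslation_apply, h, map_add]
    ring
  rw [mem_translationVectors, h1]
  exact G.mul_mem (G.mul_mem hg hs) (G.inv_mem hg)

theorem isWallpaperP_of_units {G : Subgroup (ℂ ≃ᵢ ℂ)}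
    (hlat : ∃ t₁ t₂ : ℂ, LinearIndependent ℝ ![t₁, t₂] ∧
      ∀ t : ℂ, planeTranslation t ∈ G ↔ ∃ m n : ℤ, t = m * t₁ + n * t₂)
    (h : ∀ g ∈ G, ∃ a b : ℂ, (a = 1 ∨ a = -1 ∨ a = Complex.I ∨ a = -Complex.I) ∧
      ∀ z, g z = a * z + b) :
    IsWallpaperP 1 G ∨ IsWallpaperP 2 G ∨ IsWallpaperP 4 G := by
  by_cases h4 : ∃ g ∈ G, ∃ a b : ℂ, (a = Complex.I ∨ a = -Complex.I) ∧ ∀ z, g z = a * z + b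
  · obtain ⟨g, hg, a, b, ha, hgz⟩ := h4
    refine Or.inr (Or.inr ⟨hlat, fun c hc => ?_, g, hg, a, b, ?_, hgz⟩)
    · obtain ⟨a', b', ha', h'⟩ := h c hc
      refine ⟨a', b', ?_, h'⟩
      rcases ha' with rfl | rfl | rfl | rfl
      · norm_num
      · norm_num
      · exact Complex.I_pow_four
      · rw [Even.neg_pow (by decide), Complex.I_pow_four]
    · have h2 : a ^ 2 = -1 := by rcases ha with rfl | rfl <;> simp
      refine IsPrimitiveRoot.of_map_of_injective (f := MonoidHom.id ℂ) ?_ Function.injective_id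
      -- Since `a ^ 2 = -1` and `a ^ 4 = 1`, the order is `4`, obtained as a power of the prime `2`.
      have : IsPrimitiveRoot a (2 ^ (1 + 1)) := by
        rw [IsPrimitiveRoot.iff_orderOf]
        exact orderOf_eq_prime_pow (by rw [pow_one, h2]; norm_num)
          (by rw [show 2 ^ (1 + 1) = 2 * 2 by norm_num, pow_mul, h2]; norm_num)
      exact this
  · have h' : ∀ g ∈ G, ∃ a b : ℂ, (a = 1 ∨ a = -1) ∧ ∀ z, g z = a * z + b := by
      intro g hg
      obtain ⟨a, b, ha, hgz⟩ := h g hg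
      refine ⟨a, b, ?_, hgz⟩
      rcases ha with ha | ha | ha | ha
      · exact Or.inl ha
      · exact Or.inr ha
      · exact absurd ⟨g, hg, a, b, Or.inl ha, hgz⟩ h4
      · exact absurd ⟨g, hg, a, b, Or.inr ha, hgz⟩ h4
    by_cases h2 : ∃ g ∈ G, ∃ b : ℂ, ∀ z, g z = -1 * z + b
    · obtain ⟨g, hg, b, hgz⟩ := h2
      refine Or.inr (Or.inl ⟨hlat, fun c hc => ?_, g, hg, -1, b, ?_, hgz⟩)
      · obtain ⟨a', b', ha', h'⟩ := h' c hc
        exact ⟨a', b', by rcases ha' with rfl | rfl <;> norm_num, h'⟩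
      · exact IsPrimitiveRoot.neg_one 0 (by norm_num)
    · refine Or.inl ⟨hlat, fun c hc => ?_, 1, G.one_mem, 1, 0, ?_, fun z => by simp⟩
      · obtain ⟨a', b', rfl | rfl, h'⟩ := h' c hc
        · exact ⟨1, b', one_pow 1, h'⟩
        · exact absurd ⟨c, hc, b', h'⟩ h2
      · exact IsPrimitiveRoot.one

open MeasureTheory in
/-- For almost every linear combination of two lattices, all nonzero vectors are generic. -/
theorem ae_isGeneric {p₁ p₂ q₁ q₂ : ℂ} (h : ∀ α : ℝ × ℝ, α ≠ 0 →
      LinearIndependent ℝ ![α.1 * p₁ + α.2 * q₁, α.1 * p₂ + α.2 * q₂]) :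
    ∀ᵐ α : ℝ × ℝ, ∀ m n : ℤ, (m ≠ 0 ∨ n ≠ 0) →
      IsGeneric (m * (α.1 * p₁ + α.2 * q₁) + n * (α.1 * p₂ + α.2 * q₂)) := by
  rw [ae_all_iff]
  intro m
  rw [ae_all_iff]
  intro n
  by_cases hmn : m ≠ 0 ∨ n ≠ 0
  swap
  · exact Eventually.of_forall fun α h' => absurd h' hmn
  -- A relation with coefficients `s, t` would be, after regrouping, a relation with coefficients
  -- `m, n` between the two periods for `α = (s, t)`.
  have hli : LinearIndependent ℝ ![m * p₁ + n * p₂, m * q₁ + n * q₂] := by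
    rw [LinearIndependent.pair_iff]
    intro s t hst
    by_contra hne
    have h1 := h (s, t) (fun h0 => hne (Prod.mk.inj h0))
    rw [LinearIndependent.pair_iff] at h1
    have h2 := h1 m n (by
      simp only [Complex.real_smul] at hst ⊢
      push_cast
      linear_combination hst)
    rcases hmn with h3 | h3
    · exact h3 (by exact_mod_cast h2.1)
    · exact h3 (by exact_mod_cast h2.2)
  -- The two vectors of `hli` span the plane, so a nonzero form in `re` and `im` cannot kill both;
  -- its value on the period is a nonzero linear form in `α`.
  have key : ∀ c d : ℝ, (c ≠ 0 ∨ d ≠ 0) → ∀ᵐ α : ℝ × ℝ,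
      c * (m * (α.1 * p₁ + α.2 * q₁) + n * (α.1 * p₂ + α.2 * q₂)).im +
      d * (m * (α.1 * p₁ + α.2 * q₁) + n * (α.1 * p₂ + α.2 * q₂)).re ≠ 0 := by
    intro c d hcd
    have h1 : c * (m * p₁ + n * p₂).im + d * (m * p₁ + n * p₂).re ≠ 0 ∨
        c * (m * q₁ + n * q₂).im + d * (m * q₁ + n * q₂).re ≠ 0 := by
      by_contra hc
      push Not at hc
      have h2 : ∀ z : ℂ, c * z.im + d * z.re = 0 := by
        intro z
        obtain ⟨s, t, hz⟩ := exists_real_coords hli z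
        rw [hz, Complex.add_im, Complex.add_re, Complex.im_ofReal_mul, Complex.im_ofReal_mul,
          Complex.re_ofReal_mul, Complex.re_ofReal_mul]
        linear_combination s * hc.1 + t * hc.2
      rcases hcd with h3 | h3
      · exact h3 (by simpa using h2 Complex.I)
      · exact h3 (by simpa using h2 1)
    filter_upwards [ae_linear_ne_zero h1] with α hα
    convert hα using 1
    simp
    ring
  -- One form for each of the four axes in `IsGeneric`.
  filter_upwards [key 1 0 (by norm_num), key 0 1 (by norm_num), key (-1) 1 (by norm_num),
    key 1 1 (by norm_num)] with α h1 h2 h3 h4 _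
  refine ⟨?_, ?_, ?_, ?_⟩
  · intro h0
    exact h1 (by rw [h0]; ring)
  · intro h0
    exact h2 (by rw [h0]; ring)
  · intro h0
    exact h3 (by rw [h0]; ring)
  · intro h0
    exact h4 (by rw [h0]; ring)

/-! ### Finiteness of the tiles and exclusion of reflections -/

namespace PlaneMap

variable {M : PlaneMap}

namespace SquareTiling

variable {w : M.DirEdge → ℝ} (T : M.SquareTiling w)

/-- Up to the translations induced by translations of `M`, there are finitely many tiles. -/
theorem exists_finite_tiles {x₁ x₂ : ℂ × ℂ} (hx₁ : x₁ ∈ T.periodGroup) (hx₂ : x₂ ∈ T.periodGroup)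
    (hli : LinearIndependent ℝ ![x₁.1, x₂.1]) : ∃ 𝒟 : Set (Set ℂ), 𝒟.Finite ∧
      ∀ S ∈ T.tiles, ∃ m n : ℤ, planeTranslation (m * x₁.2 + n * x₂.2) '' S ∈ 𝒟 := by
  obtain ⟨f₁, hf₁, -⟩ := id hx₁
  obtain ⟨f₂, hf₂, -⟩ := id hx₂
  obtain ⟨D, hD, h⟩ := exists_finite_transversal hf₁ hf₂ hli
  refine ⟨(fun d : M.DirEdge => T.square d.edge) '' D, hD.image _, fun S hS => ?_⟩
  obtain ⟨d, -, rfl⟩ := T.exists_square_of_mem_tiles hS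
  obtain ⟨m, n, hmn⟩ := h d
  have hx := T.periodGroup.add_mem (T.periodGroup.zsmul_mem hx₁ m) (T.periodGroup.zsmul_mem hx₂ n)
  obtain ⟨-, f, hf, hfe⟩ := T.translation_mem_of_period hx
  refine ⟨m, n, _, hmn, ?_⟩
  have h1 := hfe d.edge d.edge_mem
  have h2 : (m • x₁ + n • x₂).2 = m * x₁.2 + n * x₂.2 := by simp
  rw [h2] at h1
  rw [h1]
  change T.square ((f₁ ^ m * f₂ ^ n).1 '' d.edge) = _
  congr 2
  ext z
  rw [zpow_mul_zpow_apply hf₁ hf₂, hf]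
  simp

/-- A multiple of every translation of the tiling is induced by a translation of `M`. -/
theorem exists_multiple_mem (hw : w ≠ 0) {x₁ x₂ : ℂ × ℂ} (hx₁ : x₁ ∈ T.periodGroup)
    (hx₂ : x₂ ∈ T.periodGroup) (hli : LinearIndependent ℝ ![x₁.1, x₂.1]) :
    ∃ N : ℕ, N ≠ 0 ∧ ∀ s ∈ translationVectors T.symmetryGroup,
      ∃ m n : ℤ, N * s = m * x₁.2 + n * x₂.2 := by
  obtain ⟨𝒟, hfin, h𝒟⟩ := T.exists_finite_tiles hx₁ hx₂ hli
  obtain ⟨S, hS⟩ := T.tiles_nonempty hw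
  have hne : S.Nonempty := by
    obtain ⟨_, _, _, h⟩ := id hS
    exact h
  have hbd : Bornology.IsBounded S := by
    obtain ⟨x, y, s, -, rfl⟩ := T.exists_axisSquare_of_mem_tiles hS
    have h1 : Bornology.IsBounded (Icc x (x + s) ×ℂ Icc y (y + s)) :=
      (Metric.isBounded_Icc _ _).reProdIm (Metric.isBounded_Icc _ _)
    exact h1
  -- The pigeonhole principle puts `(j - i) * s` into the period lattice for some `0 < j - i ≤
  -- card`, depending on `s`; the factorial is a multiple of all such differences.
  refine ⟨Nat.factorial hfin.toFinset.card, Nat.factorial_ne_zero _, fun s hs => ?_⟩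
  have h1 : ∀ k : ℕ, ∃ m n : ℤ, planeTranslation (m * x₁.2 + n * x₂.2 + k * s) '' S ∈ 𝒟 := by
    intro k
    have h2 : (k : ℂ) * s ∈ translationVectors T.symmetryGroup := by
      simpa using (translationVectors T.symmetryGroup).nsmul_mem hs k
    obtain ⟨m, n, hmn⟩ := h𝒟 _ (T.image_mem_tiles h2 hS)
    refine ⟨m, n, ?_⟩
    rw [image_image] at hmn
    convert hmn using 2
    simp only [planeTranslation_apply]
    ring
  choose m n hmn using h1
  obtain ⟨i, hi, j, hj, hij, he⟩ := Finset.exists_ne_map_eq_of_card_lt_of_maps_to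
    (s := Finset.range (hfin.toFinset.card + 1)) (t := hfin.toFinset) (by simp)
    (f := fun k => planeTranslation (m k * x₁.2 + n k * x₂.2 + k * s) '' S)
    (fun k _ => by simpa using hmn k)
  wlog hlt : i < j generalizing i j
  · exact this j hj i hi hij.symm he.symm (lt_of_le_of_ne (not_lt.1 hlt) hij.symm)
  have h0 := eq_of_image_add_eq hbd hne he
  have hle : j - i ≤ hfin.toFinset.card := by
    have := Finset.mem_range.1 hj
    omega
  obtain ⟨c, hc⟩ := Nat.dvd_factorial (Nat.sub_pos_of_lt hlt) hle
  refine ⟨c * (m i - m j), c * (n i - n j), ?_⟩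
  rw [hc, Nat.cast_mul, Nat.cast_sub hlt.le]
  push_cast
  linear_combination -(c : ℂ) * h0

/-- If no period vector of the tiling lies on an axis of symmetry of the squares, then its symmetry
group has no reflections and no glide reflections. -/
theorem isWallpaperP_of_isGeneric (hharm : IsHarmonic w) (hw : w ≠ 0) {x₁ x₂ : ℂ × ℂ}
    (hx₁ : x₁ ∈ T.periodGroup) (hx₂ : x₂ ∈ T.periodGroup)
    (hli : LinearIndependent ℝ ![x₁.1, x₂.1])
    (hgen : ∀ m n : ℤ, (m ≠ 0 ∨ n ≠ 0) → IsGeneric (m * x₁.2 + n * x₂.2)) :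
    IsWallpaperP 1 T.symmetryGroup ∨ IsWallpaperP 2 T.symmetryGroup ∨
      IsWallpaperP 4 T.symmetryGroup := by
  have hp₁ : x₁.2 ∈ translationVectors T.symmetryGroup := (T.translation_mem_of_period hx₁).1
  have hp₂ : x₂.2 ∈ translationVectors T.symmetryGroup := (T.translation_mem_of_period hx₂).1
  obtain ⟨N, hN, hmul⟩ := T.exists_multiple_mem hw hx₁ hx₂ hli
  refine isWallpaperP_of_units (exists_lattice_basis _
    (T.linearIndependent_periods hharm hw hx₁ hx₂ hli) hp₁ hp₂ hN hmul) fun g hg => ?_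
  rcases isDirect_or_isOpposite g with ⟨a, b, ha, hab⟩ | ⟨a, b, ha, hab⟩
  · exact ⟨a, b, T.unit_of_mem_symmetryGroup hw hg ha (Or.inl hab), hab⟩
  exfalso
  have hunit := T.unit_of_mem_symmetryGroup hw hg ha (Or.inr hab)
  obtain ⟨m, n, hmn⟩ := hmul _ (conj_mem_translationVectors hg hab hp₁)
  have haa : a * (starRingEnd ℂ) a = 1 := by
    rw [Complex.mul_conj, Complex.normSq_eq_norm_sq, ha]
    norm_num
  -- The sum of `x₁.2` and its reflection is fixed by the linear part of `g`, and `N` times it is an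
  -- integral combination of the periods. Unless it is zero, this period lies on an axis.
  have hfix : a * (starRingEnd ℂ) (((N + m : ℤ) : ℂ) * x₁.2 + n * x₂.2) =
      (1 : ℝ) * (((N + m : ℤ) : ℂ) * x₁.2 + n * x₂.2) := by
    have h1 : ((N + m : ℤ) : ℂ) * x₁.2 + n * x₂.2 =
        N * x₁.2 + N * (a * (starRingEnd ℂ) x₁.2) := by
      rw [hmn]
      push_cast
      ring
    rw [h1]
    simp only [map_add, map_mul, Complex.conj_conj, map_natCast, Complex.ofReal_one]
    linear_combination (N : ℂ) * x₁.2 * haa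
  by_cases h0 : (N + m : ℤ) ≠ 0 ∨ n ≠ 0
  · exact (hgen _ _ h0).mul_conj_ne hunit (Or.inl rfl) hfix
  -- If the sum is zero, the reflection negates `x₁.2`, which then lies on an axis itself.
  push Not at h0
  have h2 : IsGeneric x₁.2 := by
    have := hgen 1 0 (Or.inl one_ne_zero)
    simpa using this
  refine h2.mul_conj_ne hunit (Or.inr rfl) ?_
  have hNC : (N : ℂ) ≠ 0 := Nat.cast_ne_zero.2 hN
  have hm : (m : ℂ) = -N := by
    rw [show m = -(N : ℤ) by omega]
    push_cast
    rfl
  rw [h0.2, hm, Int.cast_zero, zero_mul, add_zero] at hmn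
  apply mul_left_cancel₀ hNC
  rw [hmn]
  push_cast
  ring

end SquareTiling

end PlaneMap

namespace PlaneMap

variable {M : PlaneMap}

open MeasureTheory in
-- The periods of the two basis tilings for fixed translations of the map give those of all
-- combinations. They are independent for every `α ≠ 0`, hence generic for almost every `α`, which
-- excludes orientation-reversing symmetries.
theorem ae_isWallpaperP (hM : M.IsPeriodic) {w₁ w₂ : M.DirEdge → ℝ} (h : M.IsHarmPerBasis w₁ w₂) :
    ∀ᵐ α : ℝ × ℝ, ∀ T : M.SquareTiling (α.1 • w₁ + α.2 • w₂),
      IsWallpaperP 1 T.symmetryGroup ∨ IsWallpaperP 2 T.symmetryGroup ∨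
        IsWallpaperP 4 T.symmetryGroup := by
  obtain ⟨hind, hspan⟩ := h
  obtain ⟨t₁, t₂, hli, ht₁, ht₂⟩ := hM
  have hmem : ∀ α : ℝ × ℝ, α.1 • w₁ + α.2 • w₂ ∈ M.harmPer := by
    intro α
    rw [← hspan]
    exact Submodule.mem_span_pair.2 ⟨α.1, α.2, rfl⟩
  have hne : ∀ α : ℝ × ℝ, α ≠ 0 → α.1 • w₁ + α.2 • w₂ ≠ 0 := by
    intro α hα h0
    rw [LinearIndependent.pair_iff] at hind
    have h1 := hind _ _ h0
    exact hα (Prod.ext h1.1 h1.2)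
  have hw₁ : w₁ ∈ M.harmPer := by simpa using hmem (1, 0)
  have hw₂ : w₂ ∈ M.harmPer := by simpa using hmem (0, 1)
  obtain ⟨T₁⟩ := nonempty_squareTiling hw₁.1
  obtain ⟨T₂⟩ := nonempty_squareTiling hw₂.1
  obtain ⟨p₁, hp₁⟩ := T₁.exists_period (f := ⟨_, ht₁⟩) (t := t₁) rfl (harmPer_translation hw₁ rfl)
  obtain ⟨p₂, hp₂⟩ := T₁.exists_period (f := ⟨_, ht₂⟩) (t := t₂) rfl (harmPer_translation hw₁ rfl)
  obtain ⟨q₁, hq₁⟩ := T₂.exists_period (f := ⟨_, ht₁⟩) (t := t₁) rfl (harmPer_translation hw₂ rfl)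
  obtain ⟨q₂, hq₂⟩ := T₂.exists_period (f := ⟨_, ht₂⟩) (t := t₂) rfl (harmPer_translation hw₂ rfl)
  have h₁ : ∀ α : ℝ × ℝ, (t₁, α.1 * p₁ + α.2 * q₁) ∈ (T₁.combination T₂ α).periodGroup :=
    SquareTiling.mem_periodGroup_combination hp₁ hq₁
  have h₂ : ∀ α : ℝ × ℝ, (t₂, α.1 * p₂ + α.2 * q₂) ∈ (T₁.combination T₂ α).periodGroup :=
    SquareTiling.mem_periodGroup_combination hp₂ hq₂
  have hind' : ∀ α : ℝ × ℝ, α ≠ 0 →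
      LinearIndependent ℝ ![α.1 * p₁ + α.2 * q₁, α.1 * p₂ + α.2 * q₂] := by
    intro α hα
    have h3 := (T₁.combination T₂ α).linearIndependent_periods (x₁ := (t₁, α.1 * p₁ + α.2 * q₁))
      (x₂ := (t₂, α.1 * p₂ + α.2 * q₂)) (hmem α).1 (hne α hα) (h₁ α) (h₂ α) hli
    exact h3
  have hgen := ae_isGeneric hind'
  have hzero : ∀ᵐ α : ℝ × ℝ, α ≠ 0 := by
    filter_upwards [ae_linear_ne_zero (A := 1) (B := 0) (Or.inl one_ne_zero)] with α hα
    rintro rfl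
    simp at hα
  refine (hzero.and hgen).mono fun α hα T => ?_
  exact T.isWallpaperP_of_isGeneric ((hmem α).1) (hne α hα.1)
    (SquareTiling.mem_periodGroup_of_mem (h₁ α)) (SquareTiling.mem_periodGroup_of_mem (h₂ α)) hli
    hα.2

end PlaneMap

theorem mainTheorem5 (M : PlaneMap) (hM : M.IsPeriodic) :
    -- the tiling `T(M, w)` exists
    (∀ w ∈ M.harmPer, w ≠ 0 → Nonempty (M.SquareTiling w)) ∧
    -- (i)
    (∀ w ∈ M.harmPer, w ≠ 0 → ∀ (T : M.SquareTiling w) (f : M.symmetryGroup),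
      T.Induces f ↔ (PlaneMap.pushforward f w = w ∨ PlaneMap.pushforward f w = -w)) ∧
    -- (ii)
    (ContainsP2 M.symmetryGroup →
      ∀ w ∈ M.harmPer, w ≠ 0 → ∀ T : M.SquareTiling w, ContainsP2 T.symmetryGroup) ∧
    -- (iii)
    (∀ w₁ w₂ : M.DirEdge → ℝ, M.IsHarmPerBasis w₁ w₂ →
      ∀ᵐ α : ℝ × ℝ, ∀ T : M.SquareTiling (α.1 • w₁ + α.2 • w₂),
        IsWallpaperP 1 T.symmetryGroup ∨ IsWallpaperP 2 T.symmetryGroup ∨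
          IsWallpaperP 4 T.symmetryGroup) := by
  refine ⟨fun w hw _ => PlaneMap.nonempty_squareTiling hw.1, fun w _ hw0 T f => T.induces_iff hw0 f,
    fun h w hw hw0 T => PlaneMap.containsP2_tiling h hw hw0 T,
    fun w₁ w₂ h => PlaneMap.ae_isWallpaperP hM h⟩
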